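/- Let $n>k\ge 0$ be integers and let $d_1,\dots,d_k$ be positive integers with $\sum_{i=1}^k d_i\le n+1$. Let $X\subset\mathbb{P}^n$ be a smooth complete intersection of multidegree $(d_1,\dots,d_k)$ over a field $K$, that is, a closed subscheme of dimension $n-k$, smooth over $K$, which is the scheme-theoretic intersection of $k$ hypersurfaces of degrees $d_1,\dots,d_k$. Write $\mathcal{O}_X(m)=\mathcal{O}_{\mathbb{P}^n}(m)|_X$ for $m\in\mathbb{Z}$. Then the Hilbert polynomial $P_{\mathcal{O}_X(1)}(t)$, i.e. the polynomial of degree $\dim X$ with rational coefficients such that $P_{\mathcal{O}_X(1)}(m)=\chi(X,\mathcal{O}_X(m))$ for every integer $m$, has non-negative coefficients. -/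

import Mathlib

open AlgebraicGeometry CategoryTheory

universe u

noncomputable section

namespace ProjCI

attribute [local instance] MvPolynomial.gradedAlgebra

/-- Projective `n`-space over the field `K`, as the scheme `Proj K[x₀, …, xₙ]`. -/
abbrev PSpace (K : Type u) [Field K] (n : ℕ) : Scheme.{u} :=
  Proj (MvPolynomial.homogeneousSubmodule (Fin (n + 1)) K)

/-- The structure morphism `ℙⁿ ⟶ Spec K`. -/
def toSpecField (K : Type u) [Field K] (n : ℕ) : PSpace K n ⟶ Spec (.of K) :=
  Proj.toSpecZero (MvPolynomial.homogeneousSubmodule (Fin (n + 1)) K) ≫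
    Spec.map (CommRingCat.ofHom
      (algebraMap K (MvPolynomial.homogeneousSubmodule (Fin (n + 1)) K 0)))

/-- The standard affine open subset `D₊(x_j)` of `ℙⁿ`. -/
def chart (K : Type u) [Field K] {n : ℕ} (j : Fin (n + 1)) : (PSpace K n).Opens :=
  Proj.basicOpen (MvPolynomial.homogeneousSubmodule (Fin (n + 1)) K) (MvPolynomial.X j)

/-- For a form `f` of degree `d`, the regular function `f / x_j ^ d` on `D₊(x_j)`. -/
def dehomog {K : Type u} [Field K] {n : ℕ} (j : Fin (n + 1)) {d : ℕ}
    (f : MvPolynomial (Fin (n + 1)) K) (hf : f.IsHomogeneous d) : Γ(PSpace K n, chart K j) :=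
  (Proj.awayToSection (MvPolynomial.homogeneousSubmodule (Fin (n + 1)) K)
    (MvPolynomial.X j)).hom
      (HomogeneousLocalization.Away.mk _ (d := 1) (MvPolynomial.isHomogeneous_X K j) d f
        (by simpa using hf))

/-- The regular function `x_i / x_j` on `D₊(x_j)`. -/
def coordRatio (K : Type u) [Field K] {n : ℕ} (i j : Fin (n + 1)) : Γ(PSpace K n, chart K j) :=
  dehomog j (MvPolynomial.X i) (MvPolynomial.isHomogeneous_X K i)

lemma mapId_mul_mapId (K : Type u) [Field K] {n : ℕ} (i j : Fin (n + 1))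
    (P : Submonoid (MvPolynomial (Fin (n + 1)) K))
    (hj : Submonoid.powers (MvPolynomial.X j) ≤ P)
    (hi : Submonoid.powers (MvPolynomial.X i) ≤ P) (h₁ h₂) :
    HomogeneousLocalization.mapId (MvPolynomial.homogeneousSubmodule (Fin (n + 1)) K) hj
        (HomogeneousLocalization.Away.mk _ (d := 1) (MvPolynomial.isHomogeneous_X K j) 1
          (MvPolynomial.X i) h₁) *
      HomogeneousLocalization.mapId (MvPolynomial.homogeneousSubmodule (Fin (n + 1)) K) hi
        (HomogeneousLocalization.Away.mk _ (d := 1) (MvPolynomial.isHomogeneous_X K i) 1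
          (MvPolynomial.X j) h₂) = 1 := by
  apply HomogeneousLocalization.val_injective
  rw [HomogeneousLocalization.val_mul, HomogeneousLocalization.val_one]
  change Localization.mk (MvPolynomial.X i) (⟨MvPolynomial.X j ^ 1, hj ⟨1, rfl⟩⟩ : P) *
    Localization.mk (MvPolynomial.X j) (⟨MvPolynomial.X i ^ 1, hi ⟨1, rfl⟩⟩ : P) = 1
  rw [Localization.mk_mul]
  rw [← Localization.mk_one, Localization.mk_eq_mk_iff, Localization.r_iff_exists]
  exact ⟨1, by simp [mul_comm]⟩

lemma coordRatio_mul (K : Type u) [Field K] {n : ℕ} (i j : Fin (n + 1)) :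
    ((PSpace K n).presheaf.map (homOfLE (inf_le_right : chart K i ⊓ chart K j ≤ chart K j)).op).hom
        (coordRatio K i j) *
      ((PSpace K n).presheaf.map (homOfLE (inf_le_left : chart K i ⊓ chart K j ≤ chart K i)).op).hom
        (coordRatio K j i) = 1 := by
  refine Subtype.ext (funext fun x ↦ ?_)
  have := x.1.isPrime
  exact mapId_mul_mapId K i j (Ideal.primeCompl x.1.asHomogeneousIdeal.toIdeal)
    (Submonoid.powers_le.mpr x.2.2) (Submonoid.powers_le.mpr x.2.1) _ _

lemma map_map {X : Scheme.{u}} {U V W : X.Opens} (h : U ≤ V) (h' : V ≤ W) (s : Γ(X, W)) :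
    (X.presheaf.map (homOfLE h).op).hom ((X.presheaf.map (homOfLE h').op).hom s) =
      (X.presheaf.map (homOfLE (h.trans h')).op).hom s := by
  rw [← CommRingCat.comp_apply, ← Functor.map_comp]
  rfl

section Sections

variable {K : Type u} [Field K] {n : ℕ} {X : Scheme.{u}} (ι : X ⟶ PSpace K n)

/-- The open subset `X ∩ D₊(x_j)` of a scheme `ι : X ⟶ ℙⁿ` over `ℙⁿ`. -/
def chartOn (j : Fin (n + 1)) : X.Opens := ι ⁻¹ᵁ chart K j

/-- The ring `Γ(U, 𝒪_X)`, to be regarded as a `K`-algebra through `X ⟶ ℙⁿ ⟶ Spec K`. -/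
def Sec (_ι : X ⟶ PSpace K n) (U : X.Opens) : Type u := Γ(X, U)

instance (U : X.Opens) : CommRing (Sec ι U) := inferInstanceAs (CommRing Γ(X, U))

instance (U : X.Opens) : Algebra K (Sec ι U) :=
  RingHom.toAlgebra (R := K) (S := Sec ι U)
    ((Scheme.ΓSpecIso (.of K)).inv ≫ (ι ≫ toSpecField K n).appTop ≫
      X.presheaf.map (homOfLE le_top).op).hom

/-- Restriction of regular functions to a smaller open subset. -/
def res {U V : X.Opens} (h : U ≤ V) : Sec ι V →ₐ[K] Sec ι U where
  __ := (X.presheaf.map (homOfLE h).op).hom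
  commutes' a := by
    exact map_map h le_top _

lemma res_res {U V W : X.Opens} (h : U ≤ V) (h' : V ≤ W) (s : Sec ι W) :
    res ι h (res ι h' s) = res ι (h.trans h') s :=
  map_map h h' s

/-- The restriction to `X ∩ D₊(x_j)` of the function `x_i / x_j`. -/
def ratioOn (i j : Fin (n + 1)) : Sec ι (chartOn ι j) :=
  (ι.app (chart K j)).hom (coordRatio K i j)

lemma ratioOn_mul {U : X.Opens} {i j : Fin (n + 1)} (hi : U ≤ chartOn ι i)
    (hj : U ≤ chartOn ι j) :
    res ι hj (ratioOn ι i j) * res ι hi (ratioOn ι j i) = 1 := by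
  have nat (V : (PSpace K n).Opens) (hV : chart K i ⊓ chart K j ≤ V) (s : Γ(PSpace K n, V)) :
      (ι.app (chart K i ⊓ chart K j)).hom (((PSpace K n).presheaf.map (homOfLE hV).op).hom s) =
        (X.presheaf.map (homOfLE (ι.preimage_mono hV)).op).hom ((ι.app V).hom s) := by
    rw [← CommRingCat.comp_apply, ← CommRingCat.comp_apply, Scheme.Hom.naturality]
    rfl
  have hU : U ≤ ι ⁻¹ᵁ (chart K i ⊓ chart K j) := le_inf hi hj
  have h := congrArg (fun s ↦ (X.presheaf.map (homOfLE hU).op).hom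
    ((ι.app (chart K i ⊓ chart K j)).hom s))
    (coordRatio_mul K i j)
  simp only [map_mul, map_one, nat] at h
  rw [map_map, map_map] at h
  exact h

/-- The invertible function `x_i / x_j` on an open subset `U` of `X ∩ D₊(x_i) ∩ D₊(x_j)`. -/
def ratioUnit {U : X.Opens} {i j : Fin (n + 1)} (hi : U ≤ chartOn ι i)
    (hj : U ≤ chartOn ι j) : (Sec ι U)ˣ where
  val := res ι hj (ratioOn ι i j)
  inv := res ι hi (ratioOn ι j i)
  val_inv := ratioOn_mul ι hi hj
  inv_val := ratioOn_mul ι hj hi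

lemma res_ratioUnit_zpow {U V : X.Opens} (h : U ≤ V) {i j : Fin (n + 1)} (hi : V ≤ chartOn ι i)
    (hj : V ≤ chartOn ι j) (m : ℤ) :
    res ι h ((ratioUnit ι hi hj ^ m : (Sec ι V)ˣ) : Sec ι V) =
      ((ratioUnit ι (h.trans hi) (h.trans hj) ^ m : (Sec ι U)ˣ) : Sec ι U) := by
  have : Units.map (res ι h : Sec ι V →* Sec ι U) (ratioUnit ι hi hj) =
      ratioUnit ι (h.trans hi) (h.trans hj) := by
    ext
    exact res_res ι h hj _
  rw [← this, ← map_zpow]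
  rfl

/-- The sections over `U` of the line bundle `𝒪_X(m) = 𝒪_{ℙⁿ}(m)|_X`, for any integer `m`.
A section `s` is given by the functions `s_j = s / x_j ^ m` on the sets `U ∩ D₊(x_j)`, which are
subject to `s_j = (x_i / x_j) ^ m * s_i` on `U ∩ D₊(x_i) ∩ D₊(x_j)`. -/
def twist (m : ℤ) (U : X.Opens) : Submodule K (∀ j : Fin (n + 1), Sec ι (U ⊓ chartOn ι j)) where
  carrier := {s | ∀ i j : Fin (n + 1),
    res ι (inf_le_inf_left U inf_le_right : U ⊓ (chartOn ι i ⊓ chartOn ι j) ≤ _) (s j) =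
      ((ratioUnit ι (inf_le_right.trans inf_le_left : U ⊓ (chartOn ι i ⊓ chartOn ι j) ≤ _)
          (inf_le_right.trans inf_le_right) ^ m : (Sec ι _)ˣ) : Sec ι _) *
        res ι (inf_le_inf_left U inf_le_left) (s i)}
  add_mem' {s t} hs ht i j := by
    simp only [Pi.add_apply, map_add, mul_add, hs i j, ht i j]
  zero_mem' i j := by simp
  smul_mem' a s hs i j := by
    simp only [Pi.smul_apply, map_smul, hs i j, mul_smul_comm]

/-- Restriction of sections of `𝒪_X(m)` to a smaller open subset. -/
def twistRes (m : ℤ) {U V : X.Opens} (h : U ≤ V) : twist ι m V →ₗ[K] twist ι m U :=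
  LinearMap.restrict
    (LinearMap.pi fun j ↦
      (res ι (inf_le_inf_right (chartOn ι j) h)).toLinearMap ∘ₗ LinearMap.proj j)
    (by
      intro s hs i j
      have := congrArg (res ι (inf_le_inf_right (chartOn ι i ⊓ chartOn ι j) h)) (hs i j)
      rw [map_mul, res_ratioUnit_zpow, res_res, res_res] at this
      simpa [res_res] using this)

lemma twistRes_twistRes (m : ℤ) {U V W : X.Opens} (h : U ≤ V) (h' : V ≤ W) (s : twist ι m W) :
    twistRes ι m h (twistRes ι m h' s) = twistRes ι m (h.trans h') s := by
  apply Subtype.ext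
  funext j
  exact res_res ι _ _ _

/-- The intersection `X ∩ D₊(x_{σ 0}) ∩ … ∩ D₊(x_{σ p})`. -/
def chartInter {p : ℕ} (σ : Fin (p + 1) ↪o Fin (n + 1)) : X.Opens :=
  Finset.univ.inf fun a ↦ chartOn ι (σ a)

lemma chartInter_le {p q : ℕ} (τ : Fin (q + 1) ↪o Fin (n + 1)) (δ : Fin (p + 1) ↪o Fin (q + 1)) :
    chartInter ι τ ≤ chartInter ι (δ.trans τ) :=
  Finset.le_inf fun a _ ↦ Finset.inf_le (f := fun b ↦ chartOn ι (τ b)) (Finset.mem_univ (δ a))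

/-- The `p`-cochains of the Čech complex of `𝒪_X(m)` for the affine open covering of `X` by the
sets `X ∩ D₊(x_j)`: one section over `X ∩ D₊(x_{i_0}) ∩ … ∩ D₊(x_{i_p})` for each sequence of
indices `i_0 < … < i_p`. -/
abbrev Cochain (m : ℤ) (p : ℕ) : Type u :=
  ∀ σ : Fin (p + 1) ↪o Fin (n + 1), twist ι m (chartInter ι σ)

/-- The Čech differential
`(d c)(i_0 < … < i_{p+1}) = ∑_a (-1)^a c(i_0 < … < î_a < … < i_{p+1})`. -/
def cechD (m : ℤ) (p : ℕ) : Cochain ι m p →ₗ[K] Cochain ι m (p + 1) :=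
  LinearMap.pi fun τ ↦ ∑ a : Fin (p + 2), (-1 : ℤ) ^ (a : ℕ) •
    (twistRes ι m (chartInter_le ι τ (Fin.succAboveOrderEmb a)) ∘ₗ
      LinearMap.proj ((Fin.succAboveOrderEmb a).trans τ))

lemma cechD_apply (m : ℤ) (p : ℕ) (c : Cochain ι m p) (τ : Fin (p + 2) ↪o Fin (n + 1)) :
    cechD ι m p c τ = ∑ a : Fin (p + 2), (-1 : ℤ) ^ (a : ℕ) •
      twistRes ι m (chartInter_le ι τ (Fin.succAboveOrderEmb a))
        (c ((Fin.succAboveOrderEmb a).trans τ)) := by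
  simp [cechD, LinearMap.sum_apply]

lemma cechD_cechD (m : ℤ) (p : ℕ) : cechD ι m (p + 1) ∘ₗ cechD ι m p = 0 := by
  refine LinearMap.ext fun c ↦ funext fun τ ↦ ?_
  simp only [LinearMap.comp_apply, LinearMap.zero_apply, Pi.zero_apply]
  simp only [cechD_apply, map_sum, map_zsmul, Finset.smul_sum, smul_smul, twistRes_twistRes]
  rw [← Finset.sum_product', Finset.univ_product_univ]
  have key (σ σ' : Fin (p + 1) ↪o Fin (n + 1)) (h : σ = σ')
      (hσ : chartInter ι τ ≤ chartInter ι σ) (hσ' : chartInter ι τ ≤ chartInter ι σ') :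
      twistRes ι m hσ (c σ) = twistRes ι m hσ' (c σ') := by
    subst h
    rfl
  refine Finset.sum_involution (fun x _ ↦ (x.1.succAbove x.2, x.2.predAbove x.1)) ?_ ?_ ?_ ?_
  · rintro ⟨a, b⟩ -
    rw [key _ (((b.predAbove a).succAboveOrderEmb).trans ((a.succAbove b).succAboveOrderEmb.trans τ))
      ?_ _ ((chartInter_le ι τ _).trans (chartInter_le ι _ _)), ← add_smul, ← pow_add, ← pow_add,
      Fin.neg_one_pow_succAbove_add_predAbove, add_neg_cancel, zero_smul]
    ext x
    exact congrArg (fun y ↦ (τ y : ℕ)) (Fin.succAbove_succAbove_succAbove_predAbove a b x).symm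
  · rintro ⟨a, b⟩ - - h
    exact Fin.succAbove_ne a b (congrArg Prod.fst h)
  · simp
  · rintro ⟨a, b⟩ -
    exact Prod.ext (Fin.succAbove_succAbove_predAbove a b)
      (Fin.predAbove_predAbove_succAbove a b)

/-- The Čech complex of `𝒪_X(m)` for the covering of `X` by the sets `X ∩ D₊(x_j)`. -/
def cechComplex (m : ℤ) : CochainComplex (ModuleCat.{u} K) ℕ :=
  CochainComplex.of (fun p ↦ ModuleCat.of K (Cochain ι m p))
    (fun p ↦ ModuleCat.ofHom (cechD ι m p))
    (fun p ↦ by rw [← ModuleCat.ofHom_comp, cechD_cechD]; rfl)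

/-- The cohomology `H^p(X, 𝒪_X(m))`. When `ι` is a closed immersion, the open sets
`X ∩ D₊(x_j)` and their intersections are affine and `𝒪_X(m)` is coherent, so that the cohomology
is computed by the Čech complex. -/
def cohomology (m : ℤ) (p : ℕ) : ModuleCat.{u} K := (cechComplex ι m).homology p

/-- The Euler characteristic `χ(X, 𝒪_X(m)) = ∑_p (-1)^p dim H^p(X, 𝒪_X(m))`; there are no
cochains, hence no cohomology, in degrees `p > n`. -/
def eulerChar (m : ℤ) : ℤ :=
  ∑ p ∈ Finset.range (n + 1), (-1 : ℤ) ^ p * (Module.finrank K (cohomology ι m p) : ℤ)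

/-- `P` is the Hilbert polynomial of `X` with respect to `𝒪_X(1)`: the spaces `H^p(X, 𝒪_X(m))`
are finite-dimensional, `P` has degree `dim X`, and `P(m) = χ(X, 𝒪_X(m))` for every integer
`m`. -/
structure IsHilbertPolynomial (P : Polynomial ℚ) : Prop where
  finite : ∀ (m : ℤ) (p : ℕ), Module.Finite K (cohomology ι m p)
  degree : ((P.natDegree : ℕ∞) : WithBot ℕ∞) = topologicalKrullDim X
  eval : ∀ m : ℤ, P.eval (m : ℚ) = (eulerChar ι m : ℚ)

/-- `ι : X ⟶ ℙⁿ` is a complete intersection of multidegree `(d_1, …, d_k)`: it is a closed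
subscheme of dimension `n - k`, and it is the scheme-theoretic intersection of `k` hypersurfaces
`f_i = 0`, where `f_i` is a form of degree `d_i`, that is, on each `D₊(x_j)` its ideal is
generated by the functions `f_i / x_j ^ {d_i}`. -/
structure IsCompleteIntersection {k : ℕ} (d : Fin k → ℕ) : Prop where
  isClosedImmersion : IsClosedImmersion ι
  exists_eqs : ∃ (f : Fin k → MvPolynomial (Fin (n + 1)) K) (hf : ∀ i, (f i).IsHomogeneous (d i)),
    ∀ j : Fin (n + 1), RingHom.ker (ι.app (chart K j)).hom =
      Ideal.span (Set.range fun i ↦ dehomog j (f i) (hf i))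
  dim : topologicalKrullDim X + k = n

end Sections

end ProjCI

end

/-! The proof computes the Hilbert polynomial and then locates its zeros.

Let `S` be the shift `t ↦ t - 1`. The Hilbert polynomial is `∏ (1 - S^{d_i})` applied to `(t + 1) ⋯
(t + n) / n!`; this is `hilb`, identified in `isHilbertPolynomial_hilb`. Over `ℂ` each `1 - S^d` is
a product of factors `1 - ω S` with `|ω| = 1`. Such a factor sends `(t + 1) ⋯ (t + m + 1) g(t)` to
`(t + 1) ⋯ (t + m)` times `(t + m + 1) g(t) - ω t g(t - 1)`. If the zeros of `g` lie far enough to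
the left, the first term strictly dominates the second to the right of the line `Re t = -(m + 1) /
2`, because `|t + m + 1| > |t|` and `|g(t)| ≥ |g(t - 1)|` there. After at most `n + 1` factors no
zero has positive real part (`nonvanishing_hilb`). A real polynomial with this property and positive
leading coefficient is a product of a positive constant with factors `X + a` and `X² + b X + c`,
where `a, b, c ≥ 0`, so its coefficients are non-negative (`coeff_nonneg_of_nonvanishingRight`).

For the Euler characteristics, sections of `𝒪(m)` over an intersection of standard charts are
Laurent polynomials of degree `m`. The Čech complex of `𝒪_X(m)` is the quotient of the complex for
the whole polynomial ring by the one for the localized ideal `(f_1, …, f_k)`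
(`exists_shortExact_cechComplex`). The former is computed monomial by monomial
(`finCoh_supp_expSet`). The latter is reached by adding one equation at a time
(`exists_shortExact_locDeg`), which gives the recursion defining `hilb`, provided that each `f_i` is
a nonzerodivisor modulo the preceding ones. That is the Cohen–Macaulay property of the polynomial
ring at the vertex of the affine cone (`mem_initialIdeal_of_mul_mem`): the local ring has depth `n +
1`, and the cone over `X` has dimension at most `dim X + 1 = n + 1 - k`. -/

noncomputable section

namespace ProjCI

/-! ### Zeros and coefficients of the Hilbert polynomials -/

section HilbertPolynomials

open Polynomial

/-- `g` does not vanish on the half plane `c < Re t`. -/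
def NonvanishingRight (g : ℂ[X]) (c : ℝ) : Prop := ∀ t : ℂ, c < t.re → g.eval t ≠ 0

lemma norm_prod_sub_one_sub_le {t : ℂ} (s : Multiset ℂ) (h : ∀ a ∈ s, ‖t - 1 - a‖ < ‖t - a‖) :
    ‖(s.map fun a ↦ t - 1 - a).prod‖ ≤ ‖(s.map fun a ↦ t - a).prod‖ ∧
      (s ≠ 0 → ‖(s.map fun a ↦ t - 1 - a).prod‖ < ‖(s.map fun a ↦ t - a).prod‖) := by
  induction s using Multiset.induction_on with
  | empty => simp
  | cons a s ih =>
    have h1 := (ih fun b hb ↦ h b (Multiset.mem_cons_of_mem hb)).1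
    have h2 := h a (Multiset.mem_cons_self a s)
    have h3 : 0 < ‖(s.map fun a ↦ t - a).prod‖ := by
      rw [norm_pos_iff]
      apply Multiset.prod_ne_zero
      simp only [Multiset.mem_map, not_exists, not_and]
      intro b hb h0
      have := h b (Multiset.mem_cons_of_mem hb)
      rw [h0, norm_zero] at this
      exact absurd this (not_lt.mpr (norm_nonneg _))
    have key : ‖((a ::ₘ s).map fun a ↦ t - 1 - a).prod‖ <
        ‖((a ::ₘ s).map fun a ↦ t - a).prod‖ := by
      simp only [Multiset.map_cons, Multiset.prod_cons, norm_mul]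
      calc _ ≤ ‖t - 1 - a‖ * ‖(s.map fun a ↦ t - a).prod‖ := by gcongr
        _ < _ := by gcongr
    exact ⟨key.le, fun _ ↦ key⟩

lemma norm_sub_one_lt {t : ℂ} (h : 1 / 2 < t.re) : ‖t - 1‖ < ‖t‖ := by
  rw [← sq_lt_sq₀ (norm_nonneg _) (norm_nonneg _), ← Complex.normSq_eq_norm_sq,
    ← Complex.normSq_eq_norm_sq, Complex.normSq_apply, Complex.normSq_apply]
  simp only [Complex.sub_re, Complex.one_re, Complex.sub_im, Complex.one_im]
  nlinarith

lemma eval_eq_prod_roots_complex (g : ℂ[X]) (t : ℂ) :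
    g.eval t = g.leadingCoeff * (g.roots.map fun a ↦ t - a).prod := by
  conv_lhs => rw [(IsAlgClosed.splits g).eq_prod_roots]
  simp [eval_multiset_prod, Multiset.map_map]

/-- Every root `a` has `Re a ≤ c`, so `t - 1` is closer to `a` than `t` is. Comparing the two
factorizations factor by factor gives the inequality, and one root is enough to make it strict. -/
lemma NonvanishingRight.norm_eval_sub_one_le {g : ℂ[X]} {c : ℝ} (hg : NonvanishingRight g c)
    {t : ℂ} (ht : c + 1 / 2 < t.re) : ‖g.eval (t - 1)‖ ≤ ‖g.eval t‖ ∧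
      (g.natDegree ≠ 0 → ‖g.eval (t - 1)‖ < ‖g.eval t‖) := by
  have h0 : g ≠ 0 := by
    rintro rfl
    exact hg (c + 1 : ℝ) (by simp) (by simp)
  have hr (a) (ha : a ∈ g.roots) : ‖t - 1 - a‖ < ‖t - a‖ := by
    have : a.re ≤ c := by
      by_contra! h
      exact hg a h (isRoot_of_mem_roots ha)
    have := norm_sub_one_lt (t := t - a) (by simp; linarith)
    rwa [sub_right_comm] at this
  have := norm_prod_sub_one_sub_le g.roots hr
  have hl : 0 < ‖g.leadingCoeff‖ := by simpa
  rw [eval_eq_prod_roots_complex g, eval_eq_prod_roots_complex g, norm_mul, norm_mul]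
  refine ⟨by gcongr; exact this.1, fun hd ↦ ?_⟩
  gcongr
  refine this.2 fun h ↦ hd ?_
  rw [(IsAlgClosed.splits g).natDegree_eq_card_roots, h, Multiset.card_zero]

/-- The shift operator `p ↦ p(X - 1)`. -/
def shiftOne : Module.End ℂ ℂ[X] := (aeval (X - 1 : ℂ[X])).toLinearMap

lemma shiftOne_apply (p : ℂ[X]) : shiftOne p = p.comp (X - 1) := rfl

lemma shiftOne_pow_apply (d : ℕ) (p : ℂ[X]) : (shiftOne ^ d) p = p.comp (X - C (d : ℂ)) := by
  induction d with
  | zero => simp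
  | succ d ih =>
    rw [pow_succ', Module.End.mul_apply, ih, shiftOne_apply, comp_assoc]
    congr 1
    simp only [sub_comp, X_comp, C_comp, Nat.cast_succ, map_add, map_one]
    ring

/-- The polynomial `(X + 1) ⋯ (X + m)`. -/
def risingProd (R : Type*) [CommRing R] (m : ℕ) : R[X] := ∏ j ∈ Finset.range m, (X + C ((j : R) + 1))

/-- The effect of `1 - ω S` on the cofactor of the rising product. The line `Re t = -(m + 1) / 2` is
where `|t| = |t + m + 1|`. It lies exactly `1/2` to the right of the line assumed for `g`, which is
what `norm_eval_sub_one_le` requires. To its right the two terms have different absolute values and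
cannot cancel. -/
lemma NonvanishingRight.sub_smul_shift {g : ℂ[X]} {m : ℕ}
    (hg : NonvanishingRight g (-((m : ℝ) + 2) / 2)) {ω : ℂ} (hω : ‖ω‖ = 1) :
    NonvanishingRight ((X + C ((m : ℂ) + 1)) * g - C ω * X * g.comp (X - 1)) (-((m : ℝ) + 1) / 2) := by
  intro t ht h0
  have h1 := (hg.norm_eval_sub_one_le (t := t) (by linarith)).1
  have h2 : 0 < ‖g.eval t‖ := by
    rw [norm_pos_iff]
    exact hg t (by linarith)
  simp only [eval_sub, eval_mul, eval_add, eval_X, eval_C, eval_comp, eval_one, sub_eq_zero] at h0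
  have h3 := congrArg norm h0
  rw [norm_mul, norm_mul, norm_mul, hω, one_mul] at h3
  have h4 : ‖t‖ < ‖t + (m + 1)‖ := by
    rw [← sq_lt_sq₀ (norm_nonneg _) (norm_nonneg _), ← Complex.normSq_eq_norm_sq,
      ← Complex.normSq_eq_norm_sq, Complex.normSq_apply, Complex.normSq_apply]
    simp only [Complex.add_re, Complex.natCast_re, Complex.one_re, Complex.add_im,
      Complex.natCast_im, Complex.one_im]
    have : (0 : ℝ) ≤ m := m.cast_nonneg
    nlinarith
  have : ‖t‖ * ‖g.eval (t - 1)‖ < ‖t + (m + 1)‖ * ‖g.eval t‖ :=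
    calc _ ≤ ‖t‖ * ‖g.eval t‖ := by gcongr
      _ < _ := by gcongr
  exact this.ne' h3

lemma risingProd_succ_comp (m : ℕ) :
    (risingProd ℂ (m + 1)).comp (X - 1) = X * risingProd ℂ m := by
  rw [risingProd, Finset.prod_range_succ', risingProd, mul_comp, Polynomial.prod_comp, mul_comm]
  congr 1
  · simp
  · refine Finset.prod_congr rfl fun j _ ↦ ?_
    simp only [add_comp, X_comp, C_comp, one_comp, Nat.cast_succ, map_add, map_one]
    ring

/-- Each factor `1 - ω S` uses up one linear factor of the rising product and moves the bound on the
zeros of the cofactor to the right by `1/2`. The induction starts from the cofactor `1`. -/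
lemma exists_aeval_shiftOne_eq (n : ℕ) (l : List ℂ) (hl : ∀ ω ∈ l, ‖ω‖ = 1) (m : ℕ)
    (hm : l.length + m = n) : ∃ g : ℂ[X], NonvanishingRight g (-((m : ℝ) + 1) / 2) ∧
      aeval shiftOne (l.map fun ω ↦ 1 - C ω * X).prod (risingProd ℂ n) = risingProd ℂ m * g := by
  induction l generalizing m with
  | nil =>
    obtain rfl : m = n := by simpa using hm
    exact ⟨1, fun t _ ↦ by simp, by simp⟩
  | cons ω l ih =>
    obtain ⟨g, hg, h⟩ := ih (fun ω' h' ↦ hl ω' (List.mem_cons_of_mem _ h')) (m + 1)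
      (by rw [List.length_cons] at hm; omega)
    refine ⟨_, NonvanishingRight.sub_smul_shift (m := m) (g := g) ?_ (hl ω List.mem_cons_self), ?_⟩
    · convert hg using 2
      push_cast
      ring
    · rw [List.map_cons, List.prod_cons, map_mul, Module.End.mul_apply, h]
      simp only [map_sub, map_one, map_mul, aeval_C, aeval_X, LinearMap.sub_apply,
        Module.End.one_apply, Module.End.mul_apply, shiftOne_apply, Module.algebraMap_end_apply,
        mul_comp, risingProd_succ_comp]
      rw [risingProd, Finset.prod_range_succ, ← risingProd, smul_eq_C_mul]
      ring

lemma exists_list_prod_one_sub (d : ℕ) (hd : 0 < d) : ∃ l : List ℂ, (∀ ω ∈ l, ‖ω‖ = 1) ∧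
    l.length = d ∧ (l.map fun ω ↦ 1 - C ω * X).prod = (1 - X ^ d : ℂ[X]) := by
  have hp := Complex.isPrimitiveRoot_exp d hd.ne'
  refine ⟨(nthRootsFinset d (1 : ℂ)).toList, fun ω hω ↦ ?_, ?_, ?_⟩
  · rw [Finset.mem_toList, mem_nthRootsFinset hd] at hω
    exact Complex.norm_eq_one_of_pow_eq_one hω hd.ne'
  · rw [Finset.length_toList, hp.card_nthRootsFinset]
  · refine Polynomial.funext fun t ↦ ?_
    have := hp.pow_sub_pow_eq_prod_sub_mul 1 t hd
    rw [one_pow] at this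
    simp [Finset.prod_map_toList, eval_prod, this]

lemma exists_list_prod_prod_one_sub (k : ℕ) (d : ℕ → ℕ) (hd : ∀ i < k, 0 < d i) :
    ∃ l : List ℂ, (∀ ω ∈ l, ‖ω‖ = 1) ∧ l.length = ∑ i ∈ Finset.range k, d i ∧
      (l.map fun ω ↦ 1 - C ω * X).prod = (∏ i ∈ Finset.range k, (1 - X ^ d i) : ℂ[X]) := by
  induction k with
  | zero => exact ⟨[], by simp⟩
  | succ k ih =>
    obtain ⟨l, h1, h2, h3⟩ := ih fun i hi ↦ hd i (hi.trans k.lt_succ_self)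
    obtain ⟨l', h1', h2', h3'⟩ := exists_list_prod_one_sub (d k) (hd k k.lt_succ_self)
    refine ⟨l ++ l', fun ω hω ↦ ?_, ?_, ?_⟩
    · exact (List.mem_append.mp hω).elim (h1 ω) (h1' ω)
    · rw [List.length_append, h2, h2', Finset.sum_range_succ]
    · rw [List.map_append, List.prod_append, h3, h3', Finset.prod_range_succ]

/-- The Hilbert polynomials of the successive intersections of hypersurfaces of degrees
`d 0, d 1, …` in `ℙⁿ`. -/
def hilb (n : ℕ) (d : ℕ → ℕ) : ℕ → ℚ[X]
  | 0 => C ((n.factorial : ℚ)⁻¹) * risingProd ℚ n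
  | i + 1 => hilb n d i - (hilb n d i).comp (X - C (d i : ℚ))

lemma map_risingProd {R S : Type*} [CommRing R] [CommRing S] (f : R →+* S) (m : ℕ) :
    (risingProd R m).map f = risingProd S m := by
  simp [risingProd, Polynomial.map_prod]

/-- The recursion for `hilb` applies the operator `1 - S^{d_i}`, and these operators are polynomials
in the single operator `shiftOne`. -/
lemma map_hilb (n : ℕ) (d : ℕ → ℕ) (k : ℕ) : (hilb n d k).map (algebraMap ℚ ℂ) =
    C ((n.factorial : ℂ)⁻¹) *
      aeval shiftOne (∏ i ∈ Finset.range k, (1 - X ^ d i) : ℂ[X]) (risingProd ℂ n) := by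
  induction k with
  | zero => simp [hilb, map_risingProd]
  | succ k ih =>
    rw [hilb, Polynomial.map_sub, map_comp, ih, Finset.prod_range_succ,
      mul_comm (∏ i ∈ Finset.range k, (1 - X ^ d i : ℂ[X])), map_mul, Module.End.mul_apply]
    simp only [Polynomial.map_sub, map_X, map_natCast, Polynomial.map_natCast, map_one, map_pow, aeval_X,
      LinearMap.sub_apply, Module.End.one_apply, map_sub, shiftOne_pow_apply, mul_comp, C_comp]
    ring

/-- By Taylor expansion the top coefficients cancel, and the next one is `(D + 1) d` times the
leading coefficient of `p`. -/
lemma natDegree_sub_comp {p : ℚ[X]} {D d : ℕ} (hp : p.natDegree = D + 1)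
    (hl : 0 < p.leadingCoeff) (hd : 0 < d) :
    (p - p.comp (X - C (d : ℚ))).natDegree = D ∧
      0 < (p - p.comp (X - C (d : ℚ))).leadingCoeff := by
  have ht : p.comp (X - C (d : ℚ)) = taylor (-(d : ℚ)) p := by
    rw [taylor_apply, C_neg, sub_eq_add_neg]
  have h1 (j : ℕ) (hj : D < j) : (p - p.comp (X - C (d : ℚ))).coeff j = 0 := by
    rw [ht, coeff_sub]
    rcases (show D + 1 ≤ j from hj).eq_or_lt with rfl | h
    · rw [taylor_coeff, ← hp, hasseDeriv_natDegree_eq_C, eval_C, leadingCoeff, sub_self]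
    · rw [coeff_eq_zero_of_natDegree_lt (by omega),
        coeff_eq_zero_of_natDegree_lt (by rw [natDegree_taylor]; omega), sub_self]
  have h2 : (p - p.comp (X - C (d : ℚ))).coeff D = (D + 1) * p.leadingCoeff * d := by
    have h3 : (hasseDeriv D p).natDegree ≤ 1 := by
      have := natDegree_hasseDeriv_le p D
      omega
    rw [ht, coeff_sub, taylor_coeff, eq_X_add_C_of_natDegree_le_one h3, hasseDeriv_coeff,
      hasseDeriv_coeff, leadingCoeff, hp]
    simp [add_comm 1 D]
  have h4 : 0 < (p - p.comp (X - C (d : ℚ))).coeff D := by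
    rw [h2]
    positivity
  have h5 : (p - p.comp (X - C (d : ℚ))).natDegree = D :=
    natDegree_eq_of_le_of_coeff_ne_zero
      (natDegree_le_iff_coeff_eq_zero.mpr fun j hj ↦ h1 j hj) h4.ne'
  exact ⟨h5, by rwa [leadingCoeff, h5]⟩

lemma natDegree_risingProd (m : ℕ) : (risingProd ℚ m).natDegree = m ∧
    (risingProd ℚ m).leadingCoeff = 1 := by
  have h : (risingProd ℚ m).Monic := monic_prod_of_monic _ _ fun i _ ↦ monic_X_add_C _
  refine ⟨?_, h⟩
  rw [risingProd, natDegree_prod_of_monic _ _ fun i _ ↦ monic_X_add_C _]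
  simp only [natDegree_X_add_C, Finset.sum_const, Finset.card_range, smul_eq_mul, mul_one]

lemma natDegree_hilb (n : ℕ) (d : ℕ → ℕ) (k : ℕ) (hd : ∀ i < k, 0 < d i) (m : ℕ)
    (hm : m + k = n) : (hilb n d k).natDegree = m ∧ 0 < (hilb n d k).leadingCoeff := by
  induction k generalizing m with
  | zero =>
    obtain rfl : m = n := hm
    have h0 : (0 : ℚ) < (m.factorial : ℚ)⁻¹ := by positivity
    rw [hilb, natDegree_C_mul h0.ne', leadingCoeff_mul, leadingCoeff_C,
      (natDegree_risingProd m).2, mul_one]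
    exact ⟨(natDegree_risingProd m).1, h0⟩
  | succ k ih =>
    obtain ⟨h1, h2⟩ := ih (fun i hi ↦ hd i (hi.trans k.lt_succ_self)) (m + 1) (by omega)
    exact natDegree_sub_comp h1 h2 (hd k k.lt_succ_self)

/-- If `∑ d_i ≤ n`, then `hilb` is, up to a constant, a rising product with negative roots times a
cofactor without zeros to the right of a line `Re t = -(m + 1) / 2`. If `∑ d_i = n + 1`, the rising
product is exhausted one factor too early and the last `1 - ω S` needs a strict inequality. This is
where `k < n` enters: `hilb` then has positive degree. -/
lemma nonvanishing_hilb (n : ℕ) (d : ℕ → ℕ) (k : ℕ) (hk : k < n) (hd : ∀ i < k, 0 < d i)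
    (hs : ∑ i ∈ Finset.range k, d i ≤ n + 1) :
    NonvanishingRight ((hilb n d k).map (algebraMap ℚ ℂ)) 0 := by
  obtain ⟨l, h1, h2, h3⟩ := exists_list_prod_prod_one_sub k d hd
  have hdeg : ((hilb n d k).map (algebraMap ℚ ℂ)).natDegree ≠ 0 := by
    rw [natDegree_map, (natDegree_hilb n d k hd (n - k) (by omega)).1]
    omega
  have hfac : (n.factorial : ℂ)⁻¹ ≠ 0 := inv_ne_zero (by exact_mod_cast n.factorial_ne_zero)
  rw [map_hilb, ← h3] at hdeg ⊢
  rw [natDegree_C_mul hfac] at hdeg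
  intro t ht
  rw [eval_mul, eval_C]
  refine mul_ne_zero hfac ?_
  rcases hs.lt_or_eq with hs | hs
  · obtain ⟨g, hg, h⟩ := exists_aeval_shiftOne_eq n l h1 (n - ∑ i ∈ Finset.range k, d i) (by omega)
    rw [h, eval_mul]
    have hpos : (0 : ℝ) ≤ ((n - ∑ i ∈ Finset.range k, d i : ℕ) : ℝ) := Nat.cast_nonneg _
    refine mul_ne_zero ?_ (hg t (by linarith))
    rw [risingProd, eval_prod]
    refine Finset.prod_ne_zero_iff.mpr fun j _ h0 ↦ ?_
    have := congrArg Complex.re h0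
    simp at this
    have : (0 : ℝ) ≤ j := j.cast_nonneg
    linarith
  -- One root of unity `ω` is set aside. The other `n` leave a cofactor `g` whose zeros have real
  -- part at most `-1/2`. If `g` were constant, so would be `g - ω g(t - 1)`; hence `|g(t - 1)| <
  -- |g(t)|` strictly for `Re t > 0`.
  · match l with
    | [] =>
      rw [List.length_nil] at h2
      omega
    | ω :: l =>
      rw [List.length_cons] at h2
      obtain ⟨g, hg, h⟩ := exists_aeval_shiftOne_eq n l
        (fun ω' h' ↦ h1 ω' (List.mem_cons_of_mem _ h')) 0 (by omega)
      rw [List.map_cons, List.prod_cons, map_mul, Module.End.mul_apply, h] at hdeg ⊢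
      simp only [map_sub, map_one, map_mul, aeval_C, aeval_X, LinearMap.sub_apply,
        Module.End.one_apply, Module.End.mul_apply, shiftOne_apply, Module.algebraMap_end_apply,
        risingProd, Finset.range_zero, Finset.prod_empty, one_mul] at hdeg ⊢
      have hg0 : g.natDegree ≠ 0 := by
        intro h0
        rw [eq_C_of_natDegree_eq_zero h0, C_comp, ← C_mul', ← C_mul, ← C_sub] at hdeg
        exact hdeg (natDegree_C _)
      have := (hg.norm_eval_sub_one_le (t := t) (by push_cast; linarith)).2 hg0
      rw [eval_sub, eval_smul, eval_comp, eval_sub, eval_X, eval_one, sub_ne_zero]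
      intro h0
      have h0 := congrArg norm h0
      rw [norm_smul, h1 ω List.mem_cons_self, one_mul] at h0
      exact this.ne' h0

lemma coeff_mul_nonneg {p q : ℝ[X]} (hp : ∀ i, 0 ≤ p.coeff i) (hq : ∀ i, 0 ≤ q.coeff i) (i : ℕ) :
    0 ≤ (p * q).coeff i := by
  rw [coeff_mul]
  exact Finset.sum_nonneg fun x _ ↦ mul_nonneg (hp _) (hq _)

/-- A complex root `z` with `Re z ≤ 0` splits off `X - z` if it is real, and `X² - 2 (Re z) X +
|z|²` otherwise. Both factors are monic with non-negative coefficients, and the quotient satisfies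
the same hypotheses in smaller degree. -/
lemma coeff_nonneg_of_nonvanishingRight (D : ℕ) (p : ℝ[X]) (hD : p.natDegree ≤ D)
    (hl : 0 ≤ p.leadingCoeff) (hp : NonvanishingRight (p.map (algebraMap ℝ ℂ)) 0) (i : ℕ) :
    0 ≤ p.coeff i := by
  induction D using Nat.strong_induction_on generalizing p i with
  | _ D ih =>
    by_cases h0 : p.natDegree = 0
    · rw [eq_C_of_natDegree_eq_zero h0] at hl ⊢
      rw [leadingCoeff_C] at hl
      rw [coeff_C]
      split_ifs <;> simp [hl]
    have step (r q : ℝ[X]) (hr : r.Monic) (hr0 : 0 < r.natDegree) (hri : ∀ i, 0 ≤ r.coeff i)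
        (h : p = r * q) : 0 ≤ p.coeff i := by
      have hq : q ≠ 0 := by
        rintro rfl
        simp [h] at h0
      have hdeg : p.natDegree = r.natDegree + q.natDegree := by
        rw [h, hr.natDegree_mul' hq]
      rw [h]
      refine coeff_mul_nonneg hri (fun j ↦ ih q.natDegree (by omega) q le_rfl ?_ ?_ j) i
      · rwa [h, leadingCoeff_mul, hr.leadingCoeff, one_mul] at hl
      · intro t ht h1
        refine hp t ht ?_
        rw [h, Polynomial.map_mul, eval_mul, h1, mul_zero]
    obtain ⟨z, hz⟩ := IsAlgClosed.exists_root (p.map (algebraMap ℝ ℂ)) (by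
      rw [degree_map]
      intro h
      exact h0 (natDegree_eq_of_degree_eq_some h))
    have hzre : z.re ≤ 0 := by
      by_contra! h
      exact hp z h hz
    have hz' : aeval z p = 0 := by rwa [IsRoot, eval_map_algebraMap] at hz
    by_cases him : z.im = 0
    · have : p.IsRoot z.re := by
        have hzz : z = algebraMap ℝ ℂ z.re := Complex.ext (by simp) (by simp [him])
        rw [hzz, aeval_algebraMap_apply] at hz'
        simpa using hz'
      obtain ⟨q, hq⟩ := dvd_iff_isRoot.mpr this
      refine step _ q (monic_X_sub_C _) (by simp) (fun j ↦ ?_) hq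
      rcases j with _ | _ | j
      · simpa using hzre
      · simp
      · rw [coeff_eq_zero_of_natDegree_lt (by simp)]
    · obtain ⟨q, hq⟩ := quadratic_dvd_of_aeval_eq_zero_im_ne_zero p hz' him
      have hform : (X ^ 2 - C (2 * z.re) * X + C (‖z‖ ^ 2) : ℝ[X]) =
          C 1 * X ^ 2 + C (-(2 * z.re)) * X + C (‖z‖ ^ 2) := by
        simp only [C_neg, C_1]
        ring
      have hc : 0 ≤ ‖z‖ ^ 2 := sq_nonneg _
      rw [hform] at hq
      generalize ‖z‖ ^ 2 = c at hq hc
      have hdeg := natDegree_quadratic (R := ℝ) (b := -(2 * z.re)) (c := c) one_ne_zero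
      refine step _ q (leadingCoeff_quadratic one_ne_zero) (by rw [hdeg]; simp) (fun j ↦ ?_) hq
      rcases j with _ | _ | _ | j
      · simpa using hc
      · have : 2 * z.re ≤ 0 := by linarith
        simpa [coeff_C] using this
      · simp
      · rw [coeff_eq_zero_of_natDegree_lt (by rw [hdeg]; omega)]

lemma coeff_hilb_nonneg (n : ℕ) (d : ℕ → ℕ) (k : ℕ) (hk : k < n) (hd : ∀ i < k, 0 < d i)
    (hs : ∑ i ∈ Finset.range k, d i ≤ n + 1) (i : ℕ) : 0 ≤ (hilb n d k).coeff i := by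
  have h := coeff_nonneg_of_nonvanishingRight _ ((hilb n d k).map (algebraMap ℚ ℝ)) le_rfl
    (by
      rw [leadingCoeff_map, eq_ratCast]
      exact_mod_cast (natDegree_hilb n d k hd (n - k) (by omega)).2.le)
    (by
      rw [Polynomial.map_map, ← IsScalarTower.algebraMap_eq]
      exact nonvanishing_hilb n d k hk hd hs) i
  rw [coeff_map, eq_ratCast] at h
  exact_mod_cast h

end HilbertPolynomials

/-! ### Euler characteristics of complexes and short exact sequences -/

section Homological

variable {K : Type u} [Field K]

/-- The cohomology of `C` is finite-dimensional, vanishes in degrees `> n`, and `χ` is its Euler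
characteristic. -/
structure FinCoh (n : ℕ) (C : CochainComplex (ModuleCat.{u} K) ℕ) (χ : ℤ) : Prop where
  finite (p : ℕ) : Module.Finite K (C.homology p)
  subsingleton (p : ℕ) : n < p → Subsingleton (C.homology p)
  euler : ∑ p ∈ Finset.range (n + 1), (-1 : ℤ) ^ p * (Module.finrank K (C.homology p) : ℤ) = χ

section LongExact

variable {A B C : ℕ → Type u} [∀ p, AddCommGroup (A p)] [∀ p, AddCommGroup (B p)]
  [∀ p, AddCommGroup (C p)] [∀ p, Module K (A p)] [∀ p, Module K (B p)] [∀ p, Module K (C p)]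
  {f : ∀ p, A p →ₗ[K] B p} {g : ∀ p, B p →ₗ[K] C p} {δ : ∀ p, C p →ₗ[K] A (p + 1)}

lemma finite_of_exact {U V W : Type u} [AddCommGroup U] [AddCommGroup V] [AddCommGroup W]
    [Module K U] [Module K V] [Module K W] {f : U →ₗ[K] V} {g : V →ₗ[K] W}
    (h : Function.Exact f g) [Module.Finite K U] [Module.Finite K W] : Module.Finite K V := by
  have h1 : Module.Finite K (LinearMap.ker g) := by
    rw [LinearMap.exact_iff.mp h]
    infer_instance
  have h2 : Module.Finite K (V ⧸ LinearMap.ker g) :=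
    Module.Finite.equiv g.quotKerEquivRange.symm
  exact Module.Finite.of_submodule_quotient (LinearMap.ker g)

lemma finrank_add_of_exact {U V W : Type u} [AddCommGroup U] [AddCommGroup V] [AddCommGroup W]
    [Module K U] [Module K V] [Module K W] {f : U →ₗ[K] V} {g : V →ₗ[K] W}
    (h : Function.Exact f g) [Module.Finite K V] :
    Module.finrank K V = Module.finrank K (LinearMap.range f) +
      Module.finrank K (LinearMap.range g) := by
  rw [← LinearMap.finrank_range_add_finrank_ker g, LinearMap.exact_iff.mp h, add_comm]

lemma sum_neg_one_pow_mul_add (r : ℕ → ℤ) (n : ℕ) :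
    ∑ p ∈ Finset.range (n + 1), (-1 : ℤ) ^ p * (r p + r (p + 1)) = r 0 + (-1) ^ n * r (n + 1) := by
  induction n with
  | zero => simp
  | succ n ih => rw [Finset.sum_range_succ, ih]; ring

/-- With `r p` the rank of the connecting map into `A p`, each dimension is a sum of two
neighbouring ranks. All ranks cancel in the alternating sum except `r 0` and `r (n + 1)`, both of
which vanish. -/
lemma euler_of_long_exact (n : ℕ) [∀ p, Module.Finite K (A p)] [∀ p, Module.Finite K (B p)]
    [∀ p, Module.Finite K (C p)]
    (h0 : Function.Injective (f 0)) (h1 : ∀ p, Function.Exact (δ p) (f (p + 1)))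
    (h2 : ∀ p, Function.Exact (f p) (g p)) (h3 : ∀ p, Function.Exact (g p) (δ p))
    [Subsingleton (A (n + 1))] :
    ∑ p ∈ Finset.range (n + 1), (-1 : ℤ) ^ p * (Module.finrank K (B p) : ℤ) =
      ∑ p ∈ Finset.range (n + 1), (-1 : ℤ) ^ p * (Module.finrank K (A p) : ℤ) +
      ∑ p ∈ Finset.range (n + 1), (-1 : ℤ) ^ p * (Module.finrank K (C p) : ℤ) := by
  let r : ℕ → ℤ := fun p ↦ match p with
    | 0 => 0
    | p + 1 => Module.finrank K (LinearMap.range (δ p))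
  have hr : r (n + 1) = 0 := by
    have : Subsingleton (LinearMap.range (δ n)) := inferInstance
    simp [r, Module.finrank_zero_of_subsingleton]
  have hA (p : ℕ) : (Module.finrank K (A p) : ℤ) = r p + Module.finrank K (LinearMap.range (f p)) := by
    cases p with
    | zero => simp [r, LinearMap.finrank_range_of_inj h0]
    | succ p => simp only [r]; exact_mod_cast finrank_add_of_exact (h1 p)
  have hB (p : ℕ) : (Module.finrank K (B p) : ℤ) = Module.finrank K (LinearMap.range (f p)) +
      Module.finrank K (LinearMap.range (g p)) := by
    exact_mod_cast finrank_add_of_exact (h2 p)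
  have hC (p : ℕ) : (Module.finrank K (C p) : ℤ) = Module.finrank K (LinearMap.range (g p)) +
      r (p + 1) := by
    simp only [r]; exact_mod_cast finrank_add_of_exact (h3 p)
  have := sum_neg_one_pow_mul_add r n
  rw [hr] at this
  simp only [r, mul_zero, add_zero] at this
  rw [← Finset.sum_add_distrib, ← sub_eq_zero, ← Finset.sum_sub_distrib, ← neg_eq_zero, ← this,
    ← Finset.sum_neg_distrib]
  refine Finset.sum_congr rfl fun p _ ↦ ?_
  rw [hA, hB, hC]
  simp only [r]
  ring

end LongExact

variable {n : ℕ} {S : ShortComplex (CochainComplex (ModuleCat.{u} K) ℕ)}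

/-- In degree `0` there are no coboundaries, so cohomology is the space of cycles, which preserves
monomorphisms. -/
lemma injective_homologyMap_zero (hS : S.ShortExact) :
    Function.Injective (HomologicalComplex.homologyMap S.f 0).hom := by
  have := hS.mono_f
  have h1 : Mono (HomologicalComplex.cyclesMap S.f 0) := inferInstance
  have h2 := CochainComplex.isoHomologyπ₀_inv_naturality S.f
  have h3 : Mono (HomologicalComplex.homologyMap S.f 0) := by
    have : Mono (HomologicalComplex.homologyMap S.f 0 ≫ S.X₂.isoHomologyπ₀.inv) := by
      rw [h2]; infer_instance
    exact mono_of_mono _ S.X₂.isoHomologyπ₀.inv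
  exact (ModuleCat.mono_iff_injective _).mp h3

lemma exact_hom {S : ShortComplex (ModuleCat.{u} K)} (h : S.Exact) :
    Function.Exact S.f.hom S.g.hom :=
  (ShortComplex.ShortExact.moduleCat_exact_iff_function_exact S).mp h

lemma subsingleton_of_exact {U V W : Type u} [AddCommGroup U] [AddCommGroup V] [AddCommGroup W]
    [Module K U] [Module K V] [Module K W] {f : U →ₗ[K] V} {g : V →ₗ[K] W}
    (h : Function.Exact f g) [Subsingleton U] [Subsingleton W] : Subsingleton V := by
  refine subsingleton_of_forall_eq 0 fun v ↦ ?_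
  obtain ⟨u, rfl⟩ := (h v).mp (Subsingleton.elim _ _)
  rw [Subsingleton.elim u 0, map_zero]

lemma FinCoh.euler_add (hS : S.ShortExact) {a b c : ℤ} (h1 : FinCoh n S.X₁ a)
    (h2 : FinCoh n S.X₂ b) (h3 : FinCoh n S.X₃ c) : b = a + c := by
  have := h1.finite
  have := h2.finite
  have := h3.finite
  have := h1.subsingleton (n + 1) (by omega)
  rw [← h1.euler, ← h2.euler, ← h3.euler]
  exact euler_of_long_exact n (injective_homologyMap_zero hS)
    (fun p ↦ exact_hom (hS.homology_exact₁ p (p + 1) rfl))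
    (fun p ↦ exact_hom (hS.homology_exact₂ p))
    (fun p ↦ exact_hom (hS.homology_exact₃ p (p + 1) rfl))

/-- `H^p` of the quotient lies between `H^p` of the middle term and `H^{p+1}` of the subcomplex, so
finiteness and vanishing in degrees `> n` pass to the quotient. -/
lemma FinCoh.right (hS : S.ShortExact) {a b : ℤ} (h1 : FinCoh n S.X₁ a)
    (h2 : FinCoh n S.X₂ b) : FinCoh n S.X₃ (b - a) := by
  suffices h : ∃ c, FinCoh n S.X₃ c by
    obtain ⟨c, h3⟩ := h
    rwa [eq_sub_of_add_eq' (FinCoh.euler_add hS h1 h2 h3).symm] at h3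
  refine ⟨_, fun p ↦ ?_, fun p hp ↦ ?_, rfl⟩
  · have := h1.finite (p + 1)
    have := h2.finite p
    exact finite_of_exact (exact_hom (hS.homology_exact₃ p (p + 1) rfl))
  · have := h1.subsingleton (p + 1) (by omega)
    have := h2.subsingleton p hp
    exact subsingleton_of_exact (exact_hom (hS.homology_exact₃ p (p + 1) rfl))

lemma FinCoh.middle (hS : S.ShortExact) {a c : ℤ} (h1 : FinCoh n S.X₁ a)
    (h3 : FinCoh n S.X₃ c) : FinCoh n S.X₂ (a + c) := by
  suffices h : ∃ b, FinCoh n S.X₂ b by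
    obtain ⟨b, h2⟩ := h
    rwa [FinCoh.euler_add hS h1 h2 h3] at h2
  refine ⟨_, fun p ↦ ?_, fun p hp ↦ ?_, rfl⟩
  · have := h1.finite p
    have := h3.finite p
    exact finite_of_exact (exact_hom (hS.homology_exact₂ p))
  · have := h1.subsingleton p hp
    have := h3.subsingleton p hp
    exact subsingleton_of_exact (exact_hom (hS.homology_exact₂ p))

section Data

variable {A B C : ℕ → Type u} [∀ p, AddCommGroup (A p)] [∀ p, AddCommGroup (B p)]
  [∀ p, AddCommGroup (C p)] [∀ p, Module K (A p)] [∀ p, Module K (B p)] [∀ p, Module K (C p)]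

/-- The cochain complex with terms `A p` and differentials `d p`. -/
abbrev ofLinearMaps (d : ∀ p, A p →ₗ[K] A (p + 1)) (hd : ∀ p, d (p + 1) ∘ₗ d p = 0) :
    CochainComplex (ModuleCat.{u} K) ℕ :=
  CochainComplex.of (fun p ↦ ModuleCat.of K (A p)) (fun p ↦ ModuleCat.ofHom (d p))
    (fun p ↦ by rw [← ModuleCat.ofHom_comp, hd]; rfl)

variable {dA : ∀ p, A p →ₗ[K] A (p + 1)} (hA : ∀ p, dA (p + 1) ∘ₗ dA p = 0)
  {dB : ∀ p, B p →ₗ[K] B (p + 1)} (hB : ∀ p, dB (p + 1) ∘ₗ dB p = 0)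
  {dC : ∀ p, C p →ₗ[K] C (p + 1)} (hC : ∀ p, dC (p + 1) ∘ₗ dC p = 0)

lemma ofLinearMaps_d (p : ℕ) : (ofLinearMaps dA hA).d p (p + 1) = ModuleCat.ofHom (dA p) :=
  CochainComplex.of_d (fun p ↦ ModuleCat.of K (A p)) (fun p ↦ ModuleCat.ofHom (dA p)) p

lemma ofLinearMaps_d_apply (p : ℕ) (x : A p) :
    ((ofLinearMaps dA hA).d p (p + 1)).hom x = dA p x := by
  rw [ofLinearMaps_d]
  rfl

lemma exists_shortExact_ofLinearMaps (f : ∀ p, A p →ₗ[K] B p) (g : ∀ p, B p →ₗ[K] C p)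
    (hf : ∀ p, dB p ∘ₗ f p = f (p + 1) ∘ₗ dA p) (hg : ∀ p, dC p ∘ₗ g p = g (p + 1) ∘ₗ dB p)
    (inj : ∀ p, Function.Injective (f p)) (surj : ∀ p, Function.Surjective (g p))
    (exact : ∀ p, Function.Exact (f p) (g p)) :
    ∃ S : ShortComplex (CochainComplex (ModuleCat.{u} K) ℕ), S.ShortExact ∧
      S.X₁ = ofLinearMaps dA hA ∧ S.X₂ = ofLinearMaps dB hB ∧ S.X₃ = ofLinearMaps dC hC := by
  let F : ofLinearMaps dA hA ⟶ ofLinearMaps dB hB := CochainComplex.ofHom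
    (fun p ↦ ModuleCat.ofHom (f p)) (fun p ↦ by
      rw [ofLinearMaps_d, ofLinearMaps_d, ← ModuleCat.ofHom_comp, ← ModuleCat.ofHom_comp,
        hf])
  let G : ofLinearMaps dB hB ⟶ ofLinearMaps dC hC := CochainComplex.ofHom
    (fun p ↦ ModuleCat.ofHom (g p)) (fun p ↦ by
      rw [ofLinearMaps_d, ofLinearMaps_d, ← ModuleCat.ofHom_comp, ← ModuleCat.ofHom_comp,
        hg])
  refine ⟨ShortComplex.mk F G ?_, ?_, rfl, rfl, rfl⟩
  · ext p x
    exact (exact p).apply_apply_eq_zero x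
  · refine HomologicalComplex.shortExact_of_degreewise_shortExact _ fun p ↦ ?_
    exact ModuleCat.shortComplex_shortExact _ (exact p) (inj p) (surj p)

/-- A null-homotopy of the identity makes every cocycle a coboundary. Degree `0` is stated
separately because there the homotopy has only one term. -/
lemma finCoh_of_contraction (n : ℕ) (h : ∀ p, A (p + 1) →ₗ[K] A p)
    (h0 : ∀ x, h 0 (dA 0 x) = x) (h1 : ∀ p x, dA p (h p x) + h (p + 1) (dA (p + 1) x) = x) :
    FinCoh n (ofLinearMaps dA hA) 0 := by
  have key (p : ℕ) : Subsingleton ((ofLinearMaps dA hA).homology p) := by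
    rw [← ModuleCat.isZero_iff_subsingleton, ← HomologicalComplex.exactAt_iff_isZero_homology]
    cases p with
    | zero =>
      rw [HomologicalComplex.exactAt_iff' _ 0 0 1 (by simp) (by simp),
        ShortComplex.moduleCat_exact_iff]
      intro x hx
      refine ⟨0, ?_⟩
      have hx' : dA 0 x = 0 := (ofLinearMaps_d_apply hA 0 x).symm.trans hx
      have h2 : h 0 (dA 0 x) = 0 := (congrArg _ hx').trans (map_zero _)
      rw [map_zero]
      exact h2.symm.trans (h0 x)
    | succ p =>
      rw [HomologicalComplex.exactAt_iff' _ p (p + 1) (p + 2) (by simp) (by simp),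
        ShortComplex.moduleCat_exact_iff]
      intro x hx
      refine ⟨h p x, ?_⟩
      have hx' : dA (p + 1) x = 0 := (ofLinearMaps_d_apply hA (p + 1) x).symm.trans hx
      refine (ofLinearMaps_d_apply hA p _).trans ?_
      have := h1 p x
      rwa [hx', map_zero, add_zero] at this
  refine ⟨fun p ↦ inferInstance, fun p _ ↦ key p, ?_⟩
  exact Finset.sum_eq_zero fun p _ ↦ by rw [Module.finrank_zero_of_subsingleton]; simp

lemma finrank_homology (S : ShortComplex (ModuleCat.{u} K)) [Module.Finite K S.X₂] :
    Module.Finite K S.homology ∧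
    Module.finrank K S.X₂ = Module.finrank K S.homology + Module.finrank K (LinearMap.range S.f.hom)
      + Module.finrank K (LinearMap.range S.g.hom) := by
  let e := S.moduleCatHomologyIso.toLinearEquiv
  have h1 : Module.Finite K S.moduleCatLeftHomologyData.H :=
    inferInstanceAs (Module.Finite K (LinearMap.ker S.g.hom ⧸ LinearMap.range S.moduleCatToCycles))
  refine ⟨Module.Finite.equiv e.symm, ?_⟩
  rw [e.finrank_eq, ← LinearMap.finrank_range_add_finrank_ker S.g.hom,
    ← Submodule.finrank_quotient_add_finrank (LinearMap.range S.moduleCatToCycles)]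
  have h2 : Module.finrank K (LinearMap.range S.moduleCatToCycles) =
      Module.finrank K (LinearMap.range S.f.hom) := by
    have h3 : S.f.hom = (LinearMap.ker S.g.hom).subtype ∘ₗ S.moduleCatToCycles := rfl
    rw [h3, LinearMap.range_comp]
    exact (LinearEquiv.finrank_eq (Submodule.equivMapOfInjective _
      (Submodule.subtype_injective _) _))
  rw [h2, add_comm]
  rfl

/-- For finite-dimensional terms the Euler characteristic can be read off from the terms: with `r p`
the rank of the differential into degree `p`, the contributions of the ranks telescope. -/
lemma finCoh_of_finite (n : ℕ) [∀ p, Module.Finite K (A p)] (h : ∀ p, n < p → Subsingleton (A p)) :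
    FinCoh n (ofLinearMaps dA hA)
      (∑ p ∈ Finset.range (n + 1), (-1 : ℤ) ^ p * (Module.finrank K (A p) : ℤ)) := by
  let D := ofLinearMaps dA hA
  have hX (p : ℕ) : Module.Finite K (D.sc p).X₂ := inferInstanceAs (Module.Finite K (A p))
  let r : ℕ → ℤ := fun p ↦ match p with
    | 0 => 0
    | p + 1 => Module.finrank K (LinearMap.range (dA p))
  have hg (p : ℕ) : (Module.finrank K (LinearMap.range (D.sc p).g.hom) : ℤ) = r (p + 1) := by
    have key (q : ℕ) (hq : q = p + 1) :
        (Module.finrank K (LinearMap.range (D.d p q).hom) : ℤ) = r (p + 1) := by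
      subst hq
      have : (D.d p (p + 1)).hom = dA p := LinearMap.ext (ofLinearMaps_d_apply hA p)
      rw [this]
    exact key _ (by simp)
  have hf (p : ℕ) : (Module.finrank K (LinearMap.range (D.sc p).f.hom) : ℤ) = r p := by
    cases p with
    | zero =>
      have : (D.sc 0).f = 0 := D.shape _ _ (by simp)
      rw [this]
      simp [r]
    | succ p =>
      have key (q : ℕ) (hq : q = p) :
          (Module.finrank K (LinearMap.range (D.d q (p + 1)).hom) : ℤ) = r (p + 1) := by
        subst hq
        have : (D.d q (q + 1)).hom = dA q := LinearMap.ext (ofLinearMaps_d_apply hA q)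
        rw [this]
      exact key _ (by simp)
  have hr : r (n + 1) = 0 := by
    have := h (n + 1) (by omega)
    simp [r, Module.finrank_zero_of_subsingleton]
  refine ⟨fun p ↦ (finrank_homology (D.sc p)).1, fun p hp ↦ ?_, ?_⟩
  · rw [← ModuleCat.isZero_iff_subsingleton, ← HomologicalComplex.exactAt_iff_isZero_homology]
    refine ShortComplex.exact_of_isZero_X₂ _ ?_
    exact ModuleCat.isZero_iff_subsingleton.mpr (h p hp)
  · have hd (p : ℕ) : (Module.finrank K (A p) : ℤ) =
        Module.finrank K (D.homology p) + (r p + r (p + 1)) := by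
      rw [← hf, ← hg, ← add_assoc]
      exact_mod_cast (finrank_homology (D.sc p)).2
    have := sum_neg_one_pow_mul_add r n
    rw [hr] at this
    simp only [hd, mul_add, Finset.sum_add_distrib] at this ⊢
    rw [this]
    simp [r, D]

end Data

end Homological

/-! ### Čech complexes with values in a monotone family of subspaces -/

section SubCech

variable (K : Type u) [Field K] (V : Type u) [AddCommGroup V] [Module K V] (n : ℕ)

/-- The Čech differential on cochains with values in a fixed vector space. -/
def cechV (p : ℕ) : ((Fin (p + 1) ↪o Fin (n + 1)) → V) →ₗ[K] ((Fin (p + 2) ↪o Fin (n + 1)) → V) :=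
  LinearMap.pi fun τ ↦ ∑ a : Fin (p + 2), (-1 : ℤ) ^ (a : ℕ) •
    LinearMap.proj ((Fin.succAboveOrderEmb a).trans τ)

variable {K V n}

lemma cechV_apply (p : ℕ) (c : (Fin (p + 1) ↪o Fin (n + 1)) → V) (τ : Fin (p + 2) ↪o Fin (n + 1)) :
    cechV K V n p c τ = ∑ a : Fin (p + 2), (-1 : ℤ) ^ (a : ℕ) •
      c ((Fin.succAboveOrderEmb a).trans τ) := by
  simp [cechV, LinearMap.sum_apply]

lemma cechV_cechV (p : ℕ) (c : (Fin (p + 1) ↪o Fin (n + 1)) → V) :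
    cechV K V n (p + 1) (cechV K V n p c) = 0 := by
  refine funext fun τ ↦ ?_
  simp only [Pi.zero_apply]
  simp only [cechV_apply, Finset.smul_sum, smul_smul]
  rw [← Finset.sum_product', Finset.univ_product_univ]
  refine Finset.sum_involution (fun x _ ↦ (x.1.succAbove x.2, x.2.predAbove x.1)) ?_ ?_ ?_ ?_
  · rintro ⟨a, b⟩ -
    have : (b.succAboveOrderEmb.trans (a.succAboveOrderEmb.trans τ)) =
        (((b.predAbove a).succAboveOrderEmb).trans ((a.succAbove b).succAboveOrderEmb.trans τ)) := by
      ext x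
      exact congrArg (fun y ↦ (τ y : ℕ)) (Fin.succAbove_succAbove_succAbove_predAbove a b x).symm
    dsimp only
    rw [this, ← add_smul, ← pow_add, ← pow_add,
      Fin.neg_one_pow_succAbove_add_predAbove, add_neg_cancel, zero_smul]
  · rintro ⟨a, b⟩ - - h
    exact Fin.succAbove_ne a b (congrArg Prod.fst h)
  · simp
  · rintro ⟨a, b⟩ -
    exact Prod.ext (Fin.succAbove_succAbove_predAbove a b)
      (Fin.predAbove_predAbove_succAbove a b)

/-- The set of values of an increasing sequence of indices. -/
def vertices {p : ℕ} (σ : Fin (p + 1) ↪o Fin (n + 1)) : Finset (Fin (n + 1)) :=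
  Finset.univ.map σ.toEmbedding

lemma mem_vertices {p : ℕ} {σ : Fin (p + 1) ↪o Fin (n + 1)} {i : Fin (n + 1)} :
    i ∈ vertices σ ↔ ∃ a, σ a = i := by
  simp [vertices]

lemma vertices_nonempty {p : ℕ} (σ : Fin (p + 1) ↪o Fin (n + 1)) : (vertices σ).Nonempty :=
  ⟨σ 0, mem_vertices.mpr ⟨0, rfl⟩⟩

lemma card_vertices {p : ℕ} (σ : Fin (p + 1) ↪o Fin (n + 1)) : (vertices σ).card = p + 1 := by
  simp [vertices]

lemma vertices_face {p : ℕ} (τ : Fin (p + 2) ↪o Fin (n + 1)) (a : Fin (p + 2)) :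
    vertices (a.succAboveOrderEmb.trans τ) = (vertices τ).erase (τ a) := by
  ext i
  simp only [mem_vertices, Finset.mem_erase]
  constructor
  · rintro ⟨b, rfl⟩
    exact ⟨fun h ↦ Fin.succAbove_ne a b (τ.injective h), _, rfl⟩
  · rintro ⟨h, b, rfl⟩
    obtain ⟨c, rfl⟩ := Fin.exists_succAbove_eq (x := b) (y := a) (fun hb ↦ h (hb ▸ rfl))
    exact ⟨c, rfl⟩

/-- The cochains whose value at `σ` lies in the given subspace. -/
def subCochain (F : Finset (Fin (n + 1)) → Submodule K V) (p : ℕ) :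
    Submodule K ((Fin (p + 1) ↪o Fin (n + 1)) → V) where
  carrier := {c | ∀ σ, c σ ∈ F (vertices σ)}
  add_mem' hc hc' σ := (F _).add_mem (hc σ) (hc' σ)
  zero_mem' _ := (F _).zero_mem
  smul_mem' a _ hc σ := (F _).smul_mem a (hc σ)

variable {F : Finset (Fin (n + 1)) → Submodule K V} (hF : Monotone F)

include hF in
lemma cechV_mem (p : ℕ) {c : (Fin (p + 1) ↪o Fin (n + 1)) → V} (hc : c ∈ subCochain F p) :
    cechV K V n p c ∈ subCochain F (p + 1) := by
  intro τ
  rw [cechV_apply]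
  refine Submodule.sum_mem _ fun a _ ↦ (F _).toAddSubgroup.zsmul_mem ?_ _
  refine hF ?_ (hc _)
  rw [vertices_face]
  exact Finset.erase_subset _ _

/-- The Čech differential on `subCochain`. -/
def cechSub (p : ℕ) : subCochain F p →ₗ[K] subCochain F (p + 1) :=
  (cechV K V n p).restrict fun _ hc ↦ cechV_mem hF p hc

lemma cechSub_cechSub (p : ℕ) : cechSub hF (p + 1) ∘ₗ cechSub hF p = 0 :=
  LinearMap.ext fun c ↦ Subtype.ext (cechV_cechV p c.1)

/-- The Čech complex of a monotone family of subspaces of a vector space. -/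
abbrev subCech : CochainComplex (ModuleCat.{u} K) ℕ :=
  ofLinearMaps (cechSub hF) (cechSub_cechSub hF)

/-- All coefficient spaces sit inside one vector space, so a linear map of the ambient spaces
commutes with the Čech differentials automatically. Exactness of the complexes reduces to exactness
of `F₁ s → F₂ s → F₃ s` for each nonempty `s`. -/
lemma exists_shortExact_subCech {V₁ V₂ V₃ : Type u} [AddCommGroup V₁] [AddCommGroup V₂]
    [AddCommGroup V₃] [Module K V₁] [Module K V₂] [Module K V₃]
    {F₁ : Finset (Fin (n + 1)) → Submodule K V₁} (hF₁ : Monotone F₁)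
    {F₂ : Finset (Fin (n + 1)) → Submodule K V₂} (hF₂ : Monotone F₂)
    {F₃ : Finset (Fin (n + 1)) → Submodule K V₃} (hF₃ : Monotone F₃)
    (α : V₁ →ₗ[K] V₂) (β : V₂ →ₗ[K] V₃) (hα : Function.Injective α)
    (h₁ : ∀ s, s.Nonempty → ∀ v ∈ F₁ s, α v ∈ F₂ s ∧ β (α v) = 0)
    (h₂ : ∀ s, s.Nonempty → ∀ v ∈ F₂ s, β v ∈ F₃ s ∧ (β v = 0 → ∃ w ∈ F₁ s, α w = v))
    (h₃ : ∀ s, s.Nonempty → ∀ v ∈ F₃ s, ∃ w ∈ F₂ s, β w = v) :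
    ∃ S : ShortComplex (CochainComplex (ModuleCat.{u} K) ℕ), S.ShortExact ∧
      S.X₁ = subCech hF₁ ∧ S.X₂ = subCech hF₂ ∧ S.X₃ = subCech hF₃ := by
  let f (p : ℕ) : subCochain F₁ p →ₗ[K] subCochain F₂ p :=
    (α.compLeft (Fin (p + 1) ↪o Fin (n + 1))).restrict
      fun c hc σ ↦ (h₁ _ (vertices_nonempty σ) _ (hc σ)).1
  let g (p : ℕ) : subCochain F₂ p →ₗ[K] subCochain F₃ p :=
    (β.compLeft (Fin (p + 1) ↪o Fin (n + 1))).restrict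
      fun c hc σ ↦ (h₂ _ (vertices_nonempty σ) _ (hc σ)).1
  refine exists_shortExact_ofLinearMaps _ _ _ f g ?_ ?_ ?_ ?_ ?_
  · refine fun p ↦ LinearMap.ext fun c ↦ Subtype.ext (funext fun τ ↦ ?_)
    change cechV K V₂ n p (fun σ ↦ α (c.1 σ)) τ = α (cechV K V₁ n p c.1 τ)
    simp [cechV_apply]
  · refine fun p ↦ LinearMap.ext fun c ↦ Subtype.ext (funext fun τ ↦ ?_)
    change cechV K V₃ n p (fun σ ↦ β (c.1 σ)) τ = β (cechV K V₂ n p c.1 τ)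
    simp [cechV_apply]
  · intro p c c' h
    refine Subtype.ext (funext fun σ ↦ hα ?_)
    exact congrFun (congrArg Subtype.val h) σ
  · intro p c
    choose w hw hw' using fun σ ↦ h₃ _ (vertices_nonempty σ) _ (c.2 σ)
    exact ⟨⟨w, hw⟩, Subtype.ext (funext hw')⟩
  · intro p c
    constructor
    · intro h
      choose w hw hw' using fun σ ↦ (h₂ _ (vertices_nonempty σ) _ (c.2 σ)).2
        (congrFun (congrArg Subtype.val h) σ)
      exact ⟨⟨w, hw⟩, Subtype.ext (funext hw')⟩
    · rintro ⟨w, rfl⟩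
      exact Subtype.ext (funext fun σ ↦ (h₁ _ (vertices_nonempty σ) _ (w.2 σ)).2)

lemma FinCoh.prod {V₁ V₂ : Type u} [AddCommGroup V₁] [AddCommGroup V₂]
    [Module K V₁] [Module K V₂]
    {F₁ : Finset (Fin (n + 1)) → Submodule K V₁} {hF₁ : Monotone F₁}
    {F₂ : Finset (Fin (n + 1)) → Submodule K V₂} {hF₂ : Monotone F₂}
    (hF : Monotone fun s ↦ (F₁ s).prod (F₂ s)) {a b : ℤ}
    (h₁ : FinCoh n (subCech hF₁) a) (h₂ : FinCoh n (subCech hF₂) b) :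
    FinCoh n (subCech hF) (a + b) := by
  obtain ⟨S, hS, e₁, e₂, e₃⟩ := exists_shortExact_subCech hF₁ hF hF₂
    (LinearMap.inl K V₁ V₂) (LinearMap.snd K V₁ V₂) LinearMap.inl_injective
    (fun s _ v hv ↦ ⟨⟨hv, (F₂ s).zero_mem⟩, rfl⟩)
    (fun s _ v hv ↦ ⟨hv.2, fun h ↦ ⟨v.1, hv.1, Prod.ext rfl h.symm⟩⟩)
    (fun s _ v hv ↦ ⟨(0, v), ⟨(F₁ s).zero_mem, hv⟩, rfl⟩)
  rw [← e₁] at h₁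
  rw [← e₃] at h₂
  rw [← e₂]
  exact FinCoh.middle hS h₁ h₂

/-- The sign of `i` in the Čech differential at `τ`. -/
def cechSign (i : Fin (n + 1)) (τ : Finset (Fin (n + 1))) : ℤ :=
  (-1) ^ (τ.filter (· < i)).card

lemma cechSign_mul_self (i : Fin (n + 1)) (τ : Finset (Fin (n + 1))) :
    cechSign i τ * cechSign i τ = 1 := by
  rw [cechSign, ← mul_pow]
  simp

lemma cechSign_erase_self (i : Fin (n + 1)) (τ : Finset (Fin (n + 1))) :
    cechSign i (τ.erase i) = cechSign i τ := by
  rw [cechSign, cechSign]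
  congr 2
  ext l
  simp only [Finset.mem_filter, Finset.mem_erase]
  exact ⟨fun h ↦ ⟨h.1.2, h.2⟩, fun h ↦ ⟨⟨h.2.ne, h.1⟩, h.2⟩⟩

lemma cechSign_insert_self (i : Fin (n + 1)) (τ : Finset (Fin (n + 1))) :
    cechSign i (insert i τ) = cechSign i τ := by
  rw [cechSign, cechSign, Finset.filter_insert, if_neg (lt_irrefl i)]

/-- Exactly one of `i < j`, `j < i` holds, so exactly one of the two signs changes when the other
index is inserted or removed. This produces the cancellation in the contraction. -/
lemma cechSign_mul_swap {i j : Fin (n + 1)} {τ : Finset (Fin (n + 1))} (hi : i ∈ τ) (hj : j ∉ τ) :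
    cechSign j τ * cechSign i (insert j τ) = -(cechSign i τ * cechSign j (τ.erase i)) := by
  have hij : i ≠ j := fun h ↦ hj (h ▸ hi)
  rcases lt_or_gt_of_ne hij with h | h
  · have h1 : cechSign i (insert j τ) = cechSign i τ := by
      rw [cechSign, cechSign, Finset.filter_insert, if_neg h.not_gt]
    have h2 : cechSign j τ = - cechSign j (τ.erase i) := by
      conv_lhs => rw [← Finset.insert_erase hi, cechSign, Finset.filter_insert, if_pos h,
        Finset.card_insert_of_notMem (by simp), pow_succ]
      rw [cechSign, mul_neg_one]
    rw [h1, h2]; ring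
  · have h1 : cechSign i (insert j τ) = - cechSign i τ := by
      rw [cechSign, Finset.filter_insert, if_pos h,
        Finset.card_insert_of_notMem (by simp [hj]), pow_succ, cechSign, mul_neg_one]
    have h2 : cechSign j (τ.erase i) = cechSign j τ := by
      conv_rhs => rw [← Finset.insert_erase hi, cechSign, Finset.filter_insert, if_neg h.not_gt]
      rw [cechSign]
    rw [h1, h2]; ring

/-- The Čech differential on functions of all finite sets of indices. -/
def finsetD (C : Finset (Fin (n + 1)) → V) (τ : Finset (Fin (n + 1))) : V :=
  ∑ i ∈ τ, cechSign i τ • C (τ.erase i)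

/-- The contraction of the Čech complex by means of the index `j`. -/
def finsetH (j : Fin (n + 1)) (C : Finset (Fin (n + 1)) → V) (σ : Finset (Fin (n + 1))) : V :=
  if j ∈ σ then 0 else cechSign j σ • C (insert j σ)

/-- The cone construction with apex `j`. If `j ∈ τ`, only the term removing `j` survives. Otherwise
the term of `finsetD C (insert j τ)` removing `j` gives `C τ`, and the others cancel in pairs by
`cechSign_mul_swap`. -/
lemma finsetD_finsetH_add (j : Fin (n + 1)) (C : Finset (Fin (n + 1)) → V)
    (τ : Finset (Fin (n + 1))) :
    finsetD (finsetH j C) τ + finsetH j (finsetD C) τ = C τ := by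
  by_cases hj : j ∈ τ
  · rw [finsetH, if_pos hj, add_zero, finsetD, Finset.sum_eq_single_of_mem j hj]
    · rw [finsetH, if_neg (by simp), smul_smul, cechSign_erase_self, cechSign_mul_self, one_smul,
        Finset.insert_erase hj]
    · intro i _ hij
      rw [finsetH, if_pos (Finset.mem_erase.mpr ⟨hij.symm, hj⟩), smul_zero]
  · rw [finsetH, if_neg hj, finsetD, finsetD, Finset.sum_insert hj, smul_add, smul_smul,
      cechSign_insert_self, cechSign_mul_self, one_smul, Finset.erase_insert hj,
      add_left_comm, Finset.smul_sum, ← Finset.sum_add_distrib]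
    rw [Finset.sum_eq_zero, add_zero]
    intro i hi
    have hij : i ≠ j := fun h ↦ hj (h ▸ hi)
    rw [finsetH, if_neg fun h ↦ hj (Finset.mem_of_mem_erase h), smul_smul, smul_smul,
      cechSign_mul_swap hi hj, Finset.erase_insert_of_ne hij.symm, neg_smul, add_neg_cancel]

/-- The function of finite sets which agrees with the `p`-cochain `c` on sets with `p + 1` elements
and is zero elsewhere. -/
def cochainExt {p : ℕ} (c : (Fin (p + 1) ↪o Fin (n + 1)) → V) (s : Finset (Fin (n + 1))) : V :=
  if h : s.card = p + 1 then c (s.orderEmbOfFin h) else 0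

lemma orderEmbOfFin_vertices {p : ℕ} (σ : Fin (p + 1) ↪o Fin (n + 1)) :
    (vertices σ).orderEmbOfFin (card_vertices σ) = σ := by
  symm
  apply Finset.orderEmbOfFin_unique'
  intro a
  exact mem_vertices.mpr ⟨a, rfl⟩

lemma vertices_orderEmbOfFin {p : ℕ} (s : Finset (Fin (n + 1))) (h : s.card = p + 1) :
    vertices (s.orderEmbOfFin h) = s := by
  refine Finset.eq_of_subset_of_card_le (fun i hi ↦ ?_) (by rw [card_vertices, h])
  obtain ⟨a, rfl⟩ := mem_vertices.mp hi
  exact Finset.orderEmbOfFin_mem _ _ _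

lemma cochainExt_vertices {p : ℕ} (c : (Fin (p + 1) ↪o Fin (n + 1)) → V)
    (σ : Fin (p + 1) ↪o Fin (n + 1)) : cochainExt c (vertices σ) = c σ := by
  rw [cochainExt, dif_pos (card_vertices σ), orderEmbOfFin_vertices]

lemma cochainExt_eq {p : ℕ} (C : Finset (Fin (n + 1)) → V) (hC : ∀ s, s.card ≠ p + 1 → C s = 0) :
    cochainExt (fun σ : Fin (p + 1) ↪o Fin (n + 1) ↦ C (vertices σ)) = C := by
  funext s
  by_cases h : s.card = p + 1
  · rw [cochainExt, dif_pos h, vertices_orderEmbOfFin]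
  · rw [cochainExt, dif_neg h, hC s h]

lemma cechSign_vertices {p : ℕ} (τ : Fin (p + 1) ↪o Fin (n + 1)) (a : Fin (p + 1)) :
    cechSign (τ a) (vertices τ) = (-1) ^ (a : ℕ) := by
  rw [cechSign]
  congr 1
  have : (vertices τ).filter (· < τ a) = (Finset.Iio a).map τ.toEmbedding := by
    ext i
    simp only [Finset.mem_filter, mem_vertices, Finset.mem_map, Finset.mem_Iio]
    constructor
    · rintro ⟨⟨b, rfl⟩, h⟩
      exact ⟨b, τ.lt_iff_lt.mp h, rfl⟩
    · rintro ⟨b, h, rfl⟩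
      exact ⟨⟨b, rfl⟩, τ.lt_iff_lt.mpr h⟩
  rw [this, Finset.card_map, Fin.card_Iio]

lemma cechV_eq_finsetD (p : ℕ) (c : (Fin (p + 1) ↪o Fin (n + 1)) → V) :
    cechV K V n p c = fun τ ↦ finsetD (cochainExt c) (vertices τ) := by
  funext τ
  have h (g : Fin (n + 1) → V) : ∑ i ∈ vertices τ, g i = ∑ a, g (τ a) :=
    Finset.sum_map _ _ _
  rw [cechV_apply, finsetD, h]
  refine Finset.sum_congr rfl fun a _ ↦ ?_
  rw [cechSign_vertices, ← vertices_face, cochainExt_vertices]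

lemma cochainExt_cechV (p : ℕ) (c : (Fin (p + 1) ↪o Fin (n + 1)) → V) :
    cochainExt (cechV K V n p c) = finsetD (cochainExt c) := by
  rw [cechV_eq_finsetD]
  refine cochainExt_eq _ fun s hs ↦ Finset.sum_eq_zero fun i hi ↦ ?_
  rw [cochainExt, dif_neg, smul_zero]
  rw [Finset.card_erase_of_mem hi]
  have := Finset.card_pos.mpr ⟨i, hi⟩
  omega

include hF in
/-- The Čech complex is acyclic if the identity is a sum of projectors `π j` such that
`π j` kills the difference between `F (insert j s)` and `F s`. -/
lemma finCoh_zero_of_projectors (π : Fin (n + 1) → V →ₗ[K] V) (hπ : ∀ v, ∑ j, π j v = v)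
    (h : ∀ j s, ∀ v ∈ F (insert j s), π j v ∈ F s) (h0 : F ∅ = ⊥) :
    FinCoh n (subCech hF) 0 := by
  have hadd {p : ℕ} (c c' : (Fin (p + 1) ↪o Fin (n + 1)) → V) (s) :
      cochainExt (c + c') s = cochainExt c s + cochainExt c' s := by
    rw [cochainExt, cochainExt, cochainExt]; split_ifs <;> simp
  have hsmul {p : ℕ} (a : K) (c : (Fin (p + 1) ↪o Fin (n + 1)) → V) (s) :
      cochainExt (a • c) s = a • cochainExt c s := by
    rw [cochainExt, cochainExt]; split_ifs <;> simp
  have hext {p : ℕ} {c : (Fin (p + 1) ↪o Fin (n + 1)) → V} (hc : c ∈ subCochain F p) (s) :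
      cochainExt c s ∈ F s := by
    rw [cochainExt]
    split_ifs with hs
    · have := hc (s.orderEmbOfFin hs)
      rwa [vertices_orderEmbOfFin] at this
    · exact (F s).zero_mem
  -- Each summand of the identity is contracted towards its own apex. Inserting `j` may enlarge the
  -- coefficient space, and applying `π j` brings the value back into `F s`.
  let H (C : Finset (Fin (n + 1)) → V) (s : Finset (Fin (n + 1))) : V :=
    ∑ j, π j (finsetH j C s)
  have hH (C : Finset (Fin (n + 1)) → V) (hC : ∀ s, C s ∈ F s) (s) : H C s ∈ F s := by
    refine Submodule.sum_mem _ fun j _ ↦ ?_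
    rw [finsetH]
    split_ifs
    · rw [map_zero]; exact (F s).zero_mem
    · rw [map_zsmul]
      exact (F s).toAddSubgroup.zsmul_mem (h j s _ (hC _)) _
  have hDH (C : Finset (Fin (n + 1)) → V) (τ) : finsetD (H C) τ + H (finsetD C) τ = C τ := by
    have : finsetD (H C) τ = ∑ j, π j (finsetD (finsetH j C) τ) := by
      simp only [finsetD, H, map_sum, map_zsmul, Finset.smul_sum]
      exact Finset.sum_comm
    rw [this, ← Finset.sum_add_distrib, ← hπ (C τ)]
    refine Finset.sum_congr rfl fun j _ ↦ ?_
    rw [← map_add, finsetD_finsetH_add]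
  let η (p : ℕ) : subCochain F (p + 1) →ₗ[K] subCochain F p :=
    { toFun := fun c ↦ ⟨fun σ ↦ H (cochainExt c.1) (vertices σ), fun σ ↦ hH _ (hext c.2) _⟩
      map_add' := fun c c' ↦ Subtype.ext <| funext fun σ ↦ by
        change H (cochainExt (c.1 + c'.1)) _ = H (cochainExt c.1) _ + H (cochainExt c'.1) _
        simp only [H, finsetH, ← Finset.sum_add_distrib, ← map_add, hadd]
        refine Finset.sum_congr rfl fun j _ ↦ ?_
        split_ifs <;> simp
      map_smul' := fun a c ↦ Subtype.ext <| funext fun σ ↦ by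
        change H (cochainExt (a • c.1)) _ = a • H (cochainExt c.1) _
        simp only [H, finsetH, Finset.smul_sum, hsmul]
        refine Finset.sum_congr rfl fun j _ ↦ ?_
        split_ifs
        · simp
        · rw [smul_comm, map_smul] }
  have hη (p : ℕ) (c : subCochain F (p + 1)) : cochainExt (η p c).1 = H (cochainExt c.1) := by
    refine cochainExt_eq (H (cochainExt c.1)) fun s hs ↦ Finset.sum_eq_zero fun j _ ↦ ?_
    rw [finsetH]
    split_ifs with hj
    · simp
    · rw [cochainExt, dif_neg]
      · simp
      · rw [Finset.card_insert_of_notMem hj]; omega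
  refine finCoh_of_contraction _ n η (fun c ↦ ?_) fun p c ↦ ?_
  · refine Subtype.ext (funext fun σ ↦ ?_)
    change H (cochainExt (cechV K V n 0 c.1)) _ = _
    rw [cochainExt_cechV, ← cochainExt_vertices c.1 σ, ← hDH (cochainExt c.1)]
    -- The complex on all finite sets also has a term at `∅`, in degree `-1`. The hypothesis `F ∅ =
    -- ⊥` removes its contribution in degree `0`.
    have : finsetD (H (cochainExt c.1)) (vertices σ) = 0 := by
      refine Finset.sum_eq_zero fun i hi ↦ ?_
      have h1 : (vertices σ).erase i = ∅ := by
        rw [← Finset.card_eq_zero, Finset.card_erase_of_mem hi, card_vertices]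
      have h2 := hH _ (hext c.2) ∅
      rw [h0, Submodule.mem_bot] at h2
      rw [h1, h2, smul_zero]
    rw [this]
    exact (zero_add (M := V) _).symm
  · refine Subtype.ext (funext fun σ ↦ ?_)
    change cechV K V n p (η p c).1 σ + H (cochainExt (cechV K V n (p + 1) c.1)) (vertices σ) = _
    rw [cochainExt_cechV, cechV_eq_finsetD, hη, hDH, cochainExt_vertices]

end SubCech

/-! ### Cohomology of `𝒪(m)` on projective space by Laurent monomials -/

section Laurent

/-- The ring of Laurent polynomials in `n + 1` variables. -/
abbrev Laurent (K : Type u) [Field K] (n : ℕ) : Type u := AddMonoidAlgebra K (Fin (n + 1) → ℤ)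

variable {K : Type u} [Field K] {n : ℕ}

open Classical in
/-- The part of a Laurent polynomial with exponents in `P`. -/
def projOn (P : Set (Fin (n + 1) → ℤ)) : Laurent K n →ₗ[K] Laurent K n where
  toFun v := .ofCoeff (v.coeff.filter (· ∈ P))
  map_add' v w := by
    rw [AddMonoidAlgebra.coeff_add, Finsupp.filter_add]
    rfl
  map_smul' a v := by
    rw [AddMonoidAlgebra.coeff_smul, Finsupp.filter_smul]
    rfl

open Classical in
lemma coeff_projOn (P : Set (Fin (n + 1) → ℤ)) (v : Laurent K n) (a : Fin (n + 1) → ℤ) :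
    (projOn P v).coeff a = if a ∈ P then v.coeff a else 0 :=
  Finsupp.filter_apply _ _ _

variable (K) in
/-- The Laurent polynomials with exponents in `P`. -/
abbrev supp (P : Set (Fin (n + 1) → ℤ)) : Submodule K (Laurent K n) :=
  AddMonoidAlgebra.supported K K P

lemma mem_supp {P : Set (Fin (n + 1) → ℤ)} {v : Laurent K n} :
    v ∈ supp K P ↔ ∀ a ∉ P, v.coeff a = 0 :=
  AddMonoidAlgebra.mem_supported'

lemma projOn_eq_self {P : Set (Fin (n + 1) → ℤ)} {v : Laurent K n} (hv : v ∈ supp K P) :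
    projOn P v = v := by
  ext a
  rw [coeff_projOn]
  split_ifs with h
  · rfl
  · rw [mem_supp.mp hv a h]

lemma projOn_mem_supp {P Q : Set (Fin (n + 1) → ℤ)} {v : Laurent K n} (hv : v ∈ supp K Q) :
    projOn P v ∈ supp K (P ∩ Q) := by
  refine mem_supp.mpr fun a ha ↦ ?_
  rw [coeff_projOn]
  split_ifs with h
  · exact mem_supp.mp hv a fun h' ↦ ha ⟨h, h'⟩
  · rfl

/-- The exponents of the Laurent monomials of degree `m` whose negative exponents are in `s`. -/
def expSet (m : ℤ) (s : Finset (Fin (n + 1))) : Set (Fin (n + 1) → ℤ) :=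
  {a | ∑ i, a i = m ∧ ∀ i ∉ s, 0 ≤ a i}

lemma expSet_mono (m : ℤ) : Monotone (expSet (n := n) m) :=
  fun _ _ h _ ha ↦ ⟨ha.1, fun i hi ↦ ha.2 i fun hi' ↦ hi (h hi')⟩

/-- The exponents with both a negative and a nonnegative entry. -/
def mixedSet (n : ℕ) : Set (Fin (n + 1) → ℤ) := {a | (∃ i, a i < 0) ∧ ∃ i, 0 ≤ a i}

lemma monotone_mixed (m : ℤ) : Monotone fun s ↦ supp K (expSet m s ∩ mixedSet n) :=
  fun _ _ h ↦ AddMonoidAlgebra.supported_mono (Set.inter_subset_inter_left _ (expSet_mono m h))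

lemma monotone_unmixed (m : ℤ) : Monotone fun s ↦ supp K (expSet m s \ mixedSet n) :=
  fun _ _ h ↦ AddMonoidAlgebra.supported_mono (Set.sdiff_subset_sdiff_left (expSet_mono m h))

lemma monotone_supp_expSet (m : ℤ) : Monotone fun s ↦ supp K (expSet (n := n) m s) :=
  fun _ _ h ↦ AddMonoidAlgebra.supported_mono (expSet_mono m h)

/-- For an exponent `a` with some entry `a j ≥ 0`, allowing a negative exponent at `j` makes no
difference, so the monomial can be contracted towards `j`. The negative entry keeps mixed monomials
out of the coefficient space of `∅`. -/
lemma finCoh_mixed (m : ℤ) : FinCoh n (subCech (monotone_mixed (K := K) (n := n) m)) 0 := by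
  classical
  -- The default value `0` only serves to make the projectors sum to the identity on all Laurent
  -- polynomials; on mixed exponents the chosen entry is non-negative.
  let J (a : Fin (n + 1) → ℤ) : Fin (n + 1) := if h : ∃ i, 0 ≤ a i then h.choose else 0
  have hJ {a : Fin (n + 1) → ℤ} (ha : a ∈ mixedSet n) : 0 ≤ a (J a) := by
    simp only [J, dif_pos ha.2]
    exact ha.2.choose_spec
  refine finCoh_zero_of_projectors _ (fun j ↦ projOn {a | J a = j}) (fun v ↦ ?_) ?_ ?_
  · ext a
    rw [AddMonoidAlgebra.coeff_sum, Finsupp.finsetSum_apply]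
    simp only [coeff_projOn, Set.mem_ofPred_eq]
    exact (Finset.sum_eq_single_of_mem (J a) (Finset.mem_univ _) fun j _ hj ↦
      if_neg hj.symm).trans (if_pos rfl)
  · intro j s v hv
    refine AddMonoidAlgebra.supported_mono ?_ (projOn_mem_supp hv)
    rintro a ⟨rfl, ⟨h1, h2⟩, h3⟩
    refine ⟨⟨h1, fun i hi ↦ ?_⟩, h3⟩
    by_cases hij : i = J a
    · rw [hij]; exact hJ h3
    · exact h2 i (by simp [hij, hi])
  · rw [eq_bot_iff]
    intro v hv
    rw [Submodule.mem_bot]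
    ext a
    refine mem_supp.mp hv a ?_
    rintro ⟨⟨-, h1⟩, ⟨i, hi⟩, -⟩
    exact absurd (h1 i (by simp)) (not_le.mpr hi)

/-- The nonnegative exponents of degree `m`. -/
def nonnegSet (n : ℕ) (m : ℤ) : Set (Fin (n + 1) → ℤ) := {a | ∑ i, a i = m ∧ ∀ i, 0 ≤ a i}

/-- The exponents of degree `m` with all entries negative. -/
def negSet (n : ℕ) (m : ℤ) : Set (Fin (n + 1) → ℤ) := {a | ∑ i, a i = m ∧ ∀ i, a i < 0}

lemma nonnegSet_natCast (m : ℕ) : nonnegSet n m =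
    (fun (b : Fin (n + 1) →₀ ℕ) i ↦ (b i : ℤ)) '' ((Finset.univ : Finset (Fin (n + 1))).finsuppAntidiag m : Set (Fin (n + 1) →₀ ℕ)) := by
  ext a
  constructor
  · rintro ⟨h1, h2⟩
    refine ⟨Finsupp.equivFunOnFinite.symm fun i ↦ (a i).toNat, ?_, ?_⟩
    · simp only [Finset.mem_coe, Finset.mem_finsuppAntidiag, Finset.subset_univ, and_true]
      zify
      rw [← h1]
      exact Finset.sum_congr rfl fun i _ ↦ Int.toNat_of_nonneg (h2 i)
    · exact funext fun i ↦ Int.toNat_of_nonneg (h2 i)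
  · rintro ⟨b, hb, rfl⟩
    simp only [Finset.mem_coe, Finset.mem_finsuppAntidiag, Finset.subset_univ, and_true] at hb
    refine ⟨?_, fun i ↦ Int.natCast_nonneg _⟩
    rw [← hb]
    push_cast
    rfl

lemma nonnegSet_of_neg {m : ℤ} (hm : m < 0) : nonnegSet n m = ∅ := by
  ext a
  simp only [Set.mem_empty_iff_false, iff_false]
  rintro ⟨h1, h2⟩
  exact absurd (Finset.sum_nonneg fun i _ ↦ h2 i) (by rw [h1]; exact not_le.mpr hm)

lemma finite_nonnegSet (m : ℤ) : (nonnegSet n m).Finite := by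
  rcases lt_or_ge m 0 with hm | hm
  · rw [nonnegSet_of_neg hm]; exact Set.finite_empty
  · obtain ⟨m, rfl⟩ := Int.eq_ofNat_of_zero_le hm
    rw [nonnegSet_natCast]
    exact (Finset.finite_toSet _).image _

lemma ncard_nonnegSet (m : ℕ) : (nonnegSet n m).ncard = (m + n).choose n := by
  rw [nonnegSet_natCast, Set.ncard_image_of_injective, Set.ncard_coe_finset,
    Finset.card_finsuppAntidiag_nat_eq_choose]
  · rw [Finset.card_univ, Fintype.card_fin, show n + 1 + m - 1 = m + n by omega,
      ← Nat.choose_symm_add]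
  · intro b b' h
    ext i
    exact Int.natCast_inj.mp (congrFun h i)

/-- The exponent form of Serre duality: `a ↦ -1 - a` exchanges negative with non-negative entries
and degree `m` with degree `-m - n - 1`. -/
lemma negSet_eq (m : ℤ) : negSet n m = (fun a ↦ -1 - a) '' nonnegSet n (-m - (n + 1)) := by
  ext a
  constructor
  · rintro ⟨h1, h2⟩
    refine ⟨-1 - a, ⟨?_, fun i ↦ ?_⟩, by simp⟩
    · simp [h1]; ring
    · have := h2 i
      simp only [Pi.sub_apply, Pi.neg_apply, Pi.one_apply]
      omega
  · rintro ⟨b, ⟨h1, h2⟩, rfl⟩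
    refine ⟨?_, fun i ↦ ?_⟩
    · simp [h1]; ring
    · have := h2 i
      simp only [Pi.sub_apply, Pi.neg_apply, Pi.one_apply]
      omega

lemma finite_negSet (m : ℤ) : (negSet n m).Finite := by
  rw [negSet_eq]; exact (finite_nonnegSet _).image _

lemma ncard_negSet (m : ℤ) : (negSet n m).ncard = (nonnegSet n (-m - (n + 1))).ncard := by
  rw [negSet_eq, Set.ncard_image_of_injective _ sub_right_injective]

/-- A non-mixed exponent is either non-negative, and then allowed for every `s`, or negative
everywhere, and then allowed only when all variables are inverted. -/
lemma expSet_diff_mixedSet (m : ℤ) (s : Finset (Fin (n + 1))) :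
    expSet m s \ mixedSet n = nonnegSet n m ∪ (if s = Finset.univ then negSet n m else ∅) := by
  ext a
  constructor
  · rintro ⟨⟨h1, h2⟩, h3⟩
    by_cases h : ∀ i, 0 ≤ a i
    · exact Or.inl ⟨h1, h⟩
    · push Not at h
      have h4 (i) : a i < 0 := by
        by_contra! hi
        exact h3 ⟨h, i, hi⟩
      have hs : s = Finset.univ := by
        ext i
        simp only [Finset.mem_univ, iff_true]
        by_contra hi
        exact absurd (h2 i hi) (not_le.mpr (h4 i))
      rw [if_pos hs]
      exact Or.inr ⟨h1, h4⟩
  · rintro (⟨h1, h2⟩ | h)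
    · exact ⟨⟨h1, fun i _ ↦ h2 i⟩, fun ⟨⟨i, hi⟩, _⟩ ↦ absurd (h2 i) (not_le.mpr hi)⟩
    · split_ifs at h with hs
      · exact ⟨⟨h.1, fun i hi ↦ absurd (hs ▸ Finset.mem_univ i) hi⟩,
          fun ⟨_, ⟨i, hi⟩⟩ ↦ absurd (h.2 i) (not_lt.mpr hi)⟩
      · exact h.elim

lemma finite_expSet_diff (m : ℤ) (s : Finset (Fin (n + 1))) :
    (expSet m s \ mixedSet n).Finite := by
  rw [expSet_diff_mixedSet]
  refine (finite_nonnegSet m).union ?_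
  split_ifs
  · exact finite_negSet m
  · exact Set.finite_empty

lemma ncard_expSet_diff (m : ℤ) (s : Finset (Fin (n + 1))) :
    (expSet m s \ mixedSet n).ncard = (nonnegSet n m).ncard +
      if s = Finset.univ then (nonnegSet n (-m - (n + 1))).ncard else 0 := by
  rw [expSet_diff_mixedSet]
  split_ifs with hs
  · rw [Set.ncard_union_eq _ (finite_nonnegSet m) (finite_negSet m), ncard_negSet]
    refine Set.disjoint_left.mpr fun a ha hb ↦ ?_
    exact absurd (ha.2 0) (not_le.mpr (hb.2 0))
  · simp

lemma finrank_supp {P : Set (Fin (n + 1) → ℤ)} (hP : P.Finite) :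
    Module.Finite K (supp K P) ∧ Module.finrank K (supp K P) = P.ncard := by
  have := hP.to_subtype
  have := Fintype.ofFinite P
  let e := AddMonoidAlgebra.supportedEquivFinsupp (R := K) (S := K) P
  refine ⟨Module.Finite.equiv e.symm, ?_⟩
  rw [e.finrank_eq, Module.finrank_finsupp_self, ← Nat.card_eq_fintype_card, Nat.card_coe_set_eq]

/-- A cochain is a family of values. -/
def subCochainEquiv {V : Type u} [AddCommGroup V] [Module K V]
    (F : Finset (Fin (n + 1)) → Submodule K V) (p : ℕ) :
    subCochain F p ≃ₗ[K] ∀ σ : Fin (p + 1) ↪o Fin (n + 1), F (vertices σ) where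
  toFun c σ := ⟨c.1 σ, c.2 σ⟩
  invFun c := ⟨fun σ ↦ c σ, fun σ ↦ (c σ).2⟩
  left_inv _ := rfl
  right_inv _ := rfl
  map_add' _ _ := rfl
  map_smul' _ _ := rfl

lemma isEmpty_orderEmb {p : ℕ} (hp : n < p) : IsEmpty (Fin (p + 1) ↪o Fin (n + 1)) := by
  refine ⟨fun σ ↦ ?_⟩
  have := Fintype.card_le_of_injective σ σ.injective
  simp at this
  omega

lemma vertices_eq_univ {p : ℕ} (σ : Fin (p + 1) ↪o Fin (n + 1)) :
    vertices σ = Finset.univ ↔ p = n := by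
  rw [← Finset.card_eq_iff_eq_univ, card_vertices, Fintype.card_fin]
  omega

lemma card_orderEmb (p : ℕ) : Nat.card (Fin (p + 1) ↪o Fin (n + 1)) = (n + 1).choose (p + 1) := by
  rw [Nat.card_congr Set.powersetCard.ofFinEmbEquiv, Set.powersetCard.card, Nat.card_eq_fintype_card,
    Fintype.card_fin]

lemma sum_choose (n : ℕ) :
    ∑ p ∈ Finset.range (n + 1), (-1 : ℤ) ^ p * ((n + 1).choose (p + 1) : ℤ) = 1 := by
  have h := Int.alternating_sum_range_choose (n := n + 1)
  rw [Finset.sum_range_succ', if_neg (by omega)] at h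
  simp only [pow_succ, mul_neg_one, neg_mul, Finset.sum_neg_distrib] at h
  simp at h
  omega

/-- All terms are finite-dimensional, so the Euler characteristic is the alternating sum of their
dimensions. Each non-negative monomial contributes `∑ (-1)^p C(n + 1, p + 1) = 1`, and each negative
one occurs only in degree `n`. -/
lemma finCoh_unmixed (m : ℤ) : FinCoh n (subCech (monotone_unmixed (K := K) (n := n) m))
    ((nonnegSet n m).ncard + (-1) ^ n * (nonnegSet n (-m - (n + 1))).ncard) := by
  have hfin (s : Finset (Fin (n + 1))) := finrank_supp (K := K) (finite_expSet_diff m s)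
  have h1 (s : Finset (Fin (n + 1))) := (hfin s).1
  have h2 (p : ℕ) :
      Module.Finite K (subCochain (fun s ↦ supp K (expSet m s \ mixedSet n)) p) :=
    Module.Finite.equiv (subCochainEquiv _ p).symm
  have h3 (p : ℕ) (hp : n < p) :
      Subsingleton (subCochain (fun s ↦ supp K (expSet m s \ mixedSet n)) p) := by
    have := isEmpty_orderEmb hp
    exact (subCochainEquiv _ p).toEquiv.subsingleton
  have h4 (p : ℕ) :
      (Module.finrank K (subCochain (fun s ↦ supp K (expSet m s \ mixedSet n)) p) : ℤ) =
      (n + 1).choose (p + 1) * (nonnegSet n m).ncard +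
        if p = n then ((nonnegSet n (-m - (n + 1))).ncard : ℤ) else 0 := by
    rw [(subCochainEquiv _ p).finrank_eq, Module.finrank_pi_fintype]
    simp only [(hfin _).2, ncard_expSet_diff, vertices_eq_univ]
    rw [Finset.sum_const, Finset.card_univ, ← Nat.card_eq_fintype_card, card_orderEmb]
    split_ifs with hp
    · subst hp
      simp
    · simp
  have h5 := finCoh_of_finite (cechSub_cechSub (monotone_unmixed (K := K) (n := n) m)) n h3
  convert h5 using 1
  simp only [h4, mul_add, Finset.sum_add_distrib, ← mul_assoc, ← Finset.sum_mul, sum_choose,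
    one_mul]
  simp

theorem finCoh_supp_expSet (m : ℤ) :
    FinCoh n (subCech (monotone_supp_expSet (K := K) (n := n) m))
      ((nonnegSet n m).ncard + (-1) ^ n * (nonnegSet n (-m - (n + 1))).ncard) := by
  obtain ⟨S, hS, e₁, e₂, e₃⟩ := exists_shortExact_subCech (monotone_mixed (K := K) (n := n) m)
    (monotone_supp_expSet m) (monotone_unmixed m) LinearMap.id (projOn (mixedSet n)ᶜ)
    Function.injective_id
    (fun s _ v hv ↦ ⟨AddMonoidAlgebra.supported_mono Set.inter_subset_left hv, by
      ext a
      rw [coeff_projOn]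
      split_ifs with h
      · exact mem_supp.mp hv a fun h' ↦ h h'.2
      · rfl⟩)
    (fun s _ v hv ↦ ⟨AddMonoidAlgebra.supported_mono (Set.inter_comm _ _).subset
      (projOn_mem_supp (P := (mixedSet n)ᶜ) hv), fun h ↦ ⟨v, mem_supp.mpr fun a ha ↦ by
        by_cases h1 : a ∈ mixedSet n
        · exact mem_supp.mp hv a fun h2 ↦ ha ⟨h2, h1⟩
        · have := congrArg (fun v ↦ v.coeff a) h
          simpa [coeff_projOn, h1] using this, rfl⟩⟩)
    (fun s _ v hv ↦ ⟨v, AddMonoidAlgebra.supported_mono Set.sdiff_subset hv, projOn_eq_self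
      (AddMonoidAlgebra.supported_mono (fun a ha ↦ ha.2) hv)⟩)
  have h1 := finCoh_mixed (K := K) (n := n) m
  have h3 := finCoh_unmixed (K := K) (n := n) m
  rw [← e₁] at h1
  rw [← e₃] at h3
  rw [← e₂]
  simpa using FinCoh.middle hS h1 h3

/-- Both sides are the binomial coefficient of `m + n` over `n`. For `m ≥ 0` only the first count is
nonzero, for `-n ≤ m < 0` neither is, and for `m < -n` reversing the product gives the second count
with sign `(-1)^n`. -/
lemma eval_hilb_zero (d : ℕ → ℕ) (m : ℤ) : (hilb n d 0).eval (m : ℚ) =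
    (((nonnegSet n m).ncard + (-1) ^ n * (nonnegSet n (-m - (n + 1))).ncard : ℤ) : ℚ) := by
  have hev (m : ℤ) : (hilb n d 0).eval (m : ℚ) =
      (n.factorial : ℚ)⁻¹ * ∏ j ∈ Finset.range n, ((m : ℚ) + (j + 1)) := by
    simp [hilb, risingProd, Polynomial.eval_prod]
  have hnat (m : ℕ) : (n.factorial : ℚ)⁻¹ * ∏ j ∈ Finset.range n, ((m : ℚ) + (j + 1)) =
      (m + n).choose n := by
    rw [inv_mul_eq_iff_eq_mul₀ (by positivity)]
    have := Nat.ascFactorial_eq_factorial_mul_choose m n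
    rw [Nat.ascFactorial_eq_prod_range] at this
    rw [← Nat.cast_mul, ← this]
    push_cast
    exact Finset.prod_congr rfl fun j _ ↦ by ring
  rw [hev]
  rcases le_or_gt 0 m with hm | hm
  · obtain ⟨m, rfl⟩ := Int.eq_ofNat_of_zero_le hm
    rw [nonnegSet_of_neg (m := -m - (n + 1)) (by omega), ncard_nonnegSet]
    simpa using hnat m
  · rw [nonnegSet_of_neg hm]
    rcases le_or_gt (-m) n with hn | hn
    · rw [nonnegSet_of_neg (by omega), Finset.prod_eq_zero (i := (-m - 1).toNat)]
      · simp
      · rw [Finset.mem_range]; omega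
      · have : ((-m - 1).toNat : ℤ) = -m - 1 := Int.toNat_of_nonneg (by omega)
        have : (((-m - 1).toNat : ℤ) : ℚ) = -m - 1 := by rw [this]; push_cast; ring
        rw [← Int.cast_natCast, this]; ring
    · obtain ⟨m', hm'⟩ := Int.eq_ofNat_of_zero_le (a := -m - (n + 1)) (by omega)
      rw [hm']
      rw [ncard_nonnegSet]
      obtain rfl : m = -m' - (n + 1) := by omega
      have h := hnat m'
      rw [← Finset.prod_range_reflect] at h
      have h2 : ∏ j ∈ Finset.range n, (((-m' - (n + 1) : ℤ) : ℚ) + (j + 1)) =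
          (-1) ^ n * ∏ j ∈ Finset.range n, ((m' : ℚ) + ((n - 1 - j : ℕ) + 1)) := by
        have h3 : (-1 : ℚ) ^ n = ∏ _j ∈ Finset.range n, (-1 : ℚ) := by
          rw [Finset.prod_const, Finset.card_range]
        rw [h3, ← Finset.prod_mul_distrib]
        refine Finset.prod_congr rfl fun j hj ↦ ?_
        have := Finset.mem_range.mp hj
        rw [Nat.sub_sub, Nat.cast_sub (by omega)]
        push_cast
        ring
      rw [h2, mul_left_comm, h]
      simp

end Laurent

/-! ### Depth, associated primes and regular sequences in local rings -/

section Depth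

open CategoryTheory Abelian IsLocalRing RingTheory.Sequence
open scoped Pointwise

/-- In the domain `R ⧸ p` the class of `x` is a nonzerodivisor, and `R ⧸ q` is a quotient of `(R ⧸
p) ⧸ (x)`. -/
lemma ringKrullDim_quotient_add_one_le {R : Type*} [CommRing R] {p q : Ideal R} [p.IsPrime] (hpq : p ≤ q) {x : R}
    (hxq : x ∈ q) (hxp : x ∉ p) : ringKrullDim (R ⧸ q) + 1 ≤ ringKrullDim (R ⧸ p) := by
  have hx : Ideal.Quotient.mk p x ∈ nonZeroDivisors (R ⧸ p) :=
    mem_nonZeroDivisors_of_ne_zero (by rwa [Ne, Ideal.Quotient.eq_zero_iff_mem])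
  refine le_trans ?_ (ringKrullDim_quotient_succ_le_of_nonZeroDivisor hx)
  gcongr
  refine ringKrullDim_le_of_surjective
    (Ideal.Quotient.lift (Ideal.span {Ideal.Quotient.mk p x}) (Ideal.Quotient.factor hpq) ?_) ?_
  · intro a ha
    obtain ⟨b, rfl⟩ := Ideal.mem_span_singleton'.mp ha
    rw [map_mul, Ideal.Quotient.factor_mk, Ideal.Quotient.eq_zero_iff_mem.mpr hxq, mul_zero]
  · exact Ideal.Quotient.lift_surjective_of_surjective _ _ (Ideal.Quotient.factor_surjective hpq)

variable {R : Type u} [CommRing R] [IsLocalRing R]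

/-- The vanishing of `Ext^i(κ, M)` for `i < t`, where `κ` is the residue field, that is,
`depth M ≥ t`. -/
def DepthGE (t : ℕ) (M : ModuleCat.{u} R) : Prop :=
  ∀ i < t, Subsingleton (Ext (ModuleCat.of R (R ⧸ maximalIdeal R)) M i)

/-- In the long exact sequence, `Ext^i(κ, X₃)` lies between `Ext^i(κ, X₂)` and `Ext^{i+1}(κ, X₁)`.
-/
lemma DepthGE.of_shortExact {S : ShortComplex (ModuleCat.{u} R)} (hS : S.ShortExact) {t : ℕ}
    (h₁ : DepthGE (t + 1) S.X₁) (h₂ : DepthGE t S.X₂) : DepthGE t S.X₃ := by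
  intro i hi
  have z₁ := AddCommGrpCat.isZero_of_iff_subsingleton.mpr (h₁ (i + 1) (by omega))
  have z₂ := AddCommGrpCat.isZero_of_iff_subsingleton.mpr (h₂ i hi)
  exact AddCommGrpCat.subsingleton_of_isZero <| ShortComplex.Exact.isZero_of_both_zeros
    (Ext.covariant_sequence_exact₃' _ hS i (i + 1) rfl)
    (z₂.eq_zero_of_src _) (z₁.eq_zero_of_tgt _)

lemma DepthGE.of_iso {M N : ModuleCat.{u} R} (e : M ≅ N) {t : ℕ} (h : DepthGE t M) :
    DepthGE t N := fun i hi ↦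
  have : Subsingleton ((extFunctorObj (ModuleCat.of R (R ⧸ maximalIdeal R)) i).obj M) := h i hi
  (((extFunctorObj (ModuleCat.of R (R ⧸ maximalIdeal R)) i).mapIso
    e).addCommGroupIsoToAddEquiv).symm.toEquiv.subsingleton

lemma DepthGE.mono {s t : ℕ} (hst : s ≤ t) {M : ModuleCat.{u} R} (h : DepthGE t M) :
    DepthGE s M := fun i hi ↦ h i (hi.trans_le hst)

variable [IsNoetherianRing R]

lemma DepthGE.exists_isSMulRegular {t : ℕ} {M : ModuleCat.{u} R} [Module.Finite R M]
    (h : DepthGE (t + 1) M) : ∃ x ∈ maximalIdeal R, IsSMulRegular M x := by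
  have : Subsingleton (ModuleCat.of R (R ⧸ maximalIdeal R) ⟶ M) :=
    Ext.addEquiv₀.subsingleton_congr.mp (h 0 t.succ_pos)
  have : Subsingleton ((R ⧸ maximalIdeal R) →ₗ[R] M) :=
    (ModuleCat.homAddEquiv (M := ModuleCat.of R (R ⧸ maximalIdeal R))).symm.subsingleton
  obtain ⟨x, hx, hx'⟩ := IsSMulRegular.subsingleton_linearMap_iff.mp this
  rw [Ideal.annihilator_quotient] at hx
  exact ⟨x, hx, hx'⟩

/-- Let `N` be the submodule of elements killed by `p`; it is nonzero. If `N ⊆ xM`, then `N = xN`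
because `x` is regular, which contradicts Nakayama. An element of `N` outside `xM` has a nonzero
class in `M/xM`, killed by `p` and by `x`, and its annihilator lies in some associated prime. -/
lemma exists_associatedPrime_quotSMulTop {M : Type u} [AddCommGroup M] [Module R M]
    [Module.Finite R M] {x : R} (hx : x ∈ maximalIdeal R) (hxM : IsSMulRegular M x) {p : Ideal R}
    (hp : p ∈ associatedPrimes R M) :
    ∃ q ∈ associatedPrimes R (QuotSMulTop x M), p ≤ q ∧ x ∈ q ∧ x ∉ p := by
  rw [AssociatedPrimes.mem_iff, isAssociatedPrime_iff] at hp
  obtain ⟨hp, y, rfl⟩ := hp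
  set p := (⊥ : Submodule R M).colon {y}
  have hpy (a : R) : a ∈ p ↔ a • y = 0 := by simp [p, Submodule.mem_colon_singleton]
  have hy : y ≠ 0 := by
    rintro rfl
    exact hp.ne_top ((Ideal.eq_top_iff_one _).mpr ((hpy 1).mpr (smul_zero _)))
  have hxp : x ∉ p := fun h ↦ hy (hxM (by simpa using (hpy x).mp h))
  let N : Submodule R M := Submodule.torsionBySet R M p
  have hN (u : M) : u ∈ N ↔ ∀ a ∈ p, a • u = 0 := by
    simp [N, Submodule.mem_torsionBySet_iff]
  have hne : ∃ u ∈ N, u ∉ x • (⊤ : Submodule R M) := by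
    by_contra! hall
    have hle : N ≤ Ideal.span {x} • N := by
      intro u hu
      obtain ⟨v, -, hv⟩ := (Submodule.mem_smul_pointwise_iff_exists _ _ _).mp (hall u hu)
      rw [Submodule.ideal_span_singleton_smul]
      refine (Submodule.mem_smul_pointwise_iff_exists _ _ _).mpr ⟨v, (hN v).mpr fun a ha ↦ ?_, hv⟩
      refine hxM ?_
      have := (hN u).mp hu a ha
      rw [← hv, smul_comm] at this
      simpa using this
    have h0 := Submodule.eq_bot_of_le_smul_of_le_jacobson_bot _ _ (IsNoetherian.noetherian N) hle
      ((Ideal.span_singleton_le_iff_mem _).mpr (maximalIdeal_le_jacobson _ hx))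
    have : y ∈ N := (hN y).mpr fun a ha ↦ (hpy a).mp ha
    rw [h0] at this
    exact hy this
  obtain ⟨u, hu, hux⟩ := hne
  obtain ⟨q, hq, hle⟩ := exists_le_isAssociatedPrime_of_isNoetherianRing R
    (Submodule.Quotient.mk u : QuotSMulTop x M) (by rwa [Ne, Submodule.Quotient.mk_eq_zero])
  have hmem (a : R) (ha : a • u ∈ x • (⊤ : Submodule R M)) : a ∈ q := by
    apply hle
    rw [Submodule.mem_colon_singleton, Submodule.mem_bot, ← Submodule.Quotient.mk_smul,
      Submodule.Quotient.mk_eq_zero]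
    exact ha
  refine ⟨q, hq, fun a ha ↦ hmem a ?_, hmem x ?_, hxp⟩
  · rw [(hN u).mp hu a ha]
    exact zero_mem _
  · exact Submodule.smul_mem_pointwise_smul _ _ _ trivial

/-- Depth is bounded by the dimension of every associated prime. Dividing by a regular element costs
one unit of depth, while the enlarged associated prime `q ⊋ p` costs at least one unit of dimension.
-/
lemma DepthGE.le_ringKrullDim {t : ℕ} {M : ModuleCat.{u} R} [Module.Finite R M]
    (h : DepthGE t M) {p : Ideal R} (hp : p ∈ associatedPrimes R M) :
    (t : WithBot ℕ∞) ≤ ringKrullDim (R ⧸ p) := by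
  induction t generalizing M p with
  | zero =>
    have := hp.isPrime
    exact ringKrullDim_nonneg_of_nontrivial
  | succ t ih =>
    obtain ⟨x, hx, hxM⟩ := h.exists_isSMulRegular
    obtain ⟨q, hq, hpq, hxq, hxp⟩ := exists_associatedPrime_quotSMulTop hx hxM hp
    have := hp.isPrime
    have h' : DepthGE t (ModuleCat.of R (QuotSMulTop x M)) :=
      DepthGE.of_shortExact hxM.smulShortComplex_shortExact h (h.mono t.le_succ)
    have := ih h' hq
    calc ((t + 1 : ℕ) : WithBot ℕ∞) = t + 1 := by push_cast; rfl
      _ ≤ ringKrullDim (R ⧸ q) + 1 := by gcongr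
      _ ≤ _ := ringKrullDim_quotient_add_one_le hpq hxq hxp

/-- The ideal generated by `f 0, …, f (i - 1)`. -/
def initialIdeal {A : Type*} [CommRing A] (f : ℕ → A) (i : ℕ) : Ideal A :=
  Ideal.span (f '' Set.Iio i)

lemma initialIdeal_succ {A : Type*} [CommRing A] (f : ℕ → A) (i : ℕ) :
    initialIdeal f (i + 1) = initialIdeal f i ⊔ Ideal.span {f i} := by
  rw [initialIdeal, initialIdeal, ← Ideal.span_union, ← Set.image_singleton, ← Set.image_union]
  congr 2
  ext j
  simp

/-- If `f i` were a zero divisor modulo its predecessors, it would lie in an associated prime `p`,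
and `dim R/p ≥ N - i` by the depth bound. Dividing `R/p` by the `k - i - 1` later elements would
leave dimension at least `N - k + 1`, more than `R/(f_0, …, f_{k-1})` has. -/
lemma isSMulRegular_of_dim_le {N k : ℕ} (hR : DepthGE N (ModuleCat.of R R)) (f : ℕ → R)
    (hf : ∀ i < k, f i ∈ maximalIdeal R) (hkN : k ≤ N)
    (hdim : ringKrullDim (R ⧸ initialIdeal f k) + k ≤ N) (i : ℕ) (hi : i ≤ k) :
    DepthGE (N - i) (ModuleCat.of R (R ⧸ initialIdeal f i)) ∧
      (i < k → IsSMulRegular (R ⧸ initialIdeal f i) (f i)) := by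
  have reg (i : ℕ) (hi : i < k)
      (h : DepthGE (N - i) (ModuleCat.of R (R ⧸ initialIdeal f i))) :
      IsSMulRegular (R ⧸ initialIdeal f i) (f i) := by
    by_contra hreg
    have hmem : f i ∈ ⋃ p ∈ associatedPrimes R (R ⧸ initialIdeal f i), (p : Set R) := by
      rw [biUnion_associatedPrimes_eq_zero_divisors, Set.mem_ofPred_eq]
      rw [isSMulRegular_iff_right_eq_zero_of_smul] at hreg
      push Not at hreg
      obtain ⟨x, h1, h2⟩ := hreg
      exact ⟨x, h2, h1⟩
    simp only [Set.mem_iUnion] at hmem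
    obtain ⟨p, hp, hfp⟩ := hmem
    have hpp := hp.isPrime
    have h1 := h.le_ringKrullDim hp
    have hle : initialIdeal f i ≤ p := by
      have := IsAssociatedPrime.annihilator_le hp
      rwa [Submodule.annihilator_top, Ideal.annihilator_quotient] at this
    have : IsLocalRing (R ⧸ p) := .of_surjective' _ Ideal.Quotient.mk_surjective
    classical
    -- Modulo `p` the elements `f 0, …, f i` vanish, so these are the only equations that remain.
    let s : Finset (R ⧸ p) := (Finset.Ico (i + 1) k).image fun j ↦ Ideal.Quotient.mk p (f j)
    have hs : (s : Set (R ⧸ p)) ⊆ maximalIdeal (R ⧸ p) := by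
      intro a ha
      simp only [s, Finset.coe_image, Set.mem_image, Finset.mem_coe, Finset.mem_Ico] at ha
      obtain ⟨j, hj, rfl⟩ := ha
      have := IsLocalHom.of_surjective (Ideal.Quotient.mk p) Ideal.Quotient.mk_surjective
      exact map_nonunit _ _ (hf j hj.2)
    rw [← ringJacobson_eq_maximalIdeal] at hs
    have h2 := ringKrullDim_le_ringKrullDim_quotient_add_card s hs
    have h3 : ringKrullDim ((R ⧸ p) ⧸ Ideal.span (s : Set (R ⧸ p))) ≤
        ringKrullDim (R ⧸ initialIdeal f k) := by
      refine ringKrullDim_le_of_surjective (Ideal.Quotient.lift (initialIdeal f k)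
        ((Ideal.Quotient.mk _).comp (Ideal.Quotient.mk p)) ?_)
        (Ideal.Quotient.lift_surjective_of_surjective _ _
          (Ideal.Quotient.mk_surjective.comp Ideal.Quotient.mk_surjective))
      intro a ha
      rw [← RingHom.mem_ker]
      refine (Ideal.span_le (I := RingHom.ker _)).mpr ?_ ha
      rintro _ ⟨j, hj, rfl⟩
      rw [SetLike.mem_coe, RingHom.mem_ker, RingHom.comp_apply, Ideal.Quotient.eq_zero_iff_mem]
      rcases lt_trichotomy j i with hji | rfl | hji
      · rw [Ideal.Quotient.eq_zero_iff_mem.mpr (hle (Ideal.subset_span ⟨j, hji, rfl⟩))]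
        exact zero_mem _
      · rw [Ideal.Quotient.eq_zero_iff_mem.mpr hfp]
        exact zero_mem _
      · exact Ideal.subset_span (Finset.mem_coe.mpr
          (Finset.mem_image_of_mem _ (Finset.mem_Ico.mpr ⟨hji, hj⟩)))
    have h4 : s.card ≤ k - (i + 1) := by
      simpa using Finset.card_image_le (s := Finset.Ico (i + 1) k)
        (f := fun j ↦ Ideal.Quotient.mk p (f j))
    generalize ringKrullDim (R ⧸ p) = a at h1 h2
    generalize ringKrullDim ((R ⧸ p) ⧸ Ideal.span (s : Set (R ⧸ p))) = b at h2 h3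
    generalize ringKrullDim (R ⧸ initialIdeal f k) = c at h3 hdim
    have h5 : ((N - i : ℕ) : WithBot ℕ∞) ≤ c + (k - (i + 1) : ℕ) :=
      h1.trans (h2.trans (add_le_add h3 (by exact_mod_cast h4)))
    induction c using WithBot.recBotCoe with
    | bot => simp at h5
    | coe c =>
      induction c using ENat.recTopCoe with
      | top =>
        have : ((⊤ : ℕ∞) : WithBot ℕ∞) + (k : WithBot ℕ∞) = ⊤ := rfl
        rw [this] at hdim
        have : ((N : ℕ∞) : WithBot ℕ∞) = ((⊤ : ℕ∞) : WithBot ℕ∞) := top_le_iff.mp hdim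
        exact absurd (WithBot.coe_injective this) (ENat.natCast_ne_top N)
      | coe c =>
        have h5 : ((N - i : ℕ) : ℕ∞) ≤ c + (k - (i + 1) : ℕ) := WithBot.coe_le_coe.mp h5
        have hdim : (c : ℕ∞) + k ≤ N := WithBot.coe_le_coe.mp hdim
        norm_cast at h5 hdim
        omega
  induction i with
  | zero =>
    have h0 : DepthGE N (ModuleCat.of R (R ⧸ initialIdeal f 0)) := by
      refine hR.of_iso (LinearEquiv.toModuleIso (Submodule.quotEquivOfEqBot _ ?_).symm)
      simp [initialIdeal]
    exact ⟨h0, fun hi ↦ reg 0 hi h0⟩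
  | succ i ih =>
    obtain ⟨h1, h2⟩ := ih (by omega)
    have h2 := h2 (by omega)
    have hle : initialIdeal f i ≤ initialIdeal f (i + 1) := by
      rw [initialIdeal_succ]
      exact le_sup_left
    have hex : Function.Exact (LinearMap.lsmul R (R ⧸ initialIdeal f i) (f i))
        (Submodule.factor hle) := by
      intro x
      obtain ⟨x, rfl⟩ := Ideal.Quotient.mk_surjective x
      constructor
      · intro hx
        have hx : x ∈ initialIdeal f (i + 1) := (Submodule.Quotient.mk_eq_zero _).mp hx
        rw [initialIdeal_succ, Submodule.mem_sup] at hx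
        obtain ⟨y, hy, z, hz, rfl⟩ := hx
        obtain ⟨a, rfl⟩ := Ideal.mem_span_singleton'.mp hz
        refine ⟨Ideal.Quotient.mk _ a, ?_⟩
        rw [map_add, Ideal.Quotient.eq_zero_iff_mem.mpr hy, zero_add, mul_comm]
        rfl
      · rintro ⟨y, hy⟩
        obtain ⟨y, rfl⟩ := Ideal.Quotient.mk_surjective y
        rw [← hy]
        refine (Submodule.Quotient.mk_eq_zero (initialIdeal f (i + 1)) (x := f i * y)).mpr ?_
        exact Ideal.mul_mem_right _ _ (Ideal.subset_span ⟨i, by simp, rfl⟩)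
    have h3 : DepthGE (N - (i + 1)) (ModuleCat.of R (R ⧸ initialIdeal f (i + 1))) :=
      DepthGE.of_shortExact (ModuleCat.shortComplex_shortExact
        (ModuleCat.shortComplexOfCompEqZero _ _ hex.linearMap_comp_eq_zero) hex h2
          (Submodule.factor_surjective hle)) (h1.mono (by omega)) (h1.mono (by omega))
    exact ⟨h3, fun hi ↦ reg _ hi h3⟩

end Depth

/-! ### The affine cone and regularity of the sequence of forms -/

section GradedDepth

open MvPolynomial

attribute [local instance] MvPolynomial.gradedAlgebra

variable {K : Type u} [Field K] {σ : Type}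

lemma aeval_mul_of_isHomogeneous {A : Type*} [CommRing A] [Algebra K A] {f : MvPolynomial σ K}
    {D : ℕ} (hf : f.IsHomogeneous D) (u : A) (x : σ → A) :
    aeval (fun i ↦ u * x i) f = u ^ D * aeval x f := by
  rw [aeval_def, aeval_def, eval₂_eq, eval₂_eq, Finset.mul_sum]
  refine Finset.sum_congr rfl fun m hm ↦ ?_
  simp only [mul_pow]
  rw [Finset.prod_mul_distrib, Finset.prod_pow_eq_pow_sum, hf.degree_eq_sum_deg_support hm]
  ring

lemma sum_homogeneousComponent_of_le (g : MvPolynomial σ K) {D : ℕ} (hD : g.totalDegree ≤ D) :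
    ∑ e ∈ Finset.range (D + 1), homogeneousComponent e g = g := by
  conv_rhs => rw [← sum_homogeneousComponent g]
  symm
  refine Finset.sum_subset (Finset.range_mono (by omega)) fun e _ he ↦ ?_
  exact homogeneousComponent_eq_zero _ _ (by simpa using he)

/-- The form `h` does not depend on the target `A`. This allows a relation in a coordinate ring to
be lifted to a form and then evaluated in a residue field. -/
lemma exists_homogenization (j : σ) (g : MvPolynomial σ K) {D : ℕ} (hD : g.totalDegree ≤ D) :
    ∃ h : MvPolynomial σ K, h.IsHomogeneous D ∧
      ∀ (A : Type u) [CommRing A] [Algebra K A] (δ : MvPolynomial σ K →ₐ[K] A),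
        δ (X j) = 1 → δ h = δ g := by
  refine ⟨∑ e ∈ Finset.range (D + 1), X j ^ (D - e) * homogeneousComponent e g, ?_, ?_⟩
  · refine IsHomogeneous.sum _ _ _ fun e he ↦ ?_
    have := ((isHomogeneous_X K j).pow (D - e)).mul (homogeneousComponent_isHomogeneous e g)
    rwa [one_mul, Nat.sub_add_cancel (Finset.mem_range_succ_iff.mp he)] at this
  · intro A _ _ δ hδ
    conv_rhs => rw [← sum_homogeneousComponent_of_le g hD]
    simp [map_sum, hδ]

section Chart

variable {B : Type u} [CommRing B] [Algebra K B] (δ : MvPolynomial σ K →ₐ[K] B)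

/-- The homomorphism `K[x] → B[t]`, `x_i ↦ δ(x_i) t`. -/
def coneMap : MvPolynomial σ K →ₐ[K] Polynomial B :=
  aeval fun i ↦ Polynomial.X * Polynomial.C (δ (X i))

lemma coneMap_of_isHomogeneous {f : MvPolynomial σ K} {D : ℕ} (hf : f.IsHomogeneous D) :
    coneMap δ f = Polynomial.X ^ D * Polynomial.C (δ f) := by
  rw [coneMap, aeval_mul_of_isHomogeneous hf]
  congr 1
  have : (aeval fun i ↦ (Polynomial.C (δ (X i)) : Polynomial B)) =
      (Polynomial.CAlgHom : B →ₐ[K] Polynomial B).comp δ := by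
    ext i
    simp
  rw [this]
  rfl

variable {δ} {j : σ} (hδ : Function.Surjective δ) (hj : δ (X j) = 1)

include hδ hj in
-- Over `x_j ≠ 0` the cone is the chart times the punctured line with coordinate `t = x_j`; hence
-- `K[x]` surjects onto `B[t]` once `t` is inverted.
lemma exists_coneMap_eq (w : Polynomial B) : ∃ (M : ℕ) (h : MvPolynomial σ K),
    Polynomial.X ^ M * w = coneMap δ h := by
  induction w using Polynomial.induction_on' with
  | add p q hp hq =>
    obtain ⟨M, g, hg⟩ := hp
    obtain ⟨N, h, hh⟩ := hq
    have hX : coneMap δ (X j) = Polynomial.X := by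
      rw [coneMap_of_isHomogeneous δ (isHomogeneous_X K j), hj]
      simp
    refine ⟨M + N, X j ^ N * g + X j ^ M * h, ?_⟩
    rw [map_add, map_mul, map_mul, map_pow, map_pow, hX, ← hg, ← hh]
    ring
  | monomial e b =>
    obtain ⟨g, rfl⟩ := hδ b
    obtain ⟨h, hh, hhg⟩ := exists_homogenization j g (D := g.totalDegree + e) (by omega)
    refine ⟨g.totalDegree, h, ?_⟩
    rw [coneMap_of_isHomogeneous δ hh, hhg B δ hj, ← Polynomial.C_mul_X_pow_eq_monomial]
    ring

variable {I : Ideal (MvPolynomial σ K)}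
  (hI : ∀ (f : MvPolynomial σ K) (D : ℕ), f.IsHomogeneous D → δ f = 0 → ∃ N : ℕ, X j ^ N * f ∈ I)

include hδ hj hI in
-- A point of the cone with `x_j ≠ 0`, with values in the fraction field of `K[x]/p`, gives a point
-- of `B[t]` by `x_i ↦ x_i / x_j` and `t ↦ x_j`. The map is well defined on `B` because a relation,
-- once homogenized, lies in `I ⊆ p` up to a power of `x_j ∉ p`.
lemma exists_prime_comap_coneMap (p : Ideal (MvPolynomial σ K)) [p.IsPrime] (hIp : I ≤ p)
    (hjp : X j ∉ p) : ∃ P : Ideal (Polynomial B), P.IsPrime ∧ P.comap (coneMap δ) = p := by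
  let κ := FractionRing (MvPolynomial σ K ⧸ p)
  let π : MvPolynomial σ K →ₐ[K] κ :=
    (IsScalarTower.toAlgHom K (MvPolynomial σ K ⧸ p) κ).comp (Ideal.Quotient.mkₐ K p)
  have hπ (f : MvPolynomial σ K) : π f = 0 ↔ f ∈ p := by
    simp only [π, AlgHom.comp_apply, IsScalarTower.coe_toAlgHom']
    rw [FaithfulSMul.algebraMap_eq_zero_iff, Ideal.Quotient.mkₐ_eq_mk,
      Ideal.Quotient.eq_zero_iff_mem]
  have hπj : π (X j) ≠ 0 := fun h ↦ hjp ((hπ _).mp h)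
  let τ : MvPolynomial σ K →ₐ[K] κ := aeval fun i ↦ (π (X j))⁻¹ * π (X i)
  have hπe : aeval (fun i ↦ π (X i)) = π := by
    ext i
    simp
  have hτ {f : MvPolynomial σ K} {D : ℕ} (hf : f.IsHomogeneous D) :
      τ f = (π (X j))⁻¹ ^ D * π f := by
    rw [aeval_mul_of_isHomogeneous hf, hπe]
  have hτj : τ (X j) = 1 := by
    simp only [τ, aeval_X]
    exact inv_mul_cancel₀ hπj
  have hker : RingHom.ker δ.toRingHom ≤ RingHom.ker τ.toRingHom := by
    intro g hg
    obtain ⟨h, hh, hhg⟩ := exists_homogenization j g le_rfl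
    have h1 : δ h = 0 := by rw [hhg B δ hj]; exact hg
    obtain ⟨N, hN⟩ := hI h _ hh h1
    have h2 : π h = 0 := (hπ h).mpr
      (((‹p.IsPrime›.mem_or_mem (hIp hN)).resolve_left fun h' ↦ hjp (‹p.IsPrime›.mem_of_pow_mem _ h')))
    change τ g = 0
    rw [← hhg κ τ hτj, hτ hh, h2, mul_zero]
  let ψ : B →ₐ[K] κ := AlgHom.liftOfSurjective δ hδ τ hker
  have hψ (f : MvPolynomial σ K) : ψ (δ f) = τ f := AlgHom.liftOfSurjective_apply δ hδ τ hker f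
  let Ψ : Polynomial B →+* κ := Polynomial.eval₂RingHom ψ.toRingHom (π (X j))
  have hΨ (f : MvPolynomial σ K) : Ψ (coneMap δ f) = π f := by
    have : (Polynomial.eval₂AlgHom ψ (π (X j)) (fun _ ↦ mul_comm _ _)).comp (coneMap δ) = π := by
      ext i
      change Ψ (coneMap δ (X i)) = π (X i)
      have h1 : Ψ Polynomial.X = π (X j) := Polynomial.eval₂_X _ _
      have h2 (b : B) : Ψ (Polynomial.C b) = ψ b := Polynomial.eval₂_C _ _
      rw [coneMap, aeval_X, map_mul, h1, h2, hψ]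
      simp only [τ, aeval_X]
      exact mul_inv_cancel_left₀ hπj _
    exact DFunLike.congr_fun this f
  refine ⟨RingHom.ker Ψ, RingHom.ker_isPrime Ψ, ?_⟩
  ext f
  rw [Ideal.mem_comap, RingHom.mem_ker, hΨ, hπ]

include hδ hj hI in
-- Primes of the cone off `x_j = 0` embed in `Spec B[t]` preserving strict inclusions, and `dim B[t]
-- = dim B + 1` for Noetherian `B`.
lemma krullDim_primes_le [IsNoetherianRing B] :
    Order.krullDim {p : PrimeSpectrum (MvPolynomial σ K) // I ≤ p.asIdeal ∧ X j ∉ p.asIdeal} ≤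
      ringKrullDim B + 1 := by
  choose P hP hPc using fun p : {p : PrimeSpectrum (MvPolynomial σ K) //
    I ≤ p.asIdeal ∧ X j ∉ p.asIdeal} ↦ exists_prime_comap_coneMap hδ hj hI p.1.asIdeal p.2.1 p.2.2
  rw [← Polynomial.ringKrullDim_of_isNoetherianRing]
  have hX : coneMap δ (X j) = Polynomial.X := by
    rw [coneMap_of_isHomogeneous δ (isHomogeneous_X K j), hj]
    simp
  have hmono (p q) (hpq : p ≤ q) : P p ≤ P q := by
    intro w hw
    obtain ⟨M, h, hh⟩ := exists_coneMap_eq hδ hj w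
    have h1 : coneMap δ h ∈ P p := by
      rw [← hh]
      exact Ideal.mul_mem_left _ _ hw
    have h2 : h ∈ (P p).comap (coneMap δ) := h1
    rw [hPc] at h2
    have h3 : h ∈ q.1.asIdeal := hpq h2
    rw [← hPc, Ideal.mem_comap, ← hh] at h3
    refine ((hP q).mem_or_mem h3).resolve_left fun h4 ↦ q.2.2 ?_
    rw [← hPc, Ideal.mem_comap, hX]
    exact (hP q).mem_of_pow_mem _ h4
  refine Order.krullDim_le_of_strictMono (fun p ↦ ⟨P p, hP p⟩) fun p q hpq ↦ ?_
  refine lt_of_le_of_ne (hmono p q hpq.le) fun h ↦ hpq.ne ?_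
  have h : P p = P q := congrArg PrimeSpectrum.asIdeal h
  apply Subtype.ext
  apply PrimeSpectrum.ext
  rw [← hPc, ← hPc, h]

end Chart

variable {n : ℕ}

lemma idealOfVars_isMaximal : (idealOfVars (Fin (n + 1)) K).IsMaximal := by
  have : idealOfVars (Fin (n + 1)) K = RingHom.ker (constantCoeff (R := K) (σ := Fin (n + 1))) := by
    ext p
    rw [idealOfVars, ← Set.image_univ, mem_ideal_span_X_image, RingHom.mem_ker, constantCoeff_eq]
    constructor
    · intro h
      by_contra h0
      obtain ⟨i, -, hi⟩ := h 0 (mem_support_iff.mpr h0)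
      exact hi rfl
    · intro h m hm
      by_contra! h0
      have : m = 0 := Finsupp.ext fun i ↦ h0 i trivial
      exact mem_support_iff.mp hm (this ▸ h)
  rw [this]
  exact RingHom.ker_isMaximal_of_surjective _ fun a ↦ ⟨C a, constantCoeff_C _ _⟩

open RingTheory.Sequence in
-- Ideals generated by variables are tested on the exponents of a polynomial, and multiplying by `X
-- i` does not change the exponents of the earlier variables.
lemma isWeaklyRegular_X : IsWeaklyRegular (MvPolynomial (Fin (n + 1)) K)
    (List.ofFn fun i : Fin (n + 1) ↦ (X i : MvPolynomial (Fin (n + 1)) K)) := by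
  rw [isWeaklyRegular_iff]
  intro i hi
  rw [List.length_ofFn] at hi
  have hspan : Ideal.ofList (List.take i (List.ofFn fun i : Fin (n + 1) ↦
      (X i : MvPolynomial (Fin (n + 1)) K))) = Ideal.span (X '' {j : Fin (n + 1) | (j : ℕ) < i}) := by
    rw [Ideal.ofList]
    congr 1
    ext f
    simp only [Set.mem_ofPred_eq, List.mem_take_iff_getElem, Set.mem_image]
    constructor
    · rintro ⟨a, ha, rfl⟩
      refine ⟨⟨a, ?_⟩, ?_, ?_⟩
      · simp at ha
        omega
      · simp at ha
        exact ha.1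
      · rw [List.getElem_ofFn]
    · rintro ⟨j, hj, rfl⟩
      refine ⟨j, ?_, by rw [List.getElem_ofFn]⟩
      rw [List.length_ofFn]
      exact lt_min hj j.2
  have hmul : (Ideal.ofList (List.take i (List.ofFn fun i : Fin (n + 1) ↦
      (X i : MvPolynomial (Fin (n + 1)) K))) • ⊤ : Submodule (MvPolynomial (Fin (n + 1)) K)
        (MvPolynomial (Fin (n + 1)) K)) = Ideal.span (X '' {j : Fin (n + 1) | (j : ℕ) < i}) := by
    rw [hspan, smul_eq_mul, Ideal.mul_top]
  rw [hmul, List.getElem_ofFn, isSMulRegular_iff_right_eq_zero_of_smul]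
  intro x hx
  obtain ⟨x, rfl⟩ := Ideal.Quotient.mk_surjective x
  rw [Ideal.Quotient.eq_zero_iff_mem]
  have hx : X ⟨i, hi⟩ * x ∈ Ideal.span (X '' {j : Fin (n + 1) | (j : ℕ) < i}) :=
    Ideal.Quotient.eq_zero_iff_mem.mp hx
  rw [mem_ideal_span_X_image] at hx ⊢
  intro m hm
  obtain ⟨j, hj, hjm⟩ := hx (Finsupp.single ⟨i, hi⟩ 1 + m) (by
    rw [mem_support_iff, coeff_X_mul]
    exact mem_support_iff.mp hm)
  refine ⟨j, hj, ?_⟩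
  rw [Finsupp.add_apply, Finsupp.single_apply, if_neg, zero_add] at hjm
  · exact hjm
  · rintro rfl
    exact lt_irrefl i hj

open RingTheory.Sequence in
lemma depthGE_localization [h : (idealOfVars (Fin (n + 1)) K).IsPrime] :
    DepthGE (n + 1) (ModuleCat.of (Localization.AtPrime (idealOfVars (Fin (n + 1)) K))
      (Localization.AtPrime (idealOfVars (Fin (n + 1)) K))) := by
  have hmem : ∀ r ∈ List.ofFn fun i : Fin (n + 1) ↦ (X i : MvPolynomial (Fin (n + 1)) K),
      r ∈ idealOfVars (Fin (n + 1)) K := by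
    intro r hr
    obtain ⟨i, rfl⟩ := (List.mem_ofFn' _ _).mp hr
    exact Ideal.subset_span ⟨i, rfl⟩
  have hreg := isWeaklyRegular_X.isRegular_of_isLocalization_of_mem
    (Localization.AtPrime (idealOfVars (Fin (n + 1)) K)) (idealOfVars (Fin (n + 1)) K) hmem
  intro i hi
  refine ModuleCat.subsingleton_ext_of_exists_isRegular (IsLocalRing.maximalIdeal _) _ ?_ _ ?_
    _ ?_ hreg i (by simpa using hi)
  · rw [Module.support_eq_zeroLocus, Ideal.annihilator_quotient]
  · rw [smul_eq_mul, Ideal.mul_top]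
    exact (Ideal.IsPrime.ne_top inferInstance).lt_top
  · intro r hr
    obtain ⟨x, hx, rfl⟩ := List.mem_map.mp hr
    exact (IsLocalization.AtPrime.to_map_mem_maximal_iff _ (idealOfVars (Fin (n + 1)) K) x).mpr
      (hmem x hx)

/-- The local dimension at the vertex is controlled by the cone with its vertex removed. Only the
top member of a chain of primes can be the vertex itself, and it can be replaced by a closed point
elsewhere. -/
lemma ringKrullDim_localization_quotient_le [hm : (idealOfVars (Fin (n + 1)) K).IsPrime]
    (I : Ideal (MvPolynomial (Fin (n + 1)) K)) (e : ℕ)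
    (h : ∀ j : Fin (n + 1), Order.krullDim {p : PrimeSpectrum (MvPolynomial (Fin (n + 1)) K) //
      I ≤ p.asIdeal ∧ X j ∉ p.asIdeal} ≤ e) :
    ringKrullDim (Localization.AtPrime (idealOfVars (Fin (n + 1)) K) ⧸
      I.map (algebraMap _ (Localization.AtPrime (idealOfVars (Fin (n + 1)) K)))) ≤ e := by
  let R := Localization.AtPrime (idealOfVars (Fin (n + 1)) K)
  rw [ringKrullDim_quotient, Order.krullDim]
  refine iSup_le fun l ↦ ?_
  rcases Nat.eq_zero_or_pos l.length with h0 | hpos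
  · rw [h0]
    exact_mod_cast Nat.zero_le e
  let q (i : Fin (l.length + 1)) : PrimeSpectrum (MvPolynomial (Fin (n + 1)) K) :=
    PrimeSpectrum.comap (algebraMap _ R) (l i).1
  have hq : StrictMono q := by
    intro a b hab
    have h1 : (l a).1 < (l b).1 := l.strictMono hab
    refine lt_of_le_of_ne (fun x hx ↦ h1.le hx) fun h2 ↦ h1.ne ?_
    exact PrimeSpectrum.localization_comap_injective R (idealOfVars (Fin (n + 1)) K).primeCompl h2
  have hIq (i) : I ≤ (q i).asIdeal := Ideal.map_le_iff_le_comap.mp (l i).2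
  have hqm (i) : (q i).asIdeal ≤ idealOfVars (Fin (n + 1)) K := by
    intro x hx
    rw [← IsLocalization.AtPrime.to_map_mem_maximal_iff R (idealOfVars (Fin (n + 1)) K)]
    exact IsLocalRing.le_maximalIdeal (l i).1.2.ne_top hx
  let p := q ⟨l.length - 1, by omega⟩
  have hpm : p.asIdeal < idealOfVars (Fin (n + 1)) K :=
    lt_of_lt_of_le (hq (a := ⟨l.length - 1, by omega⟩) (b := Fin.last _)
      (by rw [Fin.lt_def, Fin.val_last]; dsimp only; omega)) (hqm _)
  obtain ⟨j, hj⟩ : ∃ j : Fin (n + 1), X j ∉ p.asIdeal := by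
    by_contra! hall
    refine hpm.not_ge (Ideal.span_le.mpr ?_)
    rintro _ ⟨j, rfl⟩
    exact hall j
  -- The polynomial ring is Jacobson, so `p` is an intersection of maximal ideals, and one of them
  -- avoids `X j`.
  obtain ⟨M, hpM, hM, hjM⟩ : ∃ M : Ideal (MvPolynomial (Fin (n + 1)) K),
      p.asIdeal ≤ M ∧ M.IsMaximal ∧ X j ∉ M := by
    have hJ := IsJacobsonRing.out (inferInstance : IsJacobsonRing (MvPolynomial (Fin (n + 1)) K))
      p.2.isRadical
    rw [← hJ, Ideal.jacobson, Ideal.mem_sInf] at hj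
    push Not at hj
    obtain ⟨M, ⟨h1, h2⟩, h3⟩ := hj
    exact ⟨M, h1, h2, h3⟩
  have hpM' : p.asIdeal < M := by
    refine lt_of_le_of_ne hpM fun h1 ↦ ?_
    rw [← h1] at hM
    exact hm.ne_top (hM.1.2 _ hpm)
  have hqj (i : Fin (l.length + 1)) (hi : (i : ℕ) < l.length) : q i ≤ p := by
    apply hq.monotone
    rw [Fin.le_def]
    dsimp only
    omega
  -- The same chain with its last prime replaced by `M`. It stays strict because `p`, being properly
  -- contained in a proper ideal, is not maximal.
  let s (i : Fin (l.length + 1)) : {p : PrimeSpectrum (MvPolynomial (Fin (n + 1)) K) //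
      I ≤ p.asIdeal ∧ X j ∉ p.asIdeal} :=
    if hi : (i : ℕ) < l.length then ⟨q i, hIq i, fun hx ↦ hj (hqj i hi hx)⟩
    else ⟨⟨M, hM.isPrime⟩, (hIq _).trans hpM, hjM⟩
  have hs : StrictMono s := by
    intro a b hab
    have hab' : (a : ℕ) < b := hab
    have ha : (a : ℕ) < l.length := by omega
    simp only [s, dif_pos ha]
    split_ifs with hb
    · exact hq hab
    · have h1 : (q a).asIdeal ≤ p.asIdeal := hqj a ha
      have h2 : (q a).asIdeal < M := lt_of_le_of_lt h1 hpM'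
      exact h2
  exact (Order.LTSeries.length_le_krullDim (LTSeries.mk l.length s hs)).trans (h j)

/-- The component of `s * b` in the degree of `b` is `b` times the constant term of `s`, which is a
nonzero scalar. Thus inverting elements outside the irrelevant ideal loses no homogeneous relation.
-/
lemma mem_of_homogeneous_mul_mem {I : Ideal (MvPolynomial (Fin (n + 1)) K)}
    (hI : I.IsHomogeneous (homogeneousSubmodule (Fin (n + 1)) K)) {s b : MvPolynomial (Fin (n + 1)) K}
    {e : ℕ} (hb : b.IsHomogeneous e) (hs : s ∉ idealOfVars (Fin (n + 1)) K) (hsb : s * b ∈ I) :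
    b ∈ I := by
  have h1 := DirectSum.coe_decompose_mul_add_of_right_mem (i := 0)
    (homogeneousSubmodule (Fin (n + 1)) K) (a := s) hb
  have h2 := hI (0 + e) hsb
  rw [h1] at h2
  have h3 : ((DirectSum.decompose (homogeneousSubmodule (Fin (n + 1)) K) s) 0 :
      MvPolynomial (Fin (n + 1)) K) = C (coeff 0 s) := by
    rw [← homogeneousComponent_zero]
    exact decomposition.decompose'_apply s 0
  have h4 : coeff 0 s ≠ 0 := by
    intro h0
    apply hs
    rw [idealOfVars, ← Set.image_univ, mem_ideal_span_X_image]
    intro m hm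
    by_contra! hall
    have : m = 0 := Finsupp.ext fun i ↦ hall i trivial
    exact mem_support_iff.mp hm (this ▸ h0)
  rw [h3] at h2
  have h5 := I.mul_mem_left (C (coeff 0 s)⁻¹) h2
  rwa [← mul_assoc, ← C_mul, inv_mul_cancel₀ h4, C_1, one_mul] at h5

lemma initialIdeal_isHomogeneous {f : ℕ → MvPolynomial (Fin (n + 1)) K} {d : ℕ → ℕ} {k : ℕ}
    (hf : ∀ i < k, (f i).IsHomogeneous (d i)) :
    (initialIdeal f k).IsHomogeneous (homogeneousSubmodule (Fin (n + 1)) K) := by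
  refine Ideal.homogeneous_span _ _ ?_
  rintro _ ⟨i, hi, rfl⟩
  exact ⟨d i, hf i hi⟩

/-- Localized at the vertex, the forms lie in the maximal ideal of a ring of depth `n + 1`, and the
quotient by all of them has dimension at most `n + 1 - k`. They therefore form a regular sequence
there, and homogeneity carries this back to the polynomial ring one component at a time. -/
theorem mem_initialIdeal_of_mul_mem {f : ℕ → MvPolynomial (Fin (n + 1)) K} {d : ℕ → ℕ} {k : ℕ}
    (hf : ∀ i < k, (f i).IsHomogeneous (d i)) (hd : ∀ i < k, 0 < d i) {e : ℕ} (he : e + k = n + 1)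
    (h : ∀ j : Fin (n + 1), Order.krullDim {p : PrimeSpectrum (MvPolynomial (Fin (n + 1)) K) //
      initialIdeal f k ≤ p.asIdeal ∧ X j ∉ p.asIdeal} ≤ e)
    {i : ℕ} (hi : i < k) {b : MvPolynomial (Fin (n + 1)) K} (hb : f i * b ∈ initialIdeal f i) :
    b ∈ initialIdeal f i := by
  have hm : (idealOfVars (Fin (n + 1)) K).IsPrime := idealOfVars_isMaximal.isPrime
  let R := Localization.AtPrime (idealOfVars (Fin (n + 1)) K)
  have hmap (i : ℕ) : (initialIdeal f i).map (algebraMap _ R) =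
      initialIdeal (fun i ↦ algebraMap _ R (f i)) i := by
    rw [initialIdeal, Ideal.map_span, ← Set.image_comp]
    rfl
  have hfm (i : ℕ) (hi : i < k) : f i ∈ idealOfVars (Fin (n + 1)) K := by
    rw [idealOfVars, ← Set.image_univ, mem_ideal_span_X_image]
    intro m hm
    by_contra! hall
    have h0 : m = 0 := Finsupp.ext fun i ↦ hall i trivial
    have := (hf i hi).degree_eq_sum_deg_support hm
    rw [h0] at this
    simp at this
    exact (hd i hi).ne' this
  have hdim := ringKrullDim_localization_quotient_le (initialIdeal f k) e h
  rw [hmap] at hdim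
  have hreg := (isSMulRegular_of_dim_le (k := k) depthGE_localization
    (fun i ↦ algebraMap _ R (f i))
    (fun i hi ↦ (IsLocalization.AtPrime.to_map_mem_maximal_iff R _ _).mpr (hfm i hi))
    (by omega) (by
      have h1 : ((n + 1 : ℕ) : WithBot ℕ∞) = (e : WithBot ℕ∞) + k := by exact_mod_cast he.symm
      exact (add_le_add_left hdim _).trans_eq h1.symm) i hi.le).2 hi
  have hhom := initialIdeal_isHomogeneous (k := i) fun j hj ↦ hf j (hj.trans hi)
  have key {b : MvPolynomial (Fin (n + 1)) K} {e : ℕ} (hbe : b.IsHomogeneous e)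
      (hb : f i * b ∈ initialIdeal f i) : b ∈ initialIdeal f i := by
    have h1 : algebraMap _ R b ∈ initialIdeal (fun i ↦ algebraMap _ R (f i)) i := by
      rw [← Ideal.Quotient.eq_zero_iff_mem]
      refine (isSMulRegular_iff_right_eq_zero_of_smul.mp hreg) _ ?_
      refine Ideal.Quotient.eq_zero_iff_mem.mpr (?_ :
        algebraMap _ R (f i) * algebraMap _ R b ∈ _)
      rw [← map_mul, ← hmap]
      exact Ideal.mem_map_of_mem _ hb
    rw [← hmap, IsLocalization.algebraMap_mem_map_algebraMap_iff
      (idealOfVars (Fin (n + 1)) K).primeCompl] at h1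
    obtain ⟨s, hs, hsb⟩ := h1
    exact mem_of_homogeneous_mul_mem hhom hbe hs hsb
  rw [mem_iff_homogeneousComponent_mem hhom]
  intro a
  refine key (homogeneousComponent_isHomogeneous a b) ?_
  have h1 := DirectSum.coe_decompose_mul_add_of_left_mem (j := a)
    (homogeneousSubmodule (Fin (n + 1)) K) (b := b) (hf i hi)
  have h2 := hhom (d i + a) hb
  rw [h1] at h2
  have h3 : ((DirectSum.decompose (homogeneousSubmodule (Fin (n + 1)) K) b) a :
      MvPolynomial (Fin (n + 1)) K) = homogeneousComponent a b :=
    decomposition.decompose'_apply b a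
  rwa [h3] at h2

end GradedDepth

/-! ### Localized homogeneous ideals inside the Laurent polynomials -/

section Saturation

attribute [local instance] MvPolynomial.gradedAlgebra

open MvPolynomial

variable {K : Type u} [Field K] {n : ℕ}

/-- Natural exponents as integral exponents. -/
def castExp (n : ℕ) : (Fin (n + 1) →₀ ℕ) →+ (Fin (n + 1) → ℤ) where
  toFun b i := b i
  map_zero' := by ext; simp
  map_add' b c := by ext; simp

lemma castExp_injective : Function.Injective (castExp n) :=
  fun _ _ h ↦ Finsupp.ext fun i ↦ Int.natCast_inj.mp (congrFun h i)

/-- Polynomials as Laurent polynomials. -/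
def toLaurent : MvPolynomial (Fin (n + 1)) K →ₐ[K] Laurent K n :=
  AddMonoidAlgebra.mapDomainAlgHom K K (castExp n)

lemma toLaurent_injective : Function.Injective (toLaurent (K := K) (n := n)) :=
  AddMonoidAlgebra.mapDomain_injective castExp_injective

lemma toLaurent_monomial (b : Fin (n + 1) →₀ ℕ) (c : K) :
    toLaurent (monomial b c) = AddMonoidAlgebra.single (castExp n b) c :=
  AddMonoidAlgebra.mapDomain_single

lemma coeff_toLaurent (f : MvPolynomial (Fin (n + 1)) K) (b : Fin (n + 1) →₀ ℕ) :
    (toLaurent f).coeff (castExp n b) = coeff b f :=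
  Finsupp.mapDomain_apply castExp_injective _ _

lemma coeff_toLaurent_of_neg (f : MvPolynomial (Fin (n + 1)) K) {a : Fin (n + 1) → ℤ}
    {i : Fin (n + 1)} (hi : a i < 0) : (toLaurent f).coeff a = 0 := by
  refine Finsupp.mapDomain_of_notMem_range _ _ ?_
  rintro ⟨b, rfl⟩
  exact absurd hi (not_lt.mpr (Int.natCast_nonneg (b i)))

variable (K) in
/-- The product of the variables with index in `s`. -/
def varProd (s : Finset (Fin (n + 1))) : MvPolynomial (Fin (n + 1)) K := ∏ i ∈ s, X i

lemma toLaurent_varProd (s : Finset (Fin (n + 1))) :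
    toLaurent (varProd K s) = AddMonoidAlgebra.single (fun i ↦ if i ∈ s then 1 else 0) 1 := by
  have hX (i : Fin (n + 1)) : toLaurent (X i : MvPolynomial (Fin (n + 1)) K) =
      AddMonoidAlgebra.single (Pi.single i 1) 1 := by
    refine (toLaurent_monomial _ _).trans ?_
    congr 1
    ext j
    simp [castExp, Finsupp.single_apply, Pi.single_apply, eq_comm]
  induction s using Finset.induction_on with
  | empty =>
    rw [varProd, Finset.prod_empty, map_one, AddMonoidAlgebra.one_def]
    congr 1
  | insert i s hi ih =>
    rw [varProd, Finset.prod_insert hi, map_mul, hX]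
    rw [varProd] at ih
    rw [ih, AddMonoidAlgebra.single_mul_single, one_mul]
    congr 1
    ext j
    by_cases hj : j = i
    · subst hj; simp [hi]
    · simp [hj]

lemma toLaurent_varProd_pow (s : Finset (Fin (n + 1))) (M : ℕ) :
    toLaurent (varProd K s ^ M) =
      AddMonoidAlgebra.single (M • fun i ↦ if i ∈ s then 1 else 0) 1 := by
  rw [map_pow, toLaurent_varProd, AddMonoidAlgebra.single_pow, one_pow]

lemma isUnit_toLaurent_varProd_pow (s : Finset (Fin (n + 1))) (M : ℕ) :
    IsUnit (toLaurent (varProd K s ^ M)) := by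
  rw [toLaurent_varProd_pow]
  refine IsUnit.of_mul_eq_one
    (AddMonoidAlgebra.single (-(M • fun i ↦ if i ∈ s then 1 else 0)) 1) ?_
  rw [AddMonoidAlgebra.single_mul_single, add_neg_cancel, one_mul, AddMonoidAlgebra.one_def]

lemma varProd_isHomogeneous (s : Finset (Fin (n + 1))) : (varProd K s).IsHomogeneous s.card := by
  have := IsHomogeneous.prod s (fun i ↦ (X i : MvPolynomial (Fin (n + 1)) K)) (fun _ ↦ 1)
    fun i _ ↦ isHomogeneous_X K i
  rwa [Finset.sum_const, smul_eq_mul, mul_one] at this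

/-- The Laurent polynomials which lie in `J` after multiplication by a power of the product of the
variables with index in `s`. -/
def satur (J : Ideal (MvPolynomial (Fin (n + 1)) K)) (s : Finset (Fin (n + 1))) :
    Submodule K (Laurent K n) where
  carrier := {v | ∃ M : ℕ, ∃ g ∈ J, toLaurent (varProd K s ^ M) * v = toLaurent g}
  add_mem' := by
    rintro v w ⟨M, g, hg, hv⟩ ⟨N, h, hh, hw⟩
    refine ⟨M + N, varProd K s ^ N * g + varProd K s ^ M * h,
      J.add_mem (J.mul_mem_left _ hg) (J.mul_mem_left _ hh), ?_⟩
    rw [map_add, map_mul, map_mul, ← hv, ← hw, pow_add, map_mul]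
    ring
  zero_mem' := ⟨0, 0, J.zero_mem, by simp⟩
  smul_mem' := by
    rintro c v ⟨M, g, hg, hv⟩
    refine ⟨M, c • g, J.smul_of_tower_mem c hg, ?_⟩
    rw [mul_smul_comm, hv, map_smul]

lemma mem_satur_iff {J : Ideal (MvPolynomial (Fin (n + 1)) K)} {s : Finset (Fin (n + 1))}
    {v : Laurent K n} :
    v ∈ satur J s ↔ ∃ M : ℕ, ∃ g ∈ J, toLaurent (varProd K s ^ M) * v = toLaurent g :=
  Iff.rfl

lemma monotone_satur (J : Ideal (MvPolynomial (Fin (n + 1)) K)) : Monotone (satur J) := by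
  rintro s t hst v ⟨M, g, hg, hv⟩
  refine ⟨M, varProd K (t \ s) ^ M * g, J.mul_mem_left _ hg, ?_⟩
  have : varProd K t = varProd K (t \ s) * varProd K s := (Finset.prod_sdiff hst).symm
  rw [this, mul_pow, map_mul, map_mul, mul_assoc, hv]

lemma satur_mono {I J : Ideal (MvPolynomial (Fin (n + 1)) K)} (h : I ≤ J)
    (s : Finset (Fin (n + 1))) : satur I s ≤ satur J s := by
  rintro v ⟨M, g, hg, hv⟩
  exact ⟨M, g, h hg, hv⟩

lemma toLaurent_mul_mem_satur {J : Ideal (MvPolynomial (Fin (n + 1)) K)}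
    {s : Finset (Fin (n + 1))} (f : MvPolynomial (Fin (n + 1)) K) {v : Laurent K n}
    (hv : v ∈ satur J s) : toLaurent f * v ∈ satur J s := by
  obtain ⟨M, g, hg, hv⟩ := hv
  refine ⟨M, f * g, J.mul_mem_left _ hg, ?_⟩
  rw [mul_left_comm, hv, map_mul]

/-- The exponents of degree `m`. -/
def degSet (n : ℕ) (m : ℤ) : Set (Fin (n + 1) → ℤ) := {a | ∑ i, a i = m}

/-- The elements of degree `m` of `satur J s`. -/
def locDeg (J : Ideal (MvPolynomial (Fin (n + 1)) K)) (m : ℤ) (s : Finset (Fin (n + 1))) :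
    Submodule K (Laurent K n) := supp K (degSet n m) ⊓ satur J s

lemma monotone_locDeg (J : Ideal (MvPolynomial (Fin (n + 1)) K)) (m : ℤ) :
    Monotone (locDeg J m) :=
  fun _ _ h ↦ inf_le_inf_left _ (monotone_satur J h)

lemma locDeg_mono {I J : Ideal (MvPolynomial (Fin (n + 1)) K)} (h : I ≤ J) (m : ℤ)
    (s : Finset (Fin (n + 1))) : locDeg I m s ≤ locDeg J m s :=
  inf_le_inf_left _ (satur_mono h s)

lemma toLaurent_eq_sum (f : MvPolynomial (Fin (n + 1)) K) :
    toLaurent f = ∑ b ∈ f.support, AddMonoidAlgebra.single (castExp n b) (coeff b f) := by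
  conv_lhs => rw [f.as_sum, map_sum]
  exact Finset.sum_congr rfl fun b _ ↦ toLaurent_monomial _ _

lemma sum_castExp {f : MvPolynomial (Fin (n + 1)) K} {d : ℕ} (hf : f.IsHomogeneous d)
    {b : Fin (n + 1) →₀ ℕ} (hb : b ∈ f.support) : ∑ i, castExp n b i = d := by
  have h := hf (mem_support_iff.mp hb)
  rw [← h, Finsupp.weight_apply, Finsupp.sum_fintype _ _ (by simp)]
  simp [castExp]

lemma projOn_toLaurent_mul {f : MvPolynomial (Fin (n + 1)) K} {d : ℕ} (hf : f.IsHomogeneous d)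
    (m : ℤ) (v : Laurent K n) :
    projOn (degSet n m) (toLaurent f * v) = toLaurent f * projOn (degSet n (m - d)) v := by
  rw [toLaurent_eq_sum, Finset.sum_mul, Finset.sum_mul, map_sum]
  refine Finset.sum_congr rfl fun b hb ↦ ?_
  ext a
  have h : a ∈ degSet n m ↔ -castExp n b + a ∈ degSet n (m - d) := by
    simp only [degSet, Set.mem_ofPred_eq, Pi.add_apply, Pi.neg_apply, Finset.sum_add_distrib,
      Finset.sum_neg_distrib, sum_castExp hf hb]
    constructor <;> intro h <;> linarith
  rw [coeff_projOn, AddMonoidAlgebra.coeff_single_mul_apply,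
    AddMonoidAlgebra.coeff_single_mul_apply, coeff_projOn]
  by_cases h' : a ∈ degSet n m
  · rw [if_pos h', if_pos (h.mp h')]
  · rw [if_neg h', if_neg (fun h2 ↦ h' (h.mpr h2)), mul_zero]

lemma toLaurent_mem_supp {f : MvPolynomial (Fin (n + 1)) K} {d : ℕ} (hf : f.IsHomogeneous d) :
    toLaurent f ∈ supp K (degSet n d) := by
  rw [toLaurent_eq_sum]
  refine Submodule.sum_mem _ fun b hb ↦ mem_supp.mpr fun a ha ↦ ?_
  rw [AddMonoidAlgebra.coeff_single, Finsupp.single_apply, if_neg]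
  rintro rfl
  exact ha (sum_castExp hf hb)

lemma projOn_eq_zero {P Q : Set (Fin (n + 1) → ℤ)} (h : P ∩ Q = ∅) {v : Laurent K n}
    (hv : v ∈ supp K Q) : projOn P v = 0 := by
  have := projOn_mem_supp (P := P) hv
  rw [h] at this
  ext a
  exact mem_supp.mp this a (Set.notMem_empty a)

lemma exists_projOn_toLaurent {J : Ideal (MvPolynomial (Fin (n + 1)) K)}
    (hJ : J.IsHomogeneous (homogeneousSubmodule (Fin (n + 1)) K))
    {g : MvPolynomial (Fin (n + 1)) K} (hg : g ∈ J) (m : ℤ) :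
    ∃ h ∈ J, projOn (degSet n m) (toLaurent g) = toLaurent h := by
  suffices projOn (degSet n m) (toLaurent g) ∈
      (J.restrictScalars K).map toLaurent.toLinearMap by
    obtain ⟨h, hh, h'⟩ := this
    exact ⟨h, hh, h'.symm⟩
  have hsum := congrArg (fun g ↦ projOn (degSet n m) (toLaurent g)) (sum_homogeneousComponent g)
  simp only [map_sum] at hsum
  rw [← hsum]
  refine Submodule.sum_mem _ fun i _ ↦ ?_
  have h1 := toLaurent_mem_supp (homogeneousComponent_isHomogeneous i g)
  by_cases him : (i : ℤ) = m
  · rw [projOn_eq_self (him ▸ h1)]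
    exact ⟨_, (mem_iff_homogeneousComponent_mem hJ g).mp hg i, rfl⟩
  · rw [projOn_eq_zero _ h1]
    · exact Submodule.zero_mem _
    · ext a
      simp only [degSet, Set.mem_inter_iff, Set.mem_ofPred_eq, Set.mem_empty_iff_false, iff_false]
      rintro ⟨h2, h3⟩
      exact him (h3.symm.trans h2)

lemma projOn_mem_satur {J : Ideal (MvPolynomial (Fin (n + 1)) K)}
    (hJ : J.IsHomogeneous (homogeneousSubmodule (Fin (n + 1)) K)) {s : Finset (Fin (n + 1))}
    {v : Laurent K n} (hv : v ∈ satur J s) (m : ℤ) : projOn (degSet n m) v ∈ satur J s := by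
  obtain ⟨M, g, hg, hv⟩ := hv
  obtain ⟨h, hh, he⟩ := exists_projOn_toLaurent hJ hg (m + (s.card * M : ℕ))
  refine ⟨M, h, hh, ?_⟩
  rw [← he, ← hv, projOn_toLaurent_mul ((varProd_isHomogeneous s).pow M), add_sub_cancel_right]

lemma projOn_mem_locDeg {J : Ideal (MvPolynomial (Fin (n + 1)) K)}
    (hJ : J.IsHomogeneous (homogeneousSubmodule (Fin (n + 1)) K)) {s : Finset (Fin (n + 1))}
    {v : Laurent K n} (hv : v ∈ satur J s) (m : ℤ) : projOn (degSet n m) v ∈ locDeg J m s := by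
  refine ⟨?_, projOn_mem_satur hJ hv m⟩
  have := projOn_mem_supp (P := degSet n m) (Q := Set.univ) (v := v) (mem_supp.mpr (by simp))
  rwa [Set.inter_univ] at this

lemma toLaurent_mul_mem_locDeg {J : Ideal (MvPolynomial (Fin (n + 1)) K)}
    {s : Finset (Fin (n + 1))} {f : MvPolynomial (Fin (n + 1)) K} {d : ℕ} (hf : f.IsHomogeneous d)
    {m : ℤ} {v : Laurent K n} (hv : v ∈ locDeg J (m - d) s) : toLaurent f * v ∈ locDeg J m s := by
  refine ⟨?_, toLaurent_mul_mem_satur f hv.2⟩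
  have h1 := projOn_toLaurent_mul hf m v
  rw [projOn_eq_self hv.1] at h1
  rw [← h1]
  have := projOn_mem_supp (P := degSet n m) (Q := Set.univ) (v := toLaurent f * v)
    (mem_supp.mpr (by simp))
  rwa [Set.inter_univ] at this

/-- For the unit ideal the degree `m` part of the localization has a basis of monomials, which links
it with the computation on projective space. -/
lemma locDeg_top (m : ℤ) (s : Finset (Fin (n + 1))) :
    locDeg (⊤ : Ideal (MvPolynomial (Fin (n + 1)) K)) m s = supp K (expSet m s) := by
  apply le_antisymm
  · rintro v ⟨h1, M, g, -, h2⟩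
    refine mem_supp.mpr fun a ha ↦ ?_
    by_cases ham : a ∈ degSet n m
    · obtain ⟨i, his, hi⟩ : ∃ i ∉ s, a i < 0 := by
        by_contra! h
        exact ha ⟨ham, h⟩
      have h3 := coeff_toLaurent_of_neg g
        (a := (M • fun i ↦ if i ∈ s then 1 else 0) + a) (i := i) (by simpa [his] using hi)
      rw [← h2, toLaurent_varProd_pow, AddMonoidAlgebra.coeff_single_mul_apply, one_mul,
        neg_add_cancel_left] at h3
      exact h3
    · exact mem_supp.mp h1 a ham
  · refine le_inf (AddMonoidAlgebra.supported_mono fun a ha ↦ ha.1) ?_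
    rw [supp, AddMonoidAlgebra.supported_eq_span_single, Submodule.span_le]
    rintro _ ⟨a, ha, rfl⟩
    -- This bounds every `|a i|`, so one power clears all denominators.
    let M := ∑ i, (a i).natAbs
    have hM (i) : (a i).natAbs ≤ M :=
      Finset.single_le_sum (f := fun i ↦ (a i).natAbs) (fun _ _ ↦ Nat.zero_le _) (Finset.mem_univ i)
    refine ⟨M, monomial (Finsupp.equivFunOnFinite.symm
      fun i ↦ ((if i ∈ s then (M : ℤ) else 0) + a i).toNat) 1, trivial, ?_⟩
    rw [toLaurent_varProd_pow, AddMonoidAlgebra.single_mul_single, toLaurent_monomial, one_mul]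
    congr 1
    ext i
    have h1 := hM i
    have h2 := ha.2 i
    simp only [castExp, AddMonoidHom.coe_mk, ZeroHom.coe_mk, Finsupp.equivFunOnFinite_symm_apply_apply,
      Pi.add_apply, Pi.smul_apply]
    split_ifs with hi
    · simp only [nsmul_eq_mul, mul_one]; omega
    · have := h2 hi
      simp only [smul_zero]; omega

lemma subCech_congr {V : Type u} [AddCommGroup V] [Module K V]
    {F G : Finset (Fin (n + 1)) → Submodule K V} (hF : Monotone F) (hG : Monotone G) (h : F = G) :
    subCech hF = subCech hG := by
  subst h
  rfl

theorem finCoh_locDeg_top (d : ℕ → ℕ) (m : ℤ) : ∃ χ : ℤ,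
    FinCoh n (subCech (monotone_locDeg (⊤ : Ideal (MvPolynomial (Fin (n + 1)) K)) m)) χ ∧
      (χ : ℚ) = (hilb n d 0).eval (m : ℚ) := by
  refine ⟨_, ?_, (eval_hilb_zero d m).symm⟩
  rw [subCech_congr _ (monotone_supp_expSet m) (funext (locDeg_top m))]
  exact finCoh_supp_expSet m

lemma locDeg_bot (m : ℤ) (s : Finset (Fin (n + 1))) :
    locDeg (⊥ : Ideal (MvPolynomial (Fin (n + 1)) K)) m s = ⊥ := by
  rw [eq_bot_iff]
  rintro v ⟨-, M, g, hg, h⟩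
  rw [Ideal.mem_bot.mp hg, map_zero] at h
  exact (isUnit_toLaurent_varProd_pow s M).mul_right_eq_zero.mp h

lemma finCoh_locDeg_bot (m : ℤ) :
    FinCoh n (subCech (monotone_locDeg (⊥ : Ideal (MvPolynomial (Fin (n + 1)) K)) m)) 0 := by
  refine finCoh_of_contraction _ n (fun _ ↦ 0) (fun c ↦ ?_) (fun p c ↦ ?_)
  all_goals
    refine Subtype.ext (funext fun σ ↦ ?_)
    have := c.2 σ
    rw [locDeg_bot, Submodule.mem_bot] at this
    rw [this]
    simp

/-- The sequence `0 → J(m - d) → J(m) ⊕ S(m - d) → (J + (f))(m) → 0` with maps `v ↦ (f v, -v)` and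
`(a, b) ↦ a + f b`. In the middle, `f b = -a` lies in the localization of `J`; after clearing
denominators, regularity of `f` modulo `J` puts `b` there too. -/
lemma exists_shortExact_locDeg {J : Ideal (MvPolynomial (Fin (n + 1)) K)}
    (hJ : J.IsHomogeneous (homogeneousSubmodule (Fin (n + 1)) K))
    {f : MvPolynomial (Fin (n + 1)) K} {d : ℕ} (hf : f.IsHomogeneous d)
    (hreg : ∀ b, f * b ∈ J → b ∈ J) (m : ℤ)
    (hprod : Monotone fun s ↦ (locDeg J m s).prod
      (locDeg (⊤ : Ideal (MvPolynomial (Fin (n + 1)) K)) (m - d) s)) :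
    ∃ S : ShortComplex (CochainComplex (ModuleCat.{u} K) ℕ), S.ShortExact ∧
      S.X₁ = subCech (monotone_locDeg J (m - d)) ∧ S.X₂ = subCech hprod ∧
      S.X₃ = subCech (monotone_locDeg (J ⊔ Ideal.span {f}) m) := by
  refine exists_shortExact_subCech _ _ _
    ((LinearMap.mulLeft K (toLaurent f)).prod (-LinearMap.id))
    (LinearMap.fst K _ _ + LinearMap.mulLeft K (toLaurent f) ∘ₗ LinearMap.snd K _ _) ?_ ?_ ?_ ?_
  · intro v w h
    exact neg_injective (congrArg Prod.snd h)
  · intro s _ v hv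
    refine ⟨⟨toLaurent_mul_mem_locDeg hf hv, ?_⟩, ?_⟩
    · exact Submodule.neg_mem _ (locDeg_mono le_top _ _ hv)
    · change toLaurent f * v + toLaurent f * (-v) = 0
      ring
  · rintro s _ ⟨a, b⟩ ⟨ha, hb⟩
    refine ⟨?_, fun h ↦ ⟨-b, ⟨Submodule.neg_mem _ hb.1, Submodule.neg_mem _ ?_⟩, ?_⟩⟩
    · refine Submodule.add_mem _ (locDeg_mono le_sup_left _ _ ha) ?_
      have h1 := toLaurent_mul_mem_locDeg hf hb
      refine ⟨h1.1, ?_⟩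
      obtain ⟨M, g, -, h2⟩ := hb.2
      refine ⟨M, f * g, Ideal.mem_sup_right (Ideal.mul_mem_right _ _
        (Ideal.mem_span_singleton_self f)), ?_⟩
      change toLaurent _ * (toLaurent f * b) = _
      rw [mul_left_comm, h2, map_mul]
    · obtain ⟨M, g, hg, h1⟩ := ha.2
      obtain ⟨N, g', -, h2⟩ := hb.2
      refine ⟨M + N, varProd K s ^ M * g', hreg _ ?_, ?_⟩
      · have h3 : f * (varProd K s ^ M * g') = -(varProd K s ^ N * g) := by
          apply toLaurent_injective
          have h4 : a + toLaurent f * b = 0 := h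
          rw [map_mul, map_mul, map_neg, map_mul, ← h1, ← h2, eq_neg_iff_add_eq_zero]
          linear_combination toLaurent (varProd K s ^ M) * toLaurent (varProd K s ^ N) * h4
        rw [h3]
        exact J.neg_mem (J.mul_mem_left _ hg)
      · dsimp only at h2
        rw [pow_add, map_mul, map_mul, ← h2, mul_assoc]
    · refine Prod.ext ?_ (neg_neg b)
      have h4 : a + toLaurent f * b = 0 := h
      change toLaurent f * (-b) = a
      rw [mul_neg]
      exact (eq_neg_of_add_eq_zero_left h4).symm
  · rintro s _ w ⟨hw, M, g, hg, h1⟩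
    obtain ⟨j, hj, _, hfc, rfl⟩ := Submodule.mem_sup.mp hg
    obtain ⟨c, rfl⟩ := Ideal.mem_span_singleton'.mp hfc
    obtain ⟨u, hu⟩ := isUnit_toLaurent_varProd_pow (K := K) s M
    have ha : ↑u⁻¹ * toLaurent j ∈ satur J s := ⟨M, j, hj, by
      rw [← hu, Units.mul_inv_cancel_left]⟩
    have hb : ↑u⁻¹ * toLaurent c ∈ satur ⊤ s := ⟨M, c, trivial, by
      rw [← hu, Units.mul_inv_cancel_left]⟩
    -- The preimages obtained from `g = j + c f` need not be homogeneous. Projecting them to degrees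
    -- `m` and `m - d` keeps their image, because `w` has degree `m`.
    refine ⟨(_, _), ⟨projOn_mem_locDeg hJ ha m, projOn_mem_locDeg ?_ hb (m - d)⟩, ?_⟩
    · exact Ideal.IsHomogeneous.top _
    · change projOn _ _ + toLaurent f * projOn _ _ = w
      rw [← projOn_toLaurent_mul hf, ← map_add, ← projOn_eq_self hw]
      congr 1
      rw [← Units.inv_mul_cancel_left u w, hu, h1, map_add, map_mul]
      ring

/-- Additivity of `χ` gives `χ(J_{i+1}, m) = χ(J_i, m) + χ(S, m - d_i) - χ(J_i, m - d_i)`. Passing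
to `χ(S, ·) - χ(J_i, ·)` turns this into the recursion for `hilb`. -/
theorem finCoh_locDeg {f : ℕ → MvPolynomial (Fin (n + 1)) K} {d : ℕ → ℕ} {k : ℕ}
    (hf : ∀ i < k, (f i).IsHomogeneous (d i))
    (hreg : ∀ i < k, ∀ b, f i * b ∈ initialIdeal f i → b ∈ initialIdeal f i)
    {i : ℕ} (hi : i ≤ k) (m : ℤ) :
    ∃ χ : ℤ, FinCoh n (subCech (monotone_locDeg (initialIdeal f i) m)) χ ∧
      (hilb n d 0).eval (m : ℚ) - χ = (hilb n d i).eval (m : ℚ) := by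
  induction i generalizing m with
  | zero =>
    have : initialIdeal f 0 = ⊥ := by simp [initialIdeal]
    rw [this]
    exact ⟨0, finCoh_locDeg_bot m, by simp⟩
  | succ i ih =>
    obtain ⟨χ₁, h₁, e₁⟩ := ih (by omega) (m - d i)
    obtain ⟨χ₂, h₂, e₂⟩ := ih (by omega) m
    obtain ⟨χ₃, h₃, e₃⟩ := finCoh_locDeg_top (K := K) (n := n) d (m - d i)
    have hprod : Monotone fun s ↦ (locDeg (initialIdeal f i) m s).prod
        (locDeg (⊤ : Ideal (MvPolynomial (Fin (n + 1)) K)) (m - d i) s) :=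
      fun _ _ h ↦ Submodule.prod_mono (monotone_locDeg _ _ h) (monotone_locDeg _ _ h)
    obtain ⟨S, hS, s₁, s₂, s₃⟩ := exists_shortExact_locDeg
      (initialIdeal_isHomogeneous fun j (hj : j < i) ↦ hf j (by omega)) (hf i (by omega))
      (hreg i (by omega)) m hprod
    have h := FinCoh.prod hprod h₂ h₃
    rw [← s₁] at h₁
    rw [← s₂] at h
    have h' := FinCoh.right hS h₁ h
    rw [s₃, ← initialIdeal_succ] at h'
    refine ⟨_, h', ?_⟩
    have hi' : hilb n d (i + 1) =
        hilb n d i - (hilb n d i).comp (Polynomial.X - Polynomial.C (d i : ℚ)) := rfl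
    rw [hi', Polynomial.eval_sub, Polynomial.eval_comp, Polynomial.eval_sub, Polynomial.eval_X,
      Polynomial.eval_C]
    rw [← e₂]
    push_cast at e₁ e₃ ⊢
    rw [← e₁, e₃]
    ring

end Saturation

attribute [local instance] MvPolynomial.gradedAlgebra

/-! ### Regular functions on the basic open sets of `Proj` -/

section Generic

variable {A : Type u} [CommRing A] {σ : Type*} [SetLike σ A] [AddSubgroupClass σ A] (𝒜 : ℕ → σ)
  [GradedRing 𝒜] (f : A)

/-- A degree zero element pulled back from `Spec 𝒜₀` is the same fraction on every `D₊(f)`. This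
identifies the scalars of the structure morphism with constant polynomials. -/
lemma toSpecZero_appTop_presheaf_map {m : ℕ} (hf : f ∈ 𝒜 m) (hm : 0 < m) :
    (Scheme.ΓSpecIso (.of (𝒜 0))).inv ≫ (Proj.toSpecZero 𝒜).appTop ≫
      (Proj 𝒜).presheaf.map (homOfLE (le_top : Proj.basicOpen 𝒜 f ≤ ⊤)).op =
    CommRingCat.ofHom (HomogeneousLocalization.fromZeroRingHom 𝒜 (Submonoid.powers f)) ≫
      Proj.awayToSection 𝒜 f := by
  have h1 : (Proj.basicOpen 𝒜 f).ι ≫ Proj.toSpecZero 𝒜 = Proj.basicOpenToSpec 𝒜 f ≫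
      Spec.map (CommRingCat.ofHom (HomogeneousLocalization.fromZeroRingHom 𝒜 _)) := by
    rw [← Proj.basicOpenIsoSpec_hom 𝒜 f hf hm, ← Proj.awayι_toSpecZero 𝒜 f hf hm,
      ← Proj.basicOpenIsoSpec_inv_ι, Category.assoc, Iso.hom_inv_id_assoc]
  have h2 : (Proj.toSpecZero 𝒜).appTop ≫
      (Proj 𝒜).presheaf.map (homOfLE (le_top : Proj.basicOpen 𝒜 f ≤ ⊤)).op =
      ((Proj.basicOpen 𝒜 f).ι ≫ Proj.toSpecZero 𝒜).appTop ≫ (Proj.basicOpen 𝒜 f).topIso.hom := by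
    rw [Scheme.Hom.comp_appTop, Category.assoc]
    congr 1
  rw [h2, h1, Scheme.Hom.comp_appTop, Category.assoc, ← Scheme.ΓSpecIso_inv_naturality_assoc]
  congr 1
  have h3 : (Proj.basicOpenToSpec 𝒜 f).appTop = (Scheme.ΓSpecIso _).hom ≫
      Proj.awayToSection 𝒜 f ≫ (Proj.basicOpen 𝒜 f).topIso.inv :=
    Proj.basicOpenToSpec_app_top 𝒜 f
  rw [h3, Category.assoc, Category.assoc, Iso.inv_hom_id_assoc, Iso.inv_hom_id, Category.comp_id]

/-- In the homogeneous localization at `x` the denominator `f ^ d` is a unit, so the fraction is a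
unit exactly when its numerator avoids the prime of `x`. -/
lemma mem_basicOpen_awayToSection {m : ℕ} (hf : f ∈ 𝒜 m) (x : Proj 𝒜)
    (hx : x ∈ Proj.basicOpen 𝒜 f) {d : ℕ} {a : A} (ha : a ∈ 𝒜 (d • m)) :
    x ∈ (Proj 𝒜).basicOpen ((Proj.awayToSection 𝒜 f).hom
      (HomogeneousLocalization.Away.mk 𝒜 hf d a ha)) ↔ x ∈ Proj.basicOpen 𝒜 a := by
  have := x.isPrime
  have h1 := Scheme.mem_basicOpen (Proj 𝒜) ((Proj.awayToSection 𝒜 f).hom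
      (HomogeneousLocalization.Away.mk 𝒜 hf d a ha)) x hx
  refine h1.trans ((MulEquiv.isUnit_map (Proj.stalkIso' 𝒜 x)).symm.trans ?_)
  have h2 : Proj.stalkIso' 𝒜 x ((Proj 𝒜).presheaf.germ (Proj.basicOpen 𝒜 f) x hx
      ((Proj.awayToSection 𝒜 f).hom (HomogeneousLocalization.Away.mk 𝒜 hf d a ha))) =
      HomogeneousLocalization.mapId _ (Submonoid.powers_le.mpr hx)
        (HomogeneousLocalization.Away.mk 𝒜 hf d a ha) :=
    Proj.stalkIso'_germ _ _ x hx _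
  refine (iff_of_eq (congrArg IsUnit h2)).trans ?_
  refine (HomogeneousLocalization.isUnit_iff_isUnit_val _ _ _).symm.trans ?_
  change IsUnit (Localization.mk a (⟨f ^ d, _⟩ : Ideal.primeCompl _)) ↔ _
  rw [Localization.mk_eq_mk', IsLocalization.AtPrime.isUnit_mk'_iff _
    x.asHomogeneousIdeal.toIdeal]
  rfl

end Generic

/-! ### Dehomogenization on the standard charts -/

section Charts

open MvPolynomial

variable {K : Type u} [Field K] {n : ℕ}

/-- The degree zero part of `K[x₀, …, xₙ, 1/x_j]`. -/
abbrev AwayX (K : Type u) [Field K] {n : ℕ} (j : Fin (n + 1)) : Type u :=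
  HomogeneousLocalization.Away (homogeneousSubmodule (Fin (n + 1)) K) (X j)

/-- The quotient `f / x_j ^ d` for a form `f` of degree `d`. -/
abbrev awayMk (j : Fin (n + 1)) {d : ℕ} (f : MvPolynomial (Fin (n + 1)) K)
    (hf : f.IsHomogeneous d) : AwayX K j :=
  HomogeneousLocalization.Away.mk _ (d := 1) (isHomogeneous_X K j) d f (by simpa using hf)

/-- Dehomogenization, `x_i ↦ x_i / x_j`. -/
def toAway (j : Fin (n + 1)) : MvPolynomial (Fin (n + 1)) K →+* AwayX K j :=
  eval₂Hom ((HomogeneousLocalization.fromZeroRingHom (homogeneousSubmodule (Fin (n + 1)) K)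
    (Submonoid.powers (X j))).comp
      (algebraMap K (homogeneousSubmodule (Fin (n + 1)) K 0)))
    fun i ↦ awayMk j (X i) (isHomogeneous_X K i)

lemma val_awayMk (j : Fin (n + 1)) {d : ℕ} (f : MvPolynomial (Fin (n + 1)) K)
    (hf : f.IsHomogeneous d) :
    (awayMk j f hf).val = Localization.mk f (⟨X j ^ d, d, rfl⟩ : Submonoid.powers (X j)) := by
  exact HomogeneousLocalization.Away.val_mk _ _ _ _ _

/-- The degree zero part injects into the full localization. There, with `u = 1 / x_j`, homogeneity
gives `f(u x) = u^d f(x)`. -/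
lemma toAway_of_isHomogeneous (j : Fin (n + 1)) {d : ℕ} {f : MvPolynomial (Fin (n + 1)) K}
    (hf : f.IsHomogeneous d) : toAway j f = awayMk j f hf := by
  apply HomogeneousLocalization.val_injective
  rw [val_awayMk]
  let L := Localization (Submonoid.powers (X j : MvPolynomial (Fin (n + 1)) K))
  let v : AwayX K j →+* L := algebraMap _ _
  let w : MvPolynomial (Fin (n + 1)) K →+* L := algebraMap _ _
  let u : L := Localization.mk 1 (⟨X j, 1, pow_one _⟩ : Submonoid.powers (X j))
  have h1 : v.comp (toAway j) = (aeval (R := K) fun i ↦ u * w (X i)).toRingHom := by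
    apply ringHom_ext
    · intro c
      rw [RingHom.comp_apply, toAway, coe_eval₂Hom, eval₂_C]
      change Localization.mk (C c) 1 = aeval _ (C c)
      rw [aeval_C, IsScalarTower.algebraMap_apply K (MvPolynomial (Fin (n + 1)) K) L]
      exact Localization.mk_one_eq_algebraMap _
    · intro i
      rw [RingHom.comp_apply, toAway, coe_eval₂Hom, eval₂_X]
      change (awayMk j (X i) (isHomogeneous_X K i)).val = aeval _ (X i)
      rw [val_awayMk, aeval_X]
      change _ = Localization.mk _ _ * algebraMap _ _ _
      rw [← Localization.mk_one_eq_algebraMap, Localization.mk_mul]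
      simp
  have h2 : v (toAway j f) = aeval (R := K) (fun i ↦ u * w (X i)) f := congrArg (fun g ↦ g f) h1
  have h3 : aeval (R := K) (fun i ↦ w (X i)) f = w f := by
    have : (aeval (R := K) fun i ↦ w (X i)) =
        IsScalarTower.toAlgHom K (MvPolynomial (Fin (n + 1)) K) L := by
      ext i
      simp [w]
    rw [this]
    rfl
  refine h2.trans ?_
  rw [aeval_mul_of_isHomogeneous hf, h3]
  change Localization.mk _ _ ^ d * algebraMap _ _ _ = _
  rw [← Localization.mk_one_eq_algebraMap, Localization.mk_pow, Localization.mk_mul, one_pow,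
    one_mul, mul_one]
  rfl

lemma awayToSection_fromZero (j : Fin (n + 1)) :
    (Scheme.ΓSpecIso (.of K)).inv ≫ (toSpecField K n).appTop ≫
      (PSpace K n).presheaf.map (homOfLE (le_top : chart K j ≤ ⊤)).op =
    CommRingCat.ofHom ((HomogeneousLocalization.fromZeroRingHom
      (homogeneousSubmodule (Fin (n + 1)) K) (Submonoid.powers (X j))).comp
        (algebraMap K (homogeneousSubmodule (Fin (n + 1)) K 0))) ≫
      Proj.awayToSection (homogeneousSubmodule (Fin (n + 1)) K) (X j) := by
  rw [CommRingCat.ofHom_comp, Category.assoc, ← toSpecZero_appTop_presheaf_map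
    (homogeneousSubmodule (Fin (n + 1)) K) (X j) (m := 1) (isHomogeneous_X K j) one_pos,
    Scheme.ΓSpecIso_inv_naturality_assoc, toSpecField, Scheme.Hom.comp_appTop, Category.assoc]
  rfl

lemma mem_basicOpen_coordRatio {i j : Fin (n + 1)} (x : PSpace K n) (hx : x ∈ chart K j) :
    x ∈ (PSpace K n).basicOpen (coordRatio K i j) ↔ x ∈ chart K i :=
  mem_basicOpen_awayToSection _ _ _ x hx _

lemma basicOpen_coordRatio (i j : Fin (n + 1)) :
    (PSpace K n).basicOpen (coordRatio K i j) = chart K j ⊓ chart K i := by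
  ext x
  constructor
  · intro hx
    have hj := (PSpace K n).basicOpen_le _ hx
    exact ⟨hj, (mem_basicOpen_coordRatio x hj).mp hx⟩
  · rintro ⟨hj, hi⟩
    exact (mem_basicOpen_coordRatio x hj).mpr hi

lemma coordRatio_cocycle (K : Type u) [Field K] {n : ℕ} (l i j : Fin (n + 1)) :
    ((PSpace K n).presheaf.map (homOfLE (inf_le_right : chart K i ⊓ chart K j ≤ chart K j)).op).hom
        (coordRatio K l j) =
    ((PSpace K n).presheaf.map (homOfLE (inf_le_right : chart K i ⊓ chart K j ≤ chart K j)).op).hom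
        (coordRatio K i j) *
      ((PSpace K n).presheaf.map (homOfLE (inf_le_left : chart K i ⊓ chart K j ≤ chart K i)).op).hom
        (coordRatio K l i) := by
  refine Subtype.ext (funext fun x ↦ ?_)
  have := x.1.isPrime
  have hj : Submonoid.powers (X j) ≤ Ideal.primeCompl x.1.asHomogeneousIdeal.toIdeal :=
    Submonoid.powers_le.mpr x.2.2
  have hi : Submonoid.powers (X i) ≤ Ideal.primeCompl x.1.asHomogeneousIdeal.toIdeal :=
    Submonoid.powers_le.mpr x.2.1
  change HomogeneousLocalization.mapId _ hj (awayMk j (X l) (isHomogeneous_X K l)) =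
    HomogeneousLocalization.mapId _ hj (awayMk j (X i) (isHomogeneous_X K i)) *
      HomogeneousLocalization.mapId _ hi (awayMk i (X l) (isHomogeneous_X K l))
  apply HomogeneousLocalization.val_injective
  rw [HomogeneousLocalization.val_mul]
  change Localization.mk (X l) (⟨X j ^ 1, hj ⟨1, rfl⟩⟩ : Ideal.primeCompl _) =
    Localization.mk (X i) (⟨X j ^ 1, hj ⟨1, rfl⟩⟩ : Ideal.primeCompl _) *
    Localization.mk (X l) (⟨X i ^ 1, hi ⟨1, rfl⟩⟩ : Ideal.primeCompl _)
  rw [Localization.mk_mul, Localization.mk_eq_mk_iff, Localization.r_iff_exists]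
  exact ⟨1, by simp; ring⟩

lemma coordRatio_self (j : Fin (n + 1)) : coordRatio K j j = 1 := by
  rw [coordRatio, dehomog]
  have : awayMk j (X j) (isHomogeneous_X K j) = 1 := by
    apply HomogeneousLocalization.val_injective
    rw [val_awayMk, HomogeneousLocalization.val_one, ← Localization.mk_one,
      Localization.mk_eq_mk_iff, Localization.r_iff_exists]
    exact ⟨1, by simp⟩
  exact (congrArg _ this).trans (map_one _)

end Charts

/-! ### Evaluating forms on open subsets of `X` -/

section CoordHom

open MvPolynomial

variable {K : Type u} [Field K] {n : ℕ} {X : Scheme.{u}} (ι : X ⟶ PSpace K n)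

lemma app_map {V W : (PSpace K n).Opens} (h : W ≤ V) (s : Γ(PSpace K n, V)) :
    (ι.app W).hom (((PSpace K n).presheaf.map (homOfLE h).op).hom s) =
      (X.presheaf.map (homOfLE (ι.preimage_mono h)).op).hom ((ι.app V).hom s) := by
  rw [← CommRingCat.comp_apply, ← CommRingCat.comp_apply, Scheme.Hom.naturality]
  rfl

/-- The evaluation of polynomials on an open subset of `X ∩ D₊(x_j)`, by `x_i ↦ x_i / x_j`. -/
def coordHom (j : Fin (n + 1)) {U : X.Opens} (hU : U ≤ chartOn ι j) :
    MvPolynomial (Fin (n + 1)) K →ₐ[K] Sec ι U :=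
  aeval fun i ↦ res ι hU (ratioOn ι i j)

lemma res_coordHom (j : Fin (n + 1)) {U V : X.Opens} (h : U ≤ V) (hV : V ≤ chartOn ι j)
    (f : MvPolynomial (Fin (n + 1)) K) :
    res ι h (coordHom ι j hV f) = coordHom ι j (h.trans hV) f := by
  have : (res ι h).comp (coordHom ι j hV) = coordHom ι j (h.trans hV) := by
    ext i
    simp only [coordHom, AlgHom.comp_apply, aeval_X, res_res]
  exact congrArg (fun g ↦ g f) this

lemma ratioOn_self (j : Fin (n + 1)) : ratioOn ι j j = 1 := by
  rw [ratioOn, coordRatio_self]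
  exact map_one (ι.app (chart K j)).hom

lemma coordHom_X_self (j : Fin (n + 1)) {U : X.Opens} (hU : U ≤ chartOn ι j) :
    coordHom ι j hU (MvPolynomial.X j) = 1 := by
  rw [coordHom, aeval_X, ratioOn_self, map_one]

lemma ratioOn_cocycle {U : X.Opens} (l i j : Fin (n + 1)) (hi : U ≤ chartOn ι i)
    (hj : U ≤ chartOn ι j) :
    res ι hj (ratioOn ι l j) = res ι hj (ratioOn ι i j) * res ι hi (ratioOn ι l i) := by
  have hU : U ≤ ι ⁻¹ᵁ (chart K i ⊓ chart K j) := le_inf hi hj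
  have h := congrArg (fun s ↦ (X.presheaf.map (homOfLE hU).op).hom
    ((ι.app (chart K i ⊓ chart K j)).hom s)) (coordRatio_cocycle K l i j)
  simp only [map_mul, app_map] at h
  rw [map_map, map_map, map_map] at h
  exact h

/-- From `x_l / x_j = (x_i / x_j) (x_l / x_i)` and homogeneity. The factor is the transition
function of `𝒪_X(d)`. -/
lemma coordHom_change {U : X.Opens} {i j : Fin (n + 1)} (hi : U ≤ chartOn ι i)
    (hj : U ≤ chartOn ι j) {f : MvPolynomial (Fin (n + 1)) K} {d : ℕ} (hf : f.IsHomogeneous d) :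
    coordHom ι j hj f = (ratioUnit ι hi hj : Sec ι U) ^ d * coordHom ι i hi f := by
  rw [coordHom, coordHom, ← aeval_mul_of_isHomogeneous hf]
  congr 2
  funext l
  exact ratioOn_cocycle ι l i j hi hj

/-- Elements of the degree zero localization as regular functions on `D₊(x_j)`. -/
def awayHom (K : Type u) [Field K] {n : ℕ} (j : Fin (n + 1)) :
    AwayX K j →+* Γ(PSpace K n, chart K j) :=
  (Proj.awayToSection (homogeneousSubmodule (Fin (n + 1)) K) (MvPolynomial.X j)).hom

lemma awayHom_toAway_C (j : Fin (n + 1)) (c : K) :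
    (ι.app (chart K j)).hom (awayHom K j (toAway j (C c))) = algebraMap K (Sec ι (chartOn ι j)) c := by
  have h := congrArg (fun g ↦ (ι.app (chart K j)).hom (g.hom c)) (awayToSection_fromZero j)
  rw [toAway, coe_eval₂Hom, eval₂_C]
  refine Eq.trans (Eq.symm h) ?_
  change ((Scheme.ΓSpecIso (.of K)).inv ≫ (toSpecField K n).appTop ≫
    (PSpace K n).presheaf.map (homOfLE (le_top : chart K j ≤ ⊤)).op ≫ ι.app (chart K j)).hom c =
    ((Scheme.ΓSpecIso (.of K)).inv ≫ (ι ≫ toSpecField K n).appTop ≫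
      X.presheaf.map (homOfLE le_top).op).hom c
  rw [Scheme.Hom.comp_appTop, Scheme.Hom.naturality, Category.assoc]
  rfl

lemma toAway_X (i j : Fin (n + 1)) :
    toAway j (MvPolynomial.X i) = awayMk j (MvPolynomial.X i) (isHomogeneous_X K i) := by
  rw [toAway, coe_eval₂Hom, eval₂_X]

lemma coordHom_chartOn (j : Fin (n + 1)) (f : MvPolynomial (Fin (n + 1)) K) :
    coordHom ι j le_rfl f = (ι.app (chart K j)).hom (awayHom K j (toAway j f)) := by
  have : (coordHom ι j le_rfl).toRingHom =
      ((ι.app (chart K j)).hom.comp (awayHom K j)).comp (toAway j) := by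
    apply ringHom_ext
    · intro c
      refine Eq.trans ?_ (awayHom_toAway_C ι j c).symm
      exact (coordHom ι j le_rfl).commutes c
    · intro i
      refine Eq.trans ?_ (congrArg (fun z ↦ (ι.app (chart K j)).hom (awayHom K j z))
        (toAway_X i j).symm)
      change coordHom ι j le_rfl (MvPolynomial.X i) = _
      rw [coordHom, aeval_X]
      change res ι le_rfl _ = ratioOn ι i j
      exact congrArg (fun g ↦ g.hom (ratioOn ι i j)) (X.presheaf.map_id _)
  exact congrArg (fun g ↦ g f) this

lemma coordHom_chartOn_of_isHomogeneous (j : Fin (n + 1)) {f : MvPolynomial (Fin (n + 1)) K}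
    {d : ℕ} (hf : f.IsHomogeneous d) :
    coordHom ι j le_rfl f = (ι.app (chart K j)).hom (dehomog j f hf) := by
  rw [coordHom_chartOn, toAway_of_isHomogeneous j hf]
  rfl

lemma awayToSection_bijective (j : Fin (n + 1)) : Function.Bijective (awayHom K j) :=
  (Proj.basicOpenIsoAway (homogeneousSubmodule (Fin (n + 1)) K) (MvPolynomial.X j) (m := 1)
    (isHomogeneous_X K j) one_pos).commRingCatIsoToRingEquiv.bijective

lemma exists_dehomog (j : Fin (n + 1)) (s : Γ(PSpace K n, chart K j)) :
    ∃ (d : ℕ) (f : MvPolynomial (Fin (n + 1)) K) (hf : f.IsHomogeneous d), dehomog j f hf = s := by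
  obtain ⟨z, rfl⟩ := (awayToSection_bijective j).2 s
  obtain ⟨d, f, hf, rfl⟩ := HomogeneousLocalization.Away.mk_surjective
    (homogeneousSubmodule (Fin (n + 1)) K) (d := 1) (isHomogeneous_X K j) z
  exact ⟨d, f, by simpa using hf, rfl⟩

lemma isAffineOpen_chart (j : Fin (n + 1)) : IsAffineOpen (chart K j) :=
  Proj.isAffineOpen_basicOpen _ _ (m := 1) (isHomogeneous_X K j) one_pos

lemma isAffineOpen_chartOn [IsAffineHom ι] (j : Fin (n + 1)) : IsAffineOpen (chartOn ι j) :=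
  (isAffineOpen_chart j).preimage ι

/-- A closed immersion is surjective on sections over the affine chart, where every function is a
form divided by a power of `x_j`. -/
lemma exists_coordHom_eq [IsClosedImmersion ι] (j : Fin (n + 1)) (a : Sec ι (chartOn ι j)) :
    ∃ (d : ℕ) (f : MvPolynomial (Fin (n + 1)) K), f.IsHomogeneous d ∧
      coordHom ι j le_rfl f = a := by
  obtain ⟨s, rfl⟩ := ι.app_surjective (chart K j) (isAffineOpen_chart j) a
  obtain ⟨d, f, hf, rfl⟩ := exists_dehomog j s
  exact ⟨d, f, hf, coordHom_chartOn_of_isHomogeneous ι j hf⟩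

lemma basicOpen_ratioOn (i j : Fin (n + 1)) :
    X.basicOpen (ratioOn ι i j : Γ(X, chartOn ι j)) = chartOn ι j ⊓ chartOn ι i := by
  have h := congrArg (ι ⁻¹ᵁ ·) (basicOpen_coordRatio (K := K) i j)
  simp only [Scheme.preimage_basicOpen] at h
  exact h

lemma basicOpen_coordHom_varProd (j : Fin (n + 1)) (s : Finset (Fin (n + 1))) :
    X.basicOpen (coordHom ι j le_rfl (varProd K s) : Γ(X, chartOn ι j)) =
      chartOn ι j ⊓ s.inf (chartOn ι) := by
  induction s using Finset.induction_on with
  | empty =>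
    rw [varProd, Finset.prod_empty, map_one, Finset.inf_empty, inf_top_eq]
    exact X.basicOpen_of_isUnit isUnit_one
  | insert i s hi ih =>
    have h1 : coordHom ι j le_rfl (varProd K (insert i s)) =
        ratioOn ι i j * coordHom ι j le_rfl (varProd K s) := by
      rw [varProd, Finset.prod_insert hi, map_mul, coordHom, aeval_X]
      congr 1
      exact congrArg (fun g ↦ g.hom (ratioOn ι i j)) (X.presheaf.map_id _)
    rw [h1, Finset.inf_insert]
    refine (X.basicOpen_mul _ _).trans ?_
    rw [basicOpen_ratioOn, ih, ← inf_inf_distrib_left]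

lemma isUnit_coordHom_varProd (j : Fin (n + 1)) {s : Finset (Fin (n + 1))} {U : X.Opens}
    (hU : U ≤ chartOn ι j) (hs : U ≤ s.inf (chartOn ι)) :
    IsUnit (coordHom ι j hU (varProd K s)) := by
  rw [varProd, map_prod]
  refine Finset.prod_induction _ IsUnit (fun _ _ ↦ IsUnit.mul) isUnit_one fun i hi ↦ ?_
  rw [coordHom, aeval_X]
  exact (ratioUnit ι (hs.trans (Finset.inf_le hi)) hU).isUnit

/-- The intersection with further charts is the locus in the affine open `X ∩ D₊(x_j)` where the
product of the corresponding ratios is invertible. -/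
lemma isLocalization_sec [IsAffineHom ι] {j : Fin (n + 1)} {s : Finset (Fin (n + 1))}
    {U : X.Opens} (hU : U = chartOn ι j ⊓ s.inf (chartOn ι)) (hj : U ≤ chartOn ι j) :
    let := (res ι hj).toRingHom.toAlgebra
    IsLocalization.Away (coordHom ι j le_rfl (varProd K s)) (Sec ι U) := by
  rw [← basicOpen_coordHom_varProd] at hU
  subst hU
  exact (isAffineOpen_chartOn ι j).isLocalization_basicOpen _

lemma exists_pow_mul_eq_coordHom [IsClosedImmersion ι] {j : Fin (n + 1)}
    {s : Finset (Fin (n + 1))} {U : X.Opens} (hU : U = chartOn ι j ⊓ s.inf (chartOn ι))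
    (hj : U ≤ chartOn ι j) (a : Sec ι U) :
    ∃ (N d : ℕ) (f : MvPolynomial (Fin (n + 1)) K), f.IsHomogeneous d ∧
      coordHom ι j hj (varProd K s ^ N) * a = coordHom ι j hj f := by
  let := (res ι hj).toRingHom.toAlgebra
  have := isLocalization_sec ι hU hj
  obtain ⟨⟨b, ⟨_, N, rfl⟩⟩, h⟩ := IsLocalization.surj
    (Submonoid.powers (coordHom ι j le_rfl (varProd K s))) a
  obtain ⟨d, f, hf, rfl⟩ := exists_coordHom_eq ι j b
  refine ⟨N, d, f, hf, ?_⟩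
  have h' : a * res ι hj (coordHom ι j le_rfl (varProd K s) ^ N) =
    res ι hj (coordHom ι j le_rfl f) := h
  rw [map_pow, res_coordHom, res_coordHom] at h'
  rw [mul_comm, map_pow, h']

lemma exists_pow_mul_coordHom_eq_zero [IsAffineHom ι] {j : Fin (n + 1)}
    {s : Finset (Fin (n + 1))} {U : X.Opens} (hU : U = chartOn ι j ⊓ s.inf (chartOn ι))
    (hj : U ≤ chartOn ι j) {f : MvPolynomial (Fin (n + 1)) K} (hf : coordHom ι j hj f = 0) :
    ∃ N : ℕ, coordHom ι j le_rfl (varProd K s ^ N * f) = 0 := by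
  let := (res ι hj).toRingHom.toAlgebra
  have := isLocalization_sec ι hU hj
  have h1 : algebraMap (Sec ι (chartOn ι j)) (Sec ι U) (coordHom ι j le_rfl f) = 0 := by
    change res ι hj _ = 0
    rw [res_coordHom, hf]
  obtain ⟨⟨_, N, rfl⟩, h⟩ := (IsLocalization.map_eq_zero_iff
    (Submonoid.powers (coordHom ι j le_rfl (varProd K s))) _ _).mp h1
  exact ⟨N, by rw [map_mul, map_pow]; exact h⟩

/-- In `K[x, 1/x_j]` the fraction `g / x_j^e` and the form `g` differ by a unit, so membership in
the chart ideal becomes membership in the extension of `(f)`. Clearing denominators gives the power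
of `x_j`. -/
lemma exists_pow_mul_mem_of_dehomog_mem {κ : Type*} {f : κ → MvPolynomial (Fin (n + 1)) K}
    {d : κ → ℕ} (hf : ∀ i, (f i).IsHomogeneous (d i)) {j : Fin (n + 1)} {D : ℕ}
    {h : MvPolynomial (Fin (n + 1)) K} (hh : h.IsHomogeneous D)
    (hmem : dehomog j h hh ∈ Ideal.span (Set.range fun i ↦ dehomog j (f i) (hf i))) :
    ∃ N : ℕ, MvPolynomial.X j ^ N * h ∈ Ideal.span (Set.range f) := by
  have h1 : awayMk j h hh ∈ Ideal.span (Set.range fun i ↦ awayMk j (f i) (hf i)) := by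
    have h3 : (Set.range fun i ↦ dehomog j (f i) (hf i)) =
        awayHom K j '' Set.range fun i ↦ awayMk j (f i) (hf i) := by
      rw [← Set.range_comp]
      rfl
    rw [h3, ← Ideal.map_span] at hmem
    obtain ⟨z, hz, h4⟩ := (Ideal.mem_map_iff_of_surjective _ (awayToSection_bijective j).2).mp hmem
    have h5 : z = awayMk j h hh := (awayToSection_bijective j).1 h4
    exact h5 ▸ hz
  let S := MvPolynomial (Fin (n + 1)) K
  let L := Localization (Submonoid.powers (MvPolynomial.X j : S))
  let v : AwayX K j →+* L := algebraMap _ _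
  have h2 {g : S} {e : ℕ} (hg : g.IsHomogeneous e) (I : Ideal L) :
      v (awayMk j g hg) ∈ I ↔ algebraMap S L g ∈ I := by
    have h3 : v (awayMk j g hg) * algebraMap S L (MvPolynomial.X j ^ e) = algebraMap S L g := by
      change (awayMk j g hg).val * _ = _
      rw [val_awayMk, ← Localization.mk_one_eq_algebraMap, ← Localization.mk_one_eq_algebraMap,
        Localization.mk_mul, Localization.mk_eq_mk_iff, Localization.r_iff_exists]
      exact ⟨1, by simp [mul_comm]⟩
    have h4 : IsUnit (algebraMap S L (MvPolynomial.X j ^ e)) :=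
      IsLocalization.map_units L (⟨_, e, rfl⟩ : Submonoid.powers (MvPolynomial.X j : S))
    rw [← h3]
    exact (I.mul_unit_mem_iff_mem h4).symm
  have h5 : v (awayMk j h hh) ∈ (Ideal.span (Set.range f)).map (algebraMap S L) := by
    have h6 := Ideal.mem_map_of_mem v h1
    refine (Ideal.map_le_iff_le_comap.mpr (Ideal.span_le.mpr ?_)) h6
    rintro _ ⟨i, rfl⟩
    exact (h2 (hf i) _).mpr (Ideal.mem_map_of_mem _ (Ideal.subset_span (Set.mem_range_self i)))
  rw [h2, IsLocalization.algebraMap_mem_map_algebraMap_iff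
    (Submonoid.powers (MvPolynomial.X j : S))] at h5
  obtain ⟨_, ⟨N, rfl⟩, h7⟩ := h5
  exact ⟨N, h7⟩

end CoordHom

/-! ### Evaluating Laurent polynomials whose denominators become units -/

section FracEval

open MvPolynomial

variable {K : Type u} [Field K] {n : ℕ} {s : Finset (Fin (n + 1))}

section Ring

variable {A : Type u} [CommRing A] [Algebra K A] (φ : MvPolynomial (Fin (n + 1)) K →ₐ[K] A)

/-- The value has to be `φ(g) / φ(varProd s)^M`. It does not depend on the chosen representation,
since polynomials embed in Laurent polynomials and cross-multiplied identities already hold before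
applying `φ`. -/
lemma exists_frac (hs : IsUnit (φ (varProd K s))) {v : Laurent K n} (hv : v ∈ satur ⊤ s) :
    ∃ a : A, ∀ h g, toLaurent h * v = toLaurent g → φ h * a = φ g := by
  obtain ⟨M, g, -, hg⟩ := hv
  obtain ⟨u, hu⟩ := hs.pow M
  refine ⟨↑u⁻¹ * φ g, fun h g' hh ↦ ?_⟩
  have h1 : h * g = varProd K s ^ M * g' := by
    apply toLaurent_injective
    rw [map_mul, map_mul, ← hg, ← hh]
    ring
  rw [← map_pow] at hu
  rw [mul_left_comm, ← map_mul, h1, map_mul, ← hu, Units.inv_mul_cancel_left]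

/-- The extension of a ring homomorphism to the Laurent polynomials whose denominators are powers
of the product of the variables with index in `s`. -/
def fracEvalFun (hs : IsUnit (φ (varProd K s)))
    (v : satur (⊤ : Ideal (MvPolynomial (Fin (n + 1)) K)) s) : A :=
  (exists_frac φ hs v.2).choose

lemma mul_fracEvalFun (hs : IsUnit (φ (varProd K s))) (v : satur ⊤ s)
    {h g : MvPolynomial (Fin (n + 1)) K} (hh : toLaurent h * v.1 = toLaurent g) :
    φ h * fracEvalFun φ hs v = φ g :=
  (exists_frac φ hs v.2).choose_spec h g hh

/-- The linear map `fracEvalFun`. -/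
def fracEval (hs : IsUnit (φ (varProd K s))) :
    satur (⊤ : Ideal (MvPolynomial (Fin (n + 1)) K)) s →ₗ[K] A where
  toFun v := fracEvalFun φ hs v
  map_add' v w := by
    obtain ⟨M, g, -, hg⟩ := mem_satur_iff.mp v.2
    obtain ⟨N, h, -, hh⟩ := mem_satur_iff.mp w.2
    refine (hs.pow (M + N)).mul_left_cancel ?_
    rw [← map_pow, mul_fracEvalFun φ hs (v + w) (g := varProd K s ^ N * g + varProd K s ^ M * h),
      map_add, map_mul, map_mul, ← mul_fracEvalFun φ hs v hg, ← mul_fracEvalFun φ hs w hh, pow_add,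
      map_mul]
    · ring
    · rw [map_add, map_mul, map_mul, ← hg, ← hh, pow_add, map_mul, Submodule.coe_add]
      ring
  map_smul' c v := by
    obtain ⟨M, g, -, hg⟩ := mem_satur_iff.mp v.2
    refine (hs.pow M).mul_left_cancel ?_
    rw [← map_pow, mul_fracEvalFun φ hs (c • v) (g := c • g), RingHom.id_apply, mul_smul_comm,
      mul_fracEvalFun φ hs v hg, map_smul]
    rw [map_smul, ← hg, Submodule.coe_smul, mul_smul_comm]

lemma mul_fracEval (hs : IsUnit (φ (varProd K s))) (v : satur ⊤ s)
    {h g : MvPolynomial (Fin (n + 1)) K} (hh : toLaurent h * v.1 = toLaurent g) :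
    φ h * fracEval φ hs v = φ g :=
  mul_fracEvalFun φ hs v hh

lemma eq_fracEval (hs : IsUnit (φ (varProd K s))) (v : satur ⊤ s) {a : A} {M : ℕ}
    {g : MvPolynomial (Fin (n + 1)) K} (hg : toLaurent (varProd K s ^ M) * v.1 = toLaurent g)
    (ha : φ (varProd K s ^ M) * a = φ g) : a = fracEval φ hs v := by
  refine (hs.pow M).mul_left_cancel ?_
  rw [← map_pow, ha, mul_fracEval φ hs v hg]

lemma comp_fracEval {B : Type u} [CommRing B] [Algebra K B] (ρ : A →ₐ[K] B)
    (ψ : MvPolynomial (Fin (n + 1)) K →ₐ[K] B) (h : ∀ f, ρ (φ f) = ψ f)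
    {t : Finset (Fin (n + 1))} (hs : IsUnit (φ (varProd K s))) (ht : IsUnit (ψ (varProd K t)))
    (v : satur ⊤ s) (w : satur ⊤ t) (hvw : v.1 = w.1) :
    ρ (fracEval φ hs v) = fracEval ψ ht w := by
  obtain ⟨M, g, -, hg⟩ := v.2
  have h1 : IsUnit (ψ (varProd K s ^ M)) := by
    rw [← h, map_pow]
    exact (hs.pow M).map ρ
  refine h1.mul_left_cancel ?_
  rw [mul_fracEval ψ ht w (hvw ▸ hg), ← h, ← h, ← map_mul, mul_fracEval φ hs v hg]

/-- Cancels the denominator in a change of chart: `a` is the degree of the denominator, `p` its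
value in the old chart and `D` the degree of the numerator. What remains is `u ^ (D - a) = u ^ m`,
the transition function of `𝒪_X(m)`. -/
lemma eq_units_zpow_mul {u : Aˣ} {x y p : A} (hp : IsUnit p) {a D : ℕ} {m : ℤ}
    (hD : (D : ℤ) = m + a) (h : (u : A) ^ a * p * x = (u : A) ^ D * (p * y)) :
    x = ((u ^ m : Aˣ) : A) * y := by
  refine ((u.isUnit.pow a).mul hp).mul_left_cancel ?_
  have h1 : (u : A) ^ D = ((u ^ m : Aˣ) : A) * (u : A) ^ a := by
    rw [← Units.val_pow_eq_pow_val, ← Units.val_pow_eq_pow_val, ← Units.val_mul, ← zpow_natCast,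
      ← zpow_natCast, ← zpow_add, hD]
  rw [h, h1]
  ring

end Ring

lemma isHomogeneous_of_toLaurent_mem_supp {g : MvPolynomial (Fin (n + 1)) K} {D : ℕ}
    (hg : toLaurent g ∈ supp K (degSet n D)) : g.IsHomogeneous D := by
  intro b hb
  by_contra h
  refine hb ?_
  rw [← coeff_toLaurent]
  refine mem_supp.mp hg _ fun h1 ↦ h ?_
  have h2 : ∑ i, (b i : ℤ) = D := h1
  rw [Finsupp.weight_apply, Finsupp.sum_fintype _ _ (by simp)]
  simp only [Pi.one_apply, smul_eq_mul, mul_one]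
  exact_mod_cast h2

/-- Extra powers of the product of the variables make the degree of the numerator a natural number
even when `m` is negative; this needs at least one variable in `s`. -/
lemma exists_isHomogeneous_of_mem_locDeg (hs : s.Nonempty) {m : ℤ} {v : Laurent K n}
    (hv : v ∈ locDeg (⊤ : Ideal (MvPolynomial (Fin (n + 1)) K)) m s) :
    ∃ (M D : ℕ) (g : MvPolynomial (Fin (n + 1)) K), g.IsHomogeneous D ∧
      (D : ℤ) = m + (s.card * M : ℕ) ∧ toLaurent (varProd K s ^ M) * v = toLaurent g := by
  obtain ⟨hm, M, g, -, hg⟩ := hv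
  have hg' : toLaurent (varProd K s ^ (m.natAbs + M)) * v =
      toLaurent (varProd K s ^ m.natAbs * g) := by
    rw [pow_add, map_mul, map_mul, ← hg, mul_assoc]
  have hc : 1 ≤ s.card := hs.card_pos
  have h1 : m.natAbs ≤ s.card * (m.natAbs + M) :=
    (Nat.le_add_right _ _).trans (Nat.le_mul_of_pos_left _ hc)
  obtain ⟨D, hD⟩ : ∃ D : ℕ, (D : ℤ) = m + (s.card * (m.natAbs + M) : ℕ) :=
    ⟨(m + (s.card * (m.natAbs + M) : ℕ)).toNat, Int.toNat_of_nonneg (by omega)⟩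
  refine ⟨m.natAbs + M, D, _, isHomogeneous_of_toLaurent_mem_supp ?_, hD, hg'⟩
  have h2 := projOn_toLaurent_mul ((varProd_isHomogeneous (K := K) s).pow (m.natAbs + M)) D v
  rw [show (D : ℤ) - (s.card * (m.natAbs + M) : ℕ) = m by omega, projOn_eq_self hm, hg'] at h2
  rw [← h2]
  have := projOn_mem_supp (P := degSet n D) (Q := Set.univ)
    (v := toLaurent (varProd K s ^ m.natAbs * g)) (mem_supp.mpr (by simp))
  rwa [Set.inter_univ] at this

end FracEval

/-! ### From Laurent polynomials of degree `m` to sections of `𝒪_X(m)` -/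

section ToTwist

open MvPolynomial

variable {K : Type u} [Field K] {n : ℕ} {X : Scheme.{u}} (ι : X ⟶ PSpace K n)
  {s : Finset (Fin (n + 1))} {U : X.Opens}

/-- A Laurent polynomial of degree `m` as a section of `𝒪_X(m)`. -/
def toTwist (m : ℤ) (hs : s.Nonempty) (hU : U ≤ s.inf (chartOn ι)) :
    locDeg (⊤ : Ideal (MvPolynomial (Fin (n + 1)) K)) m s →ₗ[K] twist ι m U :=
  (LinearMap.pi fun j ↦ fracEval (coordHom ι j (inf_le_right : U ⊓ chartOn ι j ≤ _))
    (isUnit_coordHom_varProd ι j _ (inf_le_left.trans hU)) ∘ₗ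
      Submodule.inclusion inf_le_right).codRestrict _ (by
    intro v i j
    obtain ⟨M, D, g, hg, hD, hv⟩ := exists_isHomogeneous_of_mem_locDeg hs v.2
    set W := U ⊓ (chartOn ι i ⊓ chartOn ι j)
    have hWi : W ≤ chartOn ι i := inf_le_right.trans inf_le_left
    have hWj : W ≤ chartOn ι j := inf_le_right.trans inf_le_right
    have hWs : W ≤ s.inf (chartOn ι) := inf_le_left.trans hU
    -- In every chart the component is characterized by the same fraction `g / varProd s ^ M`.
    -- Changing charts multiplies numerator and denominator by powers of the ratio, with exponents
    -- differing by `m`.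
    have key (l : Fin (n + 1)) (hl : W ≤ U ⊓ chartOn ι l) :
        coordHom ι l (hl.trans inf_le_right) (varProd K s ^ M) *
          res ι hl (fracEval (coordHom ι l (inf_le_right : U ⊓ chartOn ι l ≤ _))
            (isUnit_coordHom_varProd ι l _ (inf_le_left.trans hU))
              (Submodule.inclusion inf_le_right v)) = coordHom ι l (hl.trans inf_le_right) g := by
      rw [comp_fracEval _ (res ι hl) (coordHom ι l (hl.trans inf_le_right))
        (res_coordHom ι l hl _) _ (isUnit_coordHom_varProd ι l _ hWs) _
          (Submodule.inclusion inf_le_right v) rfl]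
      exact mul_fracEval _ _ _ hv
    refine eq_units_zpow_mul ((isUnit_coordHom_varProd ι i hWi hWs).pow M) hD ?_
    have h1 := coordHom_change ι hWi hWj ((varProd_isHomogeneous (K := K) s).pow M)
    rw [← map_pow, ← h1]
    refine (key j _).trans ?_
    rw [coordHom_change ι hWi hWj hg]
    congr 1
    exact (key i _).symm)

lemma toTwist_apply (m : ℤ) (hs : s.Nonempty) (hU : U ≤ s.inf (chartOn ι))
    (v : locDeg (⊤ : Ideal (MvPolynomial (Fin (n + 1)) K)) m s) (j : Fin (n + 1)) :
    (toTwist ι m hs hU v).1 j = fracEval (coordHom ι j (inf_le_right : U ⊓ chartOn ι j ≤ _))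
      (isUnit_coordHom_varProd ι j _ (inf_le_left.trans hU)) ⟨v.1, v.2.2⟩ := rfl

lemma twistRes_toTwist (m : ℤ) {t : Finset (Fin (n + 1))} (hs : s.Nonempty) (ht : t.Nonempty)
    {V : X.Opens} (hU : U ≤ s.inf (chartOn ι)) (hV : V ≤ t.inf (chartOn ι)) (hVU : V ≤ U)
    (v : locDeg (⊤ : Ideal (MvPolynomial (Fin (n + 1)) K)) m s)
    (w : locDeg (⊤ : Ideal (MvPolynomial (Fin (n + 1)) K)) m t) (hvw : v.1 = w.1) :
    twistRes ι m hVU (toTwist ι m hs hU v) = toTwist ι m ht hV w := by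
  refine Subtype.ext (funext fun j ↦ ?_)
  change res ι _ ((toTwist ι m hs hU v).1 j) = _
  rw [toTwist_apply, toTwist_apply]
  exact comp_fracEval _ _ _ (res_coordHom ι j _ _) _ _ _ _ hvw

section Equations

variable {κ : Type*} {f : κ → MvPolynomial (Fin (n + 1)) K} {d : κ → ℕ}
  (hf : ∀ i, (f i).IsHomogeneous (d i))
  (hker : ∀ j : Fin (n + 1), RingHom.ker (ι.app (chart K j)).hom =
    Ideal.span (Set.range fun i ↦ dehomog j (f i) (hf i)))

include hker

lemma exists_pow_X_mul_mem_of_coordHom_eq_zero {j : Fin (n + 1)} {D : ℕ}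
    {h : MvPolynomial (Fin (n + 1)) K} (hh : h.IsHomogeneous D)
    (h0 : coordHom ι j le_rfl h = 0) : ∃ N : ℕ, MvPolynomial.X j ^ N * h ∈ Ideal.span (Set.range f) := by
  refine exists_pow_mul_mem_of_dehomog_mem hf hh ?_
  rw [← hker j, RingHom.mem_ker]
  exact (coordHom_chartOn_of_isHomogeneous ι j hh).symm.trans h0

lemma exists_varProd_pow_mul_mem_of_coordHom_eq_zero [IsAffineHom ι] {j : Fin (n + 1)}
    (hjs : j ∈ s) (hU : U = chartOn ι j ⊓ s.inf (chartOn ι)) (hj : U ≤ chartOn ι j) {D : ℕ}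
    {h : MvPolynomial (Fin (n + 1)) K} (hh : h.IsHomogeneous D)
    (h0 : coordHom ι j hj h = 0) : ∃ N : ℕ, varProd K s ^ N * h ∈ Ideal.span (Set.range f) := by
  obtain ⟨N, hN⟩ := exists_pow_mul_coordHom_eq_zero ι hU hj h0
  obtain ⟨M, hM⟩ := exists_pow_X_mul_mem_of_coordHom_eq_zero ι hf hker
    (((varProd_isHomogeneous s).pow N).mul hh) hN
  refine ⟨M + N, ?_⟩
  have h1 : varProd K s = varProd K (s.erase j) * MvPolynomial.X j := (Finset.prod_erase_mul _ _ hjs).symm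
  have h2 : varProd K s ^ (M + N) * h =
      varProd K (s.erase j) ^ M * (MvPolynomial.X j ^ M * (varProd K s ^ N * h)) := by
    rw [pow_add]
    nth_rw 1 [h1]
    ring
  rw [h2]
  exact Ideal.mul_mem_left _ _ hM

lemma coordHom_eq_zero_of_mem {j : Fin (n + 1)} (hj : U ≤ chartOn ι j)
    {h : MvPolynomial (Fin (n + 1)) K} (hh : h ∈ Ideal.span (Set.range f)) :
    coordHom ι j hj h = 0 := by
  refine (Ideal.span_le (I := RingHom.ker (coordHom ι j hj))).mpr ?_ hh
  rintro _ ⟨i, rfl⟩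
  change coordHom ι j hj (f i) = 0
  rw [← res_coordHom ι j hj le_rfl, coordHom_chartOn_of_isHomogeneous ι j (hf i)]
  have h1 : dehomog j (f i) (hf i) ∈ RingHom.ker (ι.app (chart K j)).hom := by
    rw [hker j]
    exact Ideal.subset_span ⟨i, rfl⟩
  exact (congrArg _ (RingHom.mem_ker.mp h1)).trans (map_zero (res ι hj))

/-- A vanishing component at a single `j ∈ s` suffices: its numerator restricts to zero, hence lies
in `(f)` after multiplication by a power of the product of the variables in `s`. Conversely, the
forms `f i` vanish on `X` in every chart. -/
lemma toTwist_eq_zero_iff [IsAffineHom ι] (m : ℤ) (hs : s.Nonempty) (hU : U = s.inf (chartOn ι))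
    (v : locDeg (⊤ : Ideal (MvPolynomial (Fin (n + 1)) K)) m s) :
    toTwist ι m hs hU.le v = 0 ↔ v.1 ∈ locDeg (Ideal.span (Set.range f)) m s := by
  constructor
  · intro h
    obtain ⟨j, hj⟩ := id hs
    obtain ⟨M, D, g, hg, hD, hv⟩ := exists_isHomogeneous_of_mem_locDeg hs v.2
    have h1 := mul_fracEval (coordHom ι j (inf_le_right : U ⊓ chartOn ι j ≤ _))
      (isUnit_coordHom_varProd ι j _ (inf_le_left.trans hU.le)) ⟨v.1, v.2.2⟩ hv
    have h2 : fracEval (coordHom ι j (inf_le_right : U ⊓ chartOn ι j ≤ _))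
      (isUnit_coordHom_varProd ι j _ (inf_le_left.trans hU.le)) ⟨v.1, v.2.2⟩ = 0 :=
      congrFun (congrArg Subtype.val h) j
    rw [h2] at h1
    obtain ⟨N, hN⟩ := exists_varProd_pow_mul_mem_of_coordHom_eq_zero ι hf hker hj
      (by rw [hU, inf_comm]) _ hg (h1.symm.trans (mul_zero _))
    refine ⟨v.2.1, mem_satur_iff.mpr ⟨N + M, _, hN, ?_⟩⟩
    rw [pow_add, map_mul, map_mul, ← hv, mul_assoc]
  · intro h
    obtain ⟨M, g, hg, hv⟩ := mem_satur_iff.mp (Submodule.mem_inf.mp h).2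
    refine Subtype.ext (funext fun j ↦ ?_)
    have h1 : (0 : Sec ι (U ⊓ chartOn ι j)) =
        fracEval (coordHom ι j (inf_le_right : U ⊓ chartOn ι j ≤ _))
          (isUnit_coordHom_varProd ι j _ (inf_le_left.trans hU.le)) ⟨v.1, v.2.2⟩ := by
      refine eq_fracEval _ _ _ hv ?_
      rw [coordHom_eq_zero_of_mem ι hf hker _ hg, mul_zero]
    exact h1.symm

end Equations

/-- For `j ∈ s` the open set `U` lies in the chart of `x_j`, so a section is determined by its
component there. That component is a fraction of forms, and powers of `x_j` correct its degree. -/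
lemma toTwist_surjective [IsClosedImmersion ι] (m : ℤ) (hs : s.Nonempty)
    (hU : U = s.inf (chartOn ι)) : Function.Surjective (toTwist ι m hs hU.le) := by
  intro t
  obtain ⟨j, hj⟩ := id hs
  have hUj : U ≤ chartOn ι j := hU.le.trans (Finset.inf_le hj)
  obtain ⟨N, D, f, hf, h1⟩ := exists_pow_mul_eq_coordHom ι (U := U ⊓ chartOn ι j) (s := s)
    (by rw [hU, inf_comm]) inf_le_right (t.1 j)
  -- The fraction `f / varProd s ^ N` may have the wrong degree. Multiplying by `x_j^{e₁} /
  -- x_j^{e₂}` brings it to degree `m` without changing the component, as `x_j` evaluates to `1` in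
  -- its own chart.
  obtain ⟨e₁, e₂, he⟩ : ∃ e₁ e₂ : ℕ, (D : ℤ) + e₁ = m + s.card * N + e₂ :=
    ⟨(m + s.card * N - D).toNat, (D - (m + s.card * N)).toNat, by omega⟩
  obtain ⟨w, hw⟩ := isUnit_toLaurent_varProd_pow (K := K) s N
  have hXj : IsUnit (toLaurent (MvPolynomial.X j ^ e₂ : MvPolynomial (Fin (n + 1)) K)) := by
    have := isUnit_toLaurent_varProd_pow (K := K) {j} e₂
    rwa [varProd, Finset.prod_singleton] at this
  obtain ⟨w', hw'⟩ := hXj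
  let v : Laurent K n := ((w⁻¹ : (Laurent K n)ˣ) : Laurent K n) *
     (((w'⁻¹ : (Laurent K n)ˣ) : Laurent K n) * toLaurent (MvPolynomial.X j ^ e₁ * f))
  have hv : toLaurent (varProd K s ^ N * MvPolynomial.X j ^ e₂) * v = toLaurent (MvPolynomial.X j ^ e₁ * f) := by
    rw [map_mul, ← hw, ← hw', mul_comm (w : Laurent K n), mul_assoc, Units.mul_inv_cancel_left,
      Units.mul_inv_cancel_left]
  have hvsat : v ∈ satur ⊤ s := by
    refine ⟨N + e₂, varProd K (s.erase j) ^ e₂ * (MvPolynomial.X j ^ e₁ * f), trivial, ?_⟩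
    have h2 : varProd K s = varProd K (s.erase j) * MvPolynomial.X j := (Finset.prod_erase_mul _ _ hj).symm
    have h3 : varProd K s ^ (N + e₂) =
        varProd K (s.erase j) ^ e₂ * (varProd K s ^ N * MvPolynomial.X j ^ e₂) := by
      rw [pow_add]
      nth_rw 2 [h2]
      ring
    rw [h3, map_mul, mul_assoc, hv, ← map_mul]
  have hvdeg : v ∈ supp K (degSet n m) := by
    have h2 := projOn_toLaurent_mul (((varProd_isHomogeneous (K := K) s).pow N).mul
      ((isHomogeneous_X K j).pow e₂)) (D + e₁ : ℕ) v
    rw [hv, projOn_eq_self (toLaurent_mem_supp (by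
      have := ((isHomogeneous_X K j).pow e₁).mul hf
      rwa [one_mul, add_comm e₁ D] at this)), ← hv] at h2
    have h3 : IsUnit (toLaurent (varProd K s ^ N * MvPolynomial.X j ^ e₂)) := by
      rw [map_mul, ← hw, ← hw']
      exact w.isUnit.mul w'.isUnit
    have h4 := h3.mul_left_cancel h2
    rw [h4]
    have := projOn_mem_supp (P := degSet n ((D + e₁ : ℕ) - (s.card * N + 1 * e₂ : ℕ)))
      (Q := Set.univ) (v := v) (mem_supp.mpr (by simp))
    rw [Set.inter_univ] at this
    convert this using 3
    push_cast
    linarith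
  refine ⟨⟨v, hvdeg, hvsat⟩, ?_⟩
  have hcomp : (toTwist ι m hs hU.le ⟨v, hvdeg, hvsat⟩).1 j = t.1 j := by
    rw [toTwist_apply]
    have h2 := mul_fracEval (coordHom ι j (inf_le_right : U ⊓ chartOn ι j ≤ _))
      (isUnit_coordHom_varProd ι j _ (inf_le_left.trans hU.le)) ⟨v, hvsat⟩ hv
    rw [map_mul, map_mul, map_pow _ (MvPolynomial.X j), map_pow _ (MvPolynomial.X j), coordHom_X_self, one_pow, one_pow,
      mul_one, one_mul, ← h1] at h2
    have h3 := (isUnit_coordHom_varProd ι j (inf_le_right : U ⊓ chartOn ι j ≤ _)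
      (inf_le_left.trans hU.le)).pow N
    rw [← map_pow] at h3
    exact h3.mul_left_cancel h2
  refine Subtype.ext (funext fun i ↦ ?_)
  -- The gluing relation with `j` determines component `i` on `U ∩ D₊(x_j) ∩ D₊(x_i)`, which is all
  -- of `U ∩ D₊(x_i)`.
  have h4 := (toTwist ι m hs hU.le ⟨v, hvdeg, hvsat⟩).2 j i
  rw [hcomp] at h4
  have h5 := h4.trans (t.2 j i).symm
  have h6 : U ⊓ chartOn ι i ≤ U ⊓ (chartOn ι j ⊓ chartOn ι i) :=
    le_inf inf_le_left (le_inf (inf_le_left.trans hUj) inf_le_right)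
  have h7 := congrArg (res ι h6) h5
  rw [res_res, res_res] at h7
  have h8 (x : Sec ι (U ⊓ chartOn ι i)) : res ι le_rfl x = x :=
    congrArg (fun g ↦ g.hom x) (X.presheaf.map_id _)
  rwa [h8, h8] at h7

end ToTwist

/-! ### The Čech complex of `𝒪_X(m)` as a quotient, and the dimension of the cone -/

section Geometry

open MvPolynomial

variable {K : Type u} [Field K] {n : ℕ} {X : Scheme.{u}} (ι : X ⟶ PSpace K n)

lemma chartInter_eq {p : ℕ} (σ : Fin (p + 1) ↪o Fin (n + 1)) :
    chartInter ι σ = (vertices σ).inf (chartOn ι) := by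
  rw [vertices, Finset.inf_map]
  rfl

/-- Cochains with values in Laurent polynomials as cochains with values in `𝒪_X(m)`. -/
def toCochain (m : ℤ) (p : ℕ) :
    subCochain (locDeg (⊤ : Ideal (MvPolynomial (Fin (n + 1)) K)) m) p →ₗ[K] Cochain ι m p :=
  LinearMap.pi fun σ ↦ toTwist ι m (vertices_nonempty σ) (chartInter_eq ι σ).le ∘ₗ
    ((LinearMap.proj σ).restrict fun _ hc ↦ hc σ)

lemma toCochain_apply (m : ℤ) (p : ℕ)
    (c : subCochain (locDeg (⊤ : Ideal (MvPolynomial (Fin (n + 1)) K)) m) p)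
    (σ : Fin (p + 1) ↪o Fin (n + 1)) :
    toCochain ι m p c σ =
      toTwist ι m (vertices_nonempty σ) (chartInter_eq ι σ).le ⟨c.1 σ, c.2 σ⟩ := rfl

lemma cechD_toCochain (m : ℤ) (p : ℕ) :
    cechD ι m p ∘ₗ toCochain ι m p = toCochain ι m (p + 1) ∘ₗ cechSub (monotone_locDeg ⊤ m) p := by
  refine LinearMap.ext fun c ↦ funext fun τ ↦ ?_
  rw [LinearMap.comp_apply, LinearMap.comp_apply, cechD_apply, toCochain_apply]
  have hle (a : Fin (p + 2)) : vertices (a.succAboveOrderEmb.trans τ) ≤ vertices τ := by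
    rw [vertices_face]
    exact Finset.erase_subset _ _
  let w (a : Fin (p + 2)) : locDeg (⊤ : Ideal (MvPolynomial (Fin (n + 1)) K)) m (vertices τ) :=
    ⟨c.1 (a.succAboveOrderEmb.trans τ), monotone_locDeg _ m (hle a) (c.2 _)⟩
  have h1 (a : Fin (p + 2)) : twistRes ι m (chartInter_le ι τ (Fin.succAboveOrderEmb a))
      (toCochain ι m p c ((Fin.succAboveOrderEmb a).trans τ)) =
      toTwist ι m (vertices_nonempty τ) (chartInter_eq ι τ).le (w a) :=
    twistRes_toTwist ι m (vertices_nonempty _) (vertices_nonempty τ) (chartInter_eq ι _).le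
      (chartInter_eq ι τ).le _ ⟨_, c.2 _⟩ (w a) rfl
  simp only [h1, ← map_zsmul, ← map_sum]
  congr 1
  refine Subtype.ext ?_
  refine Eq.trans ?_ (cechV_apply p c.1 τ).symm
  simp [w]

lemma ringKrullDim_sec_le [IsAffineHom ι] (j : Fin (n + 1)) :
    ringKrullDim (Sec ι (chartOn ι j)) ≤ topologicalKrullDim X := by
  have h1 := (isAffineOpen_chartOn ι j).fromSpec.isOpenEmbedding.isInducing.topologicalKrullDim_le
  refine le_trans (le_of_eq ?_) h1
  exact (PrimeSpectrum.topologicalKrullDim_eq_ringKrullDim (Γ(X, chartOn ι j))).symm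

lemma toCochain_surjective [IsClosedImmersion ι] (m : ℤ) (p : ℕ) :
    Function.Surjective (toCochain ι m p) := fun t ↦ by
  choose v hv using fun σ ↦ toTwist_surjective ι m (vertices_nonempty σ) (chartInter_eq ι σ) (t σ)
  refine ⟨⟨fun σ ↦ (v σ).1, fun σ ↦ (v σ).2⟩, funext fun σ ↦ ?_⟩
  exact hv σ

variable {κ : Type*} {f : κ → MvPolynomial (Fin (n + 1)) K} {d : κ → ℕ}
  (hf : ∀ i, (f i).IsHomogeneous (d i))
  (hker : ∀ j : Fin (n + 1), RingHom.ker (ι.app (chart K j)).hom =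
    Ideal.span (Set.range fun i ↦ dehomog j (f i) (hf i)))

include hker

lemma toCochain_eq_zero_iff [IsAffineHom ι] (m : ℤ) (p : ℕ)
    (c : subCochain (locDeg (⊤ : Ideal (MvPolynomial (Fin (n + 1)) K)) m) p) :
    toCochain ι m p c = 0 ↔ c.1 ∈ subCochain (locDeg (Ideal.span (Set.range f)) m) p := by
  have h1 (σ : Fin (p + 1) ↪o Fin (n + 1)) : toCochain ι m p c σ = 0 ↔
      c.1 σ ∈ locDeg (Ideal.span (Set.range f)) m (vertices σ) :=
    toTwist_eq_zero_iff ι hf hker m (vertices_nonempty σ) (chartInter_eq ι σ) ⟨c.1 σ, c.2 σ⟩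
  exact funext_iff.trans (forall_congr' h1)

/-- Each intersection of charts is indexed by a nonempty set of variables. Over it every section of
`𝒪_X(m)` comes from a Laurent polynomial, and those inducing zero form the localized ideal. -/
lemma exists_shortExact_cechComplex [IsClosedImmersion ι] (m : ℤ) :
    ∃ S : ShortComplex (CochainComplex (ModuleCat.{u} K) ℕ), S.ShortExact ∧
      S.X₁ = subCech (monotone_locDeg (Ideal.span (Set.range f)) m) ∧
      S.X₂ = subCech (monotone_locDeg (⊤ : Ideal (MvPolynomial (Fin (n + 1)) K)) m) ∧
      S.X₃ = cechComplex ι m := by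
  refine exists_shortExact_ofLinearMaps _ _ (cechD_cechD ι m)
    (fun p ↦ Submodule.inclusion fun c hc σ ↦ locDeg_mono le_top _ _ (hc σ))
    (fun p ↦ toCochain ι m p) (fun p ↦ rfl) (cechD_toCochain ι m)
    (fun p ↦ Submodule.inclusion_injective _) (toCochain_surjective ι m) (fun p c ↦ ?_)
  have h1 := toCochain_eq_zero_iff ι hf hker m p c
  constructor
  · intro h
    exact ⟨⟨c.1, h1.mp h⟩, rfl⟩
  · rintro ⟨b, rfl⟩
    exact h1.mpr b.2

/-- The coordinate ring of `X ∩ D₊(x_j)` is a quotient of the polynomial ring, hence Noetherian, and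
its dimension is at most that of `X`. The local equations supply the saturation condition of
`krullDim_primes_le`. -/
lemma krullDim_primes_le_of_ker_app [IsClosedImmersion ι] (j : Fin (n + 1)) :
    Order.krullDim {p : PrimeSpectrum (MvPolynomial (Fin (n + 1)) K) //
      Ideal.span (Set.range f) ≤ p.asIdeal ∧ MvPolynomial.X j ∉ p.asIdeal} ≤
        topologicalKrullDim X + 1 := by
  have hsurj : Function.Surjective (coordHom ι j le_rfl) := fun a ↦ by
    obtain ⟨_, g, -, h⟩ := exists_coordHom_eq ι j a
    exact ⟨g, h⟩
  have : IsNoetherianRing (Sec ι (chartOn ι j)) := isNoetherianRing_of_surjective _ _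
    (coordHom ι j le_rfl).toRingHom hsurj
  refine (krullDim_primes_le hsurj (coordHom_X_self ι j le_rfl) ?_).trans
    (add_le_add_left (ringKrullDim_sec_le ι j) 1)
  intro g D hg h0
  exact exists_pow_X_mul_mem_of_coordHom_eq_zero ι hf hker hg h0

end Geometry

/-! ### The Hilbert polynomial of a complete intersection -/

section CompleteIntersection

open MvPolynomial

lemma eq_natCast_of_add_natCast_eq {x : WithBot ℕ∞} {k n : ℕ} (h : x + k = n) :
    ∃ m : ℕ, x = (m : ℕ∞) ∧ m + k = n := by
  induction x with
  | bot => exact absurd (h.symm.trans (WithBot.bot_add _)) (WithBot.natCast_ne_bot n)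
  | coe x =>
    have h1 : x + k = n := by exact_mod_cast h
    have hx : x ≠ ⊤ := by
      rintro rfl
      rw [top_add] at h1
      exact ENat.natCast_ne_top n h1.symm
    lift x to ℕ using hx
    exact ⟨x, rfl, by exact_mod_cast h1⟩

variable {K : Type u} [Field K] {n k : ℕ} {X : Scheme.{u}} {ι : X ⟶ PSpace K n}

/-- The dimension hypothesis makes the equations a regular sequence. The Euler characteristic of
`𝒪_X(m)` is then that of the polynomial ring minus that of the ideal, which the recursion evaluates
to `hilb`. -/
theorem isHilbertPolynomial_hilb {d : ℕ → ℕ} (hd : ∀ i < k, 0 < d i)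
    (hX : IsCompleteIntersection ι fun i : Fin k ↦ d i) : IsHilbertPolynomial ι (hilb n d k) := by
  have := hX.isClosedImmersion
  obtain ⟨f, hf, hker⟩ := hX.exists_eqs
  obtain ⟨e, he, hek⟩ := eq_natCast_of_add_natCast_eq hX.dim
  -- The equations are extended by zero to all natural indices so that the induction can run over
  -- initial segments; only indices below `k` matter.
  let F (i : ℕ) : MvPolynomial (Fin (n + 1)) K := if h : i < k then f ⟨i, h⟩ else 0
  have hF (i : Fin k) : F i = f i := dif_pos i.2
  have hFd : ∀ i < k, (F i).IsHomogeneous (d i) := fun i hi ↦ by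
    have := hf ⟨i, hi⟩
    rwa [← hF] at this
  have hI : Ideal.span (Set.range f) = initialIdeal F k := by
    rw [initialIdeal]
    congr 1
    ext g
    constructor
    · rintro ⟨i, rfl⟩
      exact ⟨i, i.2, hF i⟩
    · rintro ⟨i, hi, rfl⟩
      exact ⟨⟨i, hi⟩, (hF ⟨i, hi⟩).symm⟩
  have hreg : ∀ i < k, ∀ b, F i * b ∈ initialIdeal F i → b ∈ initialIdeal F i := by
    intro i hi b hb
    -- The cone has one dimension more than `X`, hence `e + 1`, and `(e + 1) + k = n + 1`.
    refine mem_initialIdeal_of_mul_mem hFd hd (e := e + 1) (by omega) (fun j ↦ ?_) hi hb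
    have := krullDim_primes_le_of_ker_app ι hf hker j
    rw [hI, he] at this
    exact this
  have key (m : ℤ) : ∃ χ : ℤ, FinCoh n (cechComplex ι m) χ ∧
      (χ : ℚ) = (hilb n d k).eval (m : ℚ) := by
    obtain ⟨a, ha, ha'⟩ := finCoh_locDeg hFd hreg le_rfl m
    obtain ⟨b, hb, hb'⟩ := finCoh_locDeg_top (K := K) (n := n) d m
    obtain ⟨S, hS, h₁, h₂, h₃⟩ := exists_shortExact_cechComplex ι hf hker m
    rw [subCech_congr _ (monotone_locDeg (initialIdeal F k) m) (by rw [hI])] at h₁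
    rw [← h₁] at ha
    rw [← h₂] at hb
    refine ⟨b - a, h₃ ▸ FinCoh.right hS ha hb, ?_⟩
    rw [← ha', ← hb', Int.cast_sub]
  refine ⟨fun m p ↦ ?_, ?_, fun m ↦ ?_⟩
  · obtain ⟨χ, h, -⟩ := key m
    exact h.finite p
  · rw [(natDegree_hilb n d k hd e hek).1, he]
  · obtain ⟨χ, h, h'⟩ := key m
    rw [← h', ← h.euler]
    rfl

end CompleteIntersection

end ProjCI

end

theorem theorem3p2 {K : Type u} [Field K] (n k : ℕ) (hkn : k < n)
    (d : Fin k → ℕ) (hd : ∀ i, 0 < d i) (hsum : ∑ i, d i ≤ n + 1)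
    (X : AlgebraicGeometry.Scheme.{u}) (ι : X ⟶ ProjCI.PSpace K n)
    (hX : ProjCI.IsCompleteIntersection ι d)
    (hsmooth : AlgebraicGeometry.Smooth (ι ≫ ProjCI.toSpecField K n)) :
    ∃ P : Polynomial ℚ, ProjCI.IsHilbertPolynomial ι P ∧ ∀ i : ℕ, 0 ≤ P.coeff i := by
  let D (i : ℕ) : ℕ := if h : i < k then d ⟨i, h⟩ else 0
  have hD : d = fun i : Fin k ↦ D i := funext fun i ↦ by simp [D]
  have hD0 : ∀ i < k, 0 < D i := fun i hi ↦ by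
    have := hd ⟨i, hi⟩
    rwa [hD] at this
  rw [hD] at hX hsum
  rw [Fin.sum_univ_eq_sum_range] at hsum
  exact ⟨_, ProjCI.isHilbertPolynomial_hilb hD0 hX,
    ProjCI.coeff_hilb_nonneg n D k hkn hD0 hsum⟩
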